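/- Conventions. Manifolds are smooth; the contact manifold $\tilde M$ is Hausdorff and second countable. A contact form on a manifold of dimension $2n+1$ is a smooth $1$-form $\alpha$ with $\alpha\wedge(d\alpha)^n\neq 0$ everywhere; equivalently, $\alpha$ vanishes nowhere and $d\alpha$ is nondegenerate on the hyperplane $\ker\alpha$ at every point. If the circle $S^1$ acts on $U$ preserving a contact form $\alpha$, the corresponding moment map is $f:U\to\mathbb R$, $f(x)=\alpha_x(\xi_x)$, where $\xi_x=\frac{d}{dt}\big|_{t=0}e^{it}\cdot x$. Let $(\tilde M,\alpha)$ be a contact manifold of dimension $2n+1$ with contact form $\alpha$, and let $M$ be a manifold with boundary of the same dimension $2n+1$, smoothly embedded in $\tilde M$. Suppose that there are an open neighborhood $U$ of $\partial M$ in $\tilde M$ and a free smooth $S^1$-action on $U$ preserving $\alpha|_U$ such that the corresponding moment map $f:U\to\mathbb R$ satisfies 1. $f^{-1}(0)=\partial M$, and 2. $f^{-1}([0,\infty))=U\cap M$. Let $X=M/\!\sim$ with the quotient topology, where for $m\neq m'$ one has $m\sim m'$ if and only if $m,m'\in\partial M$ and $m=\lambda\cdot m'$ for some $\lambda\in S^1$.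 Let $q:M\to X$ be the quotient map, and regard $\partial M/S^1$ as a subset of $X$ by means of $q$. Then $X$ is a contact manifold, $\partial M/S^1$ is a contact submanifold of $X$, and $X\smallsetminus(\partial M/S^1)$ is contactomorphic to $M\smallsetminus\partial M$. Precisely: $X$ is Hausdorff and second countable, $\partial M$ is a smoothly embedded $2n$-dimensional submanifold of $\tilde M$, and there are a smooth structure of dimension $2n-1$ on the orbit space $\partial M/S^1$, a smooth structure of dimension $2n+1$ on $X$ (both compatible with the quotient topologies), and a contact form $\bar\alpha$ on $X$ such that * the orbit map $p:\partial M\to\partial M/S^1$ is a smooth submersion; * the natural map $j:\partial M/S^1\to X$ is a smooth embedding, $j^*\bar\alpha$ is a contact form on $\partial M/S^1$, and $p^*(j^*\bar\alpha)=\alpha|_{\partial M}$; * $q$ restricts to a diffeomorphism from $M\smallsetminus\partial M$ onto the open subset $X\smallsetminus(\partial M/S^1)$ that pulls $\bar\alpha$ back to $\alpha|_{M\smallsetminus\partial M}$; in particular it is a contactomorphism. (If $n=0$, the hypotheses force $\partial M=\emptyset$, and the assertions about $\partial M/S^1$ are empty.) -/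

import Mathlib

open Set Manifold Topology TopologicalSpace
open scoped ContDiff

noncomputable section

namespace ContactCut

section Forms

variable {E : Type*} [NormedAddCommGroup E] [NormedSpace ℝ E] {H : Type*} [TopologicalSpace H]
  (I : ModelWithCorners ℝ E H)
  {E' : Type*} [NormedAddCommGroup E'] [NormedSpace ℝ E'] {H' : Type*} [TopologicalSpace H']
  (I' : ModelWithCorners ℝ E' H')

/-- A (not necessarily continuous) differential `1`-form on `M`: a covector at each point. -/
abbrev OneForm (M : Type*) [TopologicalSpace M] [ChartedSpace H M] :=
  ∀ x : M, TangentSpace I x →L[ℝ] ℝ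

variable {M : Type*} [TopologicalSpace M] [ChartedSpace H M]
  {N : Type*} [TopologicalSpace N] [ChartedSpace H' N]

/-- The pullback `g^* α` of a `1`-form along `g : M → N`. -/
def pullback (g : M → N) (α : OneForm I' N) : OneForm I M :=
  fun x => (α (g x)).comp (mfderiv I I' g x)

/-- A `1`-form is smooth if it is a smooth section of the cotangent bundle. -/
def IsSmoothForm [IsManifold I 1 M] (α : OneForm I M) : Prop :=
  ContMDiff I (I.prod 𝓘(ℝ, E →L[ℝ] ℝ)) ∞
    (fun x : M => (Bundle.TotalSpace.mk' (E →L[ℝ] ℝ)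
      (E := fun x : M => TangentSpace I x →L[ℝ] Bundle.Trivial M ℝ x) x (α x)))

/-- The local representative of `α` in the preferred chart at `x`, that is, the pullback of `α`
by the inverse of that chart. -/
def chartRep (α : OneForm I M) (x : M) (y : E) : E →L[ℝ] ℝ :=
  (α ((extChartAt I x).symm y)).comp
    (mfderivWithin 𝓘(ℝ, E) I (extChartAt I x).symm (range I) y)

/-- The exterior derivative of a `1`-form at `x`, as a function of two tangent vectors at `x`,
computed in the preferred chart at `x`. -/
def dForm (α : OneForm I M) (x : M) (u v : TangentSpace I x) : ℝ :=
  extDerivWithin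
    (fun y => ContinuousAlternatingMap.ofSubsingleton ℝ E ℝ (0 : Fin 1) (chartRep I α x y))
    (range I) (extChartAt I x x)
    ![mfderiv I 𝓘(ℝ, E) (extChartAt I x) x u, mfderiv I 𝓘(ℝ, E) (extChartAt I x) x v]

/-- A contact form: a smooth nowhere vanishing `1`-form `α` such that `dα` is nondegenerate on
the hyperplane `ker α` at each point. In dimension `2n+1` this says `α ∧ (dα)^n ≠ 0` everywhere. -/
structure IsContactForm [IsManifold I 1 M] (α : OneForm I M) : Prop where
  smooth : IsSmoothForm I α
  ne_zero : ∀ x, α x ≠ 0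
  nondegenerate : ∀ (x : M) (u : TangentSpace I x), α x u = 0 →
    (∀ v : TangentSpace I x, α x v = 0 → dForm I α x u v = 0) → u = 0

/-- The moment map of a circle action for the form `α`: the value of `α` on the generating vector
field `d/dt|_{t=0} exp(it) • x`. -/
def momentMap [SMul Circle M] (α : OneForm I M) (x : M) : ℝ :=
  α (Circle.exp 0 • x)
    (mfderiv 𝓘(ℝ, ℝ) I (fun t : ℝ => Circle.exp t • x) 0 (1 : ℝ))

end Forms

section Cut

variable {N : Type*} [TopologicalSpace N] (U : Opens N) [MulAction Circle U]

/-- `x` and `y` lie in `U`, in the same orbit of the circle action on `U`. -/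
def SameOrbit (x y : N) : Prop :=
  ∃ (hx : x ∈ U) (hy : y ∈ U) (c : Circle), (⟨x, hx⟩ : U) = c • (⟨y, hy⟩ : U)

variable {U} in
theorem SameOrbit.symm {x y : N} : SameOrbit U x y → SameOrbit U y x := by
  rintro ⟨hx, hy, c, h⟩
  exact ⟨hy, hx, c⁻¹, by rw [h, inv_smul_smul]⟩

variable {U} in
theorem SameOrbit.trans {x y z : N} : SameOrbit U x y → SameOrbit U y z → SameOrbit U x z := by
  rintro ⟨hx, hy, c, h⟩ ⟨_, hz, d, h'⟩
  exact ⟨hx, hz, c * d, by rw [h, h', mul_smul]⟩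

variable {M : Type*} (b : Set M) (ι : M → N)

/-- The equivalence relation on `M` whose nontrivial identifications are `m ∼ λ • m` for
`m ∈ b`; here `M` is mapped to `N` by `ι` and the circle acts on `U ⊆ N`. -/
def cutSetoid : Setoid M where
  r m m' := m = m' ∨ (m ∈ b ∧ m' ∈ b ∧ SameOrbit U (ι m) (ι m'))
  iseqv :=
    { refl := fun _ => Or.inl rfl
      symm := by
        rintro m m' (h | ⟨h, h', k⟩)
        · exact Or.inl h.symm
        · exact Or.inr ⟨h', h, k.symm⟩
      trans := by
        rintro m m' m'' (rfl | ⟨h, h', k⟩) (rfl | ⟨l, l', k'⟩)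
        · exact Or.inl rfl
        · exact Or.inr ⟨l, l', k'⟩
        · exact Or.inr ⟨h, h', k⟩
        · exact Or.inr ⟨h, l', k.trans k'⟩ }

/-- The cut space `X = M / ∼`. If `M` is a topological space, it carries the quotient topology. -/
abbrev CutSpace := Quotient (cutSetoid U b ι)

/-- The orbit space `b / S¹`. It carries the quotient topology of the subspace topology of `b`. -/
abbrev BoundaryQuotient := Quotient ((cutSetoid U b ι).comap (Subtype.val : b → M))

/-- The quotient map `M → X`. -/
def cutMk (m : M) : CutSpace U b ι := Quotient.mk _ m

/-- The orbit map `b → b / S¹`. -/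
def boundaryMk (m : b) : BoundaryQuotient U b ι := Quotient.mk _ m

/-- The natural map `b / S¹ → X`. -/
def boundaryInclusion : BoundaryQuotient U b ι → CutSpace U b ι :=
  Quotient.map' (s₁ := (cutSetoid U b ι).comap (Subtype.val : b → M)) (s₂ := cutSetoid U b ι)
    Subtype.val (fun _ _ h => h)

theorem preimage_range_boundaryInclusion :
    cutMk U b ι ⁻¹' range (boundaryInclusion U b ι) = b := by
  ext m
  constructor
  · rintro ⟨⟨p⟩, hp⟩
    have h : cutMk U b ι p.1 = cutMk U b ι m := hp
    rcases Quotient.exact h with h | ⟨-, h, -⟩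
    · exact h ▸ p.2
    · exact h
  · intro hm
    exact ⟨boundaryMk U b ι ⟨m, hm⟩, rfl⟩

/-- The complement of `b / S¹` in `X`, as an open subset, for closed `b`. -/
def cutComplement [TopologicalSpace M] (hb : IsClosed b) : Opens (CutSpace U b ι) where
  carrier := (range (boundaryInclusion U b ι))ᶜ
  is_open' := by
    refine isOpen_coinduced.2 ?_
    change IsOpen (cutMk U b ι ⁻¹' (range (boundaryInclusion U b ι))ᶜ)
    rw [preimage_compl, preimage_range_boundaryInclusion]
    exact hb.isOpen_compl

/-- The complement `M ∖ b`, as an open subset, for closed `b`. -/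
def sourceComplement {M : Type*} [TopologicalSpace M] {b : Set M} (hb : IsClosed b) : Opens M :=
  ⟨bᶜ, hb.isOpen_compl⟩

end Cut

section Boundary

variable (d : ℕ) [NeZero d]
  (M : Type*) [TopologicalSpace M] [ChartedSpace (EuclideanHalfSpace d) M]

/-- The boundary `∂M` of a `d`-dimensional manifold with boundary. -/
abbrev bdry : Set M := (𝓡∂ d).boundary M

theorem isClosed_bdry [IsManifold (𝓡∂ d) ∞ M] : IsClosed (bdry d M) :=
  (𝓡∂ d).isClosed_boundary (n := ∞) (by simp)

end Boundary

end ContactCut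

end

open ContactCut

open ContactCut

noncomputable section

namespace ContactCut

section Euclidean

variable {E : Type*} [NormedAddCommGroup E] [NormedSpace ℝ E]
  {F : Type*} [NormedAddCommGroup F] [NormedSpace ℝ F]

/-- The contact condition at a point for a `1`-form on a normed space. -/
def ContactAt (η : E → E →L[ℝ] ℝ) (x : E) : Prop :=
  η x ≠ 0 ∧ ∀ u, η x u = 0 →
    (∀ v, η x v = 0 → fderiv ℝ η x u v - fderiv ℝ η x v u = 0) → u = 0

theorem ContactAt.congr {η η' : E → E →L[ℝ] ℝ} {x : E} (h : ContactAt η x)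
    (he : η' =ᶠ[𝓝 x] η) : ContactAt η' x := by
  rw [ContactAt, he.fderiv_eq, he.eq_of_nhds]
  exact h

theorem fderiv_pullback_sub {η : F → F →L[ℝ] ℝ} {g : E → F} {x : E}
    (hη : DifferentiableAt ℝ η (g x)) (hg : ContDiffAt ℝ ∞ g x) (u v : E) :
    fderiv ℝ (fun y => (η (g y)).comp (fderiv ℝ g y)) x u v
        - fderiv ℝ (fun y => (η (g y)).comp (fderiv ℝ g y)) x v u
      = fderiv ℝ η (g x) (fderiv ℝ g x u) (fderiv ℝ g x v)
        - fderiv ℝ η (g x) (fderiv ℝ g x v) (fderiv ℝ g x u) := by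
  have hg1 : DifferentiableAt ℝ g x := hg.differentiableAt (by simp)
  have hg2 : DifferentiableAt ℝ (fderiv ℝ g) x :=
    (hg.fderiv_right (m := 1) (by norm_cast)).differentiableAt (by simp)
  have hc : DifferentiableAt ℝ (fun y => η (g y)) x := hη.comp x hg1
  have hsymm : IsSymmSndFDerivAt ℝ g x :=
    hg.isSymmSndFDerivAt (by simp; norm_cast)
  have key : ∀ a b : E, fderiv ℝ (fun y => (η (g y)).comp (fderiv ℝ g y)) x a b
      = η (g x) (fderiv ℝ (fderiv ℝ g) x a b)
        + fderiv ℝ η (g x) (fderiv ℝ g x a) (fderiv ℝ g x b) := by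
    intro a b
    rw [fderiv_clm_comp hc hg2, fderiv_fun_comp x hη hg1]
    simp
  rw [key, key, hsymm.eq v u]
  ring

theorem ContactAt.pullback {η : F → F →L[ℝ] ℝ} {g : E → F} {x : E} (h : ContactAt η (g x))
    (hη : DifferentiableAt ℝ η (g x)) (hg : ContDiffAt ℝ ∞ g x)
    (hb : Function.Bijective (fderiv ℝ g x)) :
    ContactAt (fun y => (η (g y)).comp (fderiv ℝ g y)) x := by
  refine ⟨fun h0 => h.1 ?_, fun u hu hv => ?_⟩
  · ext w
    obtain ⟨v, rfl⟩ := hb.2 w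
    simpa using DFunLike.congr_fun h0 v
  · refine hb.1 ?_
    rw [map_zero]
    refine h.2 _ hu fun w hw => ?_
    obtain ⟨v, rfl⟩ := hb.2 w
    have := hv v hw
    rwa [fderiv_pullback_sub hη hg] at this

end Euclidean

section Manifold

variable {E : Type*} [NormedAddCommGroup E] [NormedSpace ℝ E]
  {F : Type*} [NormedAddCommGroup F] [NormedSpace ℝ F]
  {N : Type*} [TopologicalSpace N] [ChartedSpace E N]

theorem oneForm_congr (α : OneForm 𝓘(ℝ, E) N) {x y : N} (h : x = y) (v : E) :
    α x v = α y v := by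
  rw [h]

/-- The pullback of a `1`-form along a map defined on a normed space. -/
def pullbackRep (g : F → N) (α : OneForm 𝓘(ℝ, E) N) : F → F →L[ℝ] ℝ :=
  pullback 𝓘(ℝ, F) 𝓘(ℝ, E) g α

theorem pullbackRep_apply (g : F → N) (α : OneForm 𝓘(ℝ, E) N) (y v : F) :
    pullbackRep g α y v = α (g y) (mfderiv 𝓘(ℝ, F) 𝓘(ℝ, E) g y v) := rfl

theorem pullbackRep_congr {g g' : F → N} (α : OneForm 𝓘(ℝ, E) N) {y : F} (h : g =ᶠ[𝓝 y] g') :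
    pullbackRep g α y = pullbackRep g' α y := by
  ext v
  rw [pullbackRep_apply, pullbackRep_apply, h.mfderiv_eq]
  have := h.eq_of_nhds
  rw [this]

theorem chartRep_eq (α : OneForm 𝓘(ℝ, E) N) (x : N) :
    chartRep 𝓘(ℝ, E) α x = pullbackRep (extChartAt 𝓘(ℝ, E) x).symm α := by
  ext y v
  have h : range (𝓘(ℝ, E) : E → E) = univ := by simp
  rw [chartRep, h, mfderivWithin_univ]
  rfl

variable [IsManifold 𝓘(ℝ, E) ∞ N]

theorem chartRep_apply_self (α : OneForm 𝓘(ℝ, E) N) (x : N) :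
    chartRep 𝓘(ℝ, E) α x (extChartAt 𝓘(ℝ, E) x x) = α x := by
  have h1 := mfderivWithin_range_extChartAt_symm (I := 𝓘(ℝ, E)) (x := x)
  have h2 := extChartAt_to_inv (I := 𝓘(ℝ, E)) x
  ext v
  simp only [chartRep]
  rw [h1]
  change α _ v = α x v
  rw [h2]

theorem dForm_eq (α : OneForm 𝓘(ℝ, E) N) (x : N)
    (h : DifferentiableAt ℝ (chartRep 𝓘(ℝ, E) α x) (extChartAt 𝓘(ℝ, E) x x)) (u v : E) :
    dForm 𝓘(ℝ, E) α x u v =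
      fderiv ℝ (chartRep 𝓘(ℝ, E) α x) (extChartAt 𝓘(ℝ, E) x x) u v
        - fderiv ℝ (chartRep 𝓘(ℝ, E) α x) (extChartAt 𝓘(ℝ, E) x x) v u := by
  have h1 := mfderiv_extChartAt_self (I := 𝓘(ℝ, E)) (x := x)
  have hr : range (𝓘(ℝ, E) : E → E) = univ := by simp
  set y₀ : E := extChartAt 𝓘(ℝ, E) x x with hy
  have h0 : dForm 𝓘(ℝ, E) α x u v = extDeriv (fun y =>
      ContinuousAlternatingMap.ofSubsingleton ℝ E ℝ (0 : Fin 1) (chartRep 𝓘(ℝ, E) α x y)) y₀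
      ![u, v] := by
    simp only [dForm]
    rw [h1, hr, extDerivWithin_univ]
    rfl
  have hd : DifferentiableAt ℝ (fun y => ContinuousAlternatingMap.ofSubsingleton ℝ E ℝ (0 : Fin 1)
      (chartRep 𝓘(ℝ, E) α x y)) y₀ := by
    exact ((ContinuousAlternatingMap.ofSubsingletonLIE (𝕜 := ℝ) (E := E) (F := ℝ) (0 : Fin 1)
      ).toContinuousLinearEquiv.differentiableAt).comp _ h
  have key : ∀ w w' : E, fderiv ℝ (fun y => chartRep 𝓘(ℝ, E) α x y w) y₀ w'
      = fderiv ℝ (chartRep 𝓘(ℝ, E) α x) y₀ w' w := by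
    intro w w'
    rw [fderiv_clm_apply h (differentiableAt_const w)]
    simp
  rw [h0, extDeriv_apply hd, ← key, ← key]
  simp [Fin.sum_univ_two, Fin.removeNth, sub_eq_add_neg]

theorem isSmoothForm_iff (α : OneForm 𝓘(ℝ, E) N) : IsSmoothForm 𝓘(ℝ, E) α ↔
    ∀ x, ContDiffAt ℝ ∞ (chartRep 𝓘(ℝ, E) α x) (extChartAt 𝓘(ℝ, E) x x) := by
  refine forall_congr' fun x₀ => ?_
  have hr : range (𝓘(ℝ, E) : E → E) = univ := by simp
  rw [contMDiffAt_hom_bundle]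
  refine (and_iff_right contMDiffAt_id).trans ?_
  have hev : (fun x => ContinuousLinearMap.inCoordinates E (TangentSpace 𝓘(ℝ, E)) ℝ
      (Bundle.Trivial N ℝ) x₀ x x₀ x (α x))
      =ᶠ[𝓝 x₀] fun x => chartRep 𝓘(ℝ, E) α x₀ (extChartAt 𝓘(ℝ, E) x₀ x) := by
    filter_upwards [chart_source_mem_nhds E x₀] with x hx
    have hl : (extChartAt 𝓘(ℝ, E) x₀).symm (extChartAt 𝓘(ℝ, E) x₀ x) = x :=
      (extChartAt 𝓘(ℝ, E) x₀).left_inv (by simpa using hx)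
    have h1 := TangentBundle.symmL_trivializationAt (I := 𝓘(ℝ, E)) hx
    rw [ContinuousLinearMap.inCoordinates, h1]
    ext v
    have h2 : Bundle.Trivialization.continuousLinearMapAt ℝ
        (trivializationAt ℝ (Bundle.Trivial N ℝ) x₀) x = ContinuousLinearMap.id ℝ ℝ := by
      simp
    rw [h2]
    exact oneForm_congr α hl.symm _
  refine (Filter.EventuallyEq.contMDiffAt_iff hev).trans ?_
  rw [contMDiffAt_iff_source, hr, contMDiffWithinAt_univ, contMDiffAt_iff_contDiffAt]
  suffices h : ((fun x => chartRep 𝓘(ℝ, E) α x₀ (extChartAt 𝓘(ℝ, E) x₀ x)) ∘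
      (extChartAt 𝓘(ℝ, E) x₀).symm) =ᶠ[𝓝 (extChartAt 𝓘(ℝ, E) x₀ x₀)] chartRep 𝓘(ℝ, E) α x₀ from
    ⟨fun k => k.congr_of_eventuallyEq h.symm, fun k => k.congr_of_eventuallyEq h⟩
  filter_upwards [extChartAt_target_mem_nhds (I := 𝓘(ℝ, E)) x₀] with y hy
  rw [Function.comp_apply, (extChartAt 𝓘(ℝ, E) x₀).right_inv hy]

theorem IsSmoothForm.contDiffAt_chartRep {α : OneForm 𝓘(ℝ, E) N} (hα : IsSmoothForm 𝓘(ℝ, E) α)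
    (x : N) : ContDiffAt ℝ ∞ (chartRep 𝓘(ℝ, E) α x) (extChartAt 𝓘(ℝ, E) x x) :=
  (isSmoothForm_iff α).1 hα x

theorem isContactForm_iff (α : OneForm 𝓘(ℝ, E) N) : IsContactForm 𝓘(ℝ, E) α ↔
    ∀ x, ContDiffAt ℝ ∞ (chartRep 𝓘(ℝ, E) α x) (extChartAt 𝓘(ℝ, E) x x) ∧
      ContactAt (chartRep 𝓘(ℝ, E) α x) (extChartAt 𝓘(ℝ, E) x x) := by
  have key : ∀ x, ContDiffAt ℝ ∞ (chartRep 𝓘(ℝ, E) α x) (extChartAt 𝓘(ℝ, E) x x) →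
      (ContactAt (chartRep 𝓘(ℝ, E) α x) (extChartAt 𝓘(ℝ, E) x x) ↔
        α x ≠ 0 ∧ ∀ u : TangentSpace 𝓘(ℝ, E) x, α x u = 0 →
          (∀ v : TangentSpace 𝓘(ℝ, E) x, α x v = 0 → dForm 𝓘(ℝ, E) α x u v = 0) → u = 0) := by
    intro x hx
    rw [ContactAt, chartRep_apply_self]
    refine and_congr Iff.rfl (forall_congr' fun u => imp_congr Iff.rfl (imp_congr ?_ Iff.rfl))
    refine forall_congr' fun v => imp_congr Iff.rfl ?_
    rw [dForm_eq α x (hx.differentiableAt (by simp))]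
  constructor
  · intro h x
    have hx := h.smooth.contDiffAt_chartRep x
    exact ⟨hx, (key x hx).2 ⟨h.ne_zero x, h.nondegenerate x⟩⟩
  · intro h
    exact ⟨(isSmoothForm_iff α).2 fun x => (h x).1, fun x => ((key x (h x).1).1 (h x).2).1,
      fun x => ((key x (h x).1).1 (h x).2).2⟩

/-- Pulling back in two steps: through the preferred chart at a point of the target. -/
theorem pullbackRep_eventuallyEq {g : F → N} (α : OneForm 𝓘(ℝ, E) N) {y₀ : F}
    (hg : ContMDiffAt 𝓘(ℝ, F) 𝓘(ℝ, E) ∞ g y₀) :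
    pullbackRep g α =ᶠ[𝓝 y₀] fun y =>
      (chartRep 𝓘(ℝ, E) α (g y₀) (extChartAt 𝓘(ℝ, E) (g y₀) (g y))).comp
        (fderiv ℝ (fun y => extChartAt 𝓘(ℝ, E) (g y₀) (g y)) y) := by
  have hs : ∀ᶠ y in 𝓝 y₀, g y ∈ (chartAt E (g y₀)).source :=
    hg.continuousAt.preimage_mem_nhds (chart_source_mem_nhds E (g y₀))
  have h1 : ∀ᶠ y in 𝓝 y₀, ContMDiffAt 𝓘(ℝ, F) 𝓘(ℝ, E) 1 g y :=
    
    (contMDiffAt_iff_contMDiffAt_nhds (by simp)).1 (hg.of_le (by norm_cast : (1 : ℕ∞ω) ≤ ∞))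
  filter_upwards [hs, h1] with y hy hgy
  set φ := extChartAt 𝓘(ℝ, E) (g y₀)
  have hl : φ.symm (φ (g y)) = g y := φ.left_inv (by simpa [φ] using hy)
  have hφ : MDifferentiableAt 𝓘(ℝ, E) 𝓘(ℝ, E) φ (g y) := mdifferentiableAt_extChartAt hy
  have hgd : MDifferentiableAt 𝓘(ℝ, F) 𝓘(ℝ, E) g y := hgy.mdifferentiableAt (by simp)
  have hcomp : fderiv ℝ (fun y => φ (g y)) y
      = (mfderiv 𝓘(ℝ, E) 𝓘(ℝ, E) φ (g y)).comp (mfderiv 𝓘(ℝ, F) 𝓘(ℝ, E) g y) := by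
    rw [← mfderiv_eq_fderiv]
    exact mfderiv_comp y hφ hgd
  have hinv := mfderivWithin_extChartAt_symm_comp_mfderiv_extChartAt' (I := 𝓘(ℝ, E))
    (x := g y₀) (y := g y) (by simpa using hy)
  ext v
  rw [hcomp, pullbackRep_apply]
  have h3 : (mfderivWithin 𝓘(ℝ, E) 𝓘(ℝ, E) φ.symm (range 𝓘(ℝ, E)) (φ (g y)))
      (mfderiv 𝓘(ℝ, E) 𝓘(ℝ, E) φ (g y) (mfderiv 𝓘(ℝ, F) 𝓘(ℝ, E) g y v))
      = mfderiv 𝓘(ℝ, F) 𝓘(ℝ, E) g y v := DFunLike.congr_fun hinv _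
  have h4 : α (φ.symm (φ (g y))) ((mfderivWithin 𝓘(ℝ, E) 𝓘(ℝ, E) φ.symm (range 𝓘(ℝ, E)) (φ (g y)))
      (mfderiv 𝓘(ℝ, E) 𝓘(ℝ, E) φ (g y) (mfderiv 𝓘(ℝ, F) 𝓘(ℝ, E) g y v)))
      = α (g y) (mfderiv 𝓘(ℝ, F) 𝓘(ℝ, E) g y v) := by
    refine (oneForm_congr α hl _).trans ?_
    exact congrArg (α (g y)) h3
  exact h4.symm

omit [IsManifold 𝓘(ℝ, E) ∞ N] in
theorem extChartAt_comp_contDiffAt {g : F → N} {y₀ : F}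
    (hg : ContMDiffAt 𝓘(ℝ, F) 𝓘(ℝ, E) ∞ g y₀) :
    ContDiffAt ℝ ∞ (fun y => extChartAt 𝓘(ℝ, E) (g y₀) (g y)) y₀ := by
  rw [← contMDiffAt_iff_contDiffAt]
  exact (contMDiffAt_extChartAt (n := ∞)).comp y₀ hg

theorem IsSmoothForm.contDiffAt_pullbackRep {α : OneForm 𝓘(ℝ, E) N}
    (hα : IsSmoothForm 𝓘(ℝ, E) α) {g : F → N} {y₀ : F}
    (hg : ContMDiffAt 𝓘(ℝ, F) 𝓘(ℝ, E) ∞ g y₀) : ContDiffAt ℝ ∞ (pullbackRep g α) y₀ := by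
  refine ContDiffAt.congr_of_eventuallyEq ?_ (pullbackRep_eventuallyEq α hg)
  have h := extChartAt_comp_contDiffAt hg
  refine ContDiffAt.clm_comp ?_ (h.fderiv_right (m := ∞) (by norm_cast))
  exact (hα.contDiffAt_chartRep (g y₀)).comp y₀ h

theorem IsContactForm.contactAt_pullbackRep {α : OneForm 𝓘(ℝ, E) N}
    (hα : IsContactForm 𝓘(ℝ, E) α) {g : F → N} {y₀ : F}
    (hg : ContMDiffAt 𝓘(ℝ, F) 𝓘(ℝ, E) ∞ g y₀)
    (hb : Function.Bijective (mfderiv 𝓘(ℝ, F) 𝓘(ℝ, E) g y₀)) :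
    ContactAt (pullbackRep g α) y₀ := by
  refine ContactAt.congr ?_ (pullbackRep_eventuallyEq α hg)
  have hc := (isContactForm_iff α).1 hα (g y₀)
  refine ContactAt.pullback hc.2 (hc.1.differentiableAt (by simp)) (extChartAt_comp_contDiffAt hg)
    ?_
  have hcomp : fderiv ℝ (fun y => extChartAt 𝓘(ℝ, E) (g y₀) (g y)) y₀
      = (mfderiv 𝓘(ℝ, E) 𝓘(ℝ, E) (extChartAt 𝓘(ℝ, E) (g y₀)) (g y₀)).comp
        (mfderiv 𝓘(ℝ, F) 𝓘(ℝ, E) g y₀) := by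
    rw [← mfderiv_eq_fderiv]
    exact mfderiv_comp y₀ (mdifferentiableAt_extChartAt (mem_chart_source E _))
      (hg.mdifferentiableAt (by simp))
  rw [hcomp, mfderiv_extChartAt_self]
  exact hb

end Manifold
end ContactCut

namespace ContactCut

section InverseFunction

variable {E : Type*} [NormedAddCommGroup E] [NormedSpace ℝ E] [CompleteSpace E]
  {F : Type*} [NormedAddCommGroup F] [NormedSpace ℝ F]

/-- The inverse function theorem, with a smooth inverse on an open set. -/
theorem exists_openPartialHomeomorph_of_hasFDerivAt {g : E → F} {O : Set E} (hO : IsOpen O)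
    (hg : ContDiffOn ℝ ∞ g O) {x : E} (hx : x ∈ O) (A : E ≃L[ℝ] F)
    (hA : HasFDerivAt g (A : E →L[ℝ] F) x) :
    ∃ e : OpenPartialHomeomorph E F, x ∈ e.source ∧ e.source ⊆ O ∧ (∀ y, e y = g y) ∧
      ContDiffOn ℝ ∞ e.symm e.target := by
  have hgx : ContDiffAt ℝ ∞ g x := hg.contDiffAt (hO.mem_nhds hx)
  set e₀ := hgx.toOpenPartialHomeomorph g hA (by simp) with he₀
  have hcont : ContinuousOn (fderiv ℝ g) O := hg.continuousOn_fderiv_of_isOpen hO (by simp)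
  set O' := O ∩ fderiv ℝ g ⁻¹' range ((↑) : (E ≃L[ℝ] F) → E →L[ℝ] F) with hO'
  have hO'o : IsOpen O' := hcont.isOpen_inter_preimage hO ContinuousLinearEquiv.isOpen
  refine ⟨e₀.restrOpen O' hO'o, ⟨?_, hx, A, hA.fderiv.symm⟩, fun y hy => hy.2.1, fun y => rfl, ?_⟩
  · exact hgx.mem_toOpenPartialHomeomorph_source hA (by simp)
  · intro y hy
    have hs := (e₀.restrOpen O' hO'o).map_target hy
    obtain ⟨B, hB⟩ := hs.2.2
    have hsm : ContDiffAt ℝ ∞ g ((e₀.restrOpen O' hO'o).symm y) :=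
      hg.contDiffAt (hO.mem_nhds hs.2.1)
    refine (OpenPartialHomeomorph.contDiffAt_symm (f := e₀.restrOpen O' hO'o) (f₀' := B) hy ?_
      hsm).contDiffWithinAt
    rw [hB]
    exact (hsm.differentiableAt (by simp)).hasFDerivAt

end InverseFunction

section Family

variable {E : Type*} [NormedAddCommGroup E] [NormedSpace ℝ E] {X : Type*} [TopologicalSpace X]

/-- A smooth atlas on `X` modelled on `E`, as an indexed family of charts. -/
structure ChartFamily (E : Type*) [NormedAddCommGroup E] [NormedSpace ℝ E] (X : Type*)
    [TopologicalSpace X] where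
  /-- the index type -/
  Index : Type*
  /-- the charts -/
  chart : Index → OpenPartialHomeomorph X E
  /-- the preferred chart at a point -/
  pick : X → Index
  mem_pick : ∀ x, x ∈ (chart (pick x)).source
  smooth : ∀ i j y, y ∈ (chart i).target → (chart i).symm y ∈ (chart j).source →
    ContDiffAt ℝ ∞ (fun z => chart j ((chart i).symm z)) y

namespace ChartFamily

variable (𝒜 : ChartFamily E X)

/-- The charted space structure given by a family of charts. -/
@[reducible] def chartedSpace : ChartedSpace E X where
  atlas := range 𝒜.chart
  chartAt x := 𝒜.chart (𝒜.pick x)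
  mem_chart_source := 𝒜.mem_pick
  chart_mem_atlas x := ⟨𝒜.pick x, rfl⟩

theorem isManifold : letI := 𝒜.chartedSpace; IsManifold 𝓘(ℝ, E) ∞ X := by
  let _ := 𝒜.chartedSpace
  refine isManifold_of_contDiffOn _ _ _ ?_
  rintro _ _ ⟨i, rfl⟩ ⟨j, rfl⟩ y hy
  simp only [modelWithCornersSelf_coe, modelWithCornersSelf_coe_symm] at hy ⊢
  have hy' := hy.1
  simp only [preimage_id_eq, id] at hy'
  exact (𝒜.smooth i j y hy'.1 hy'.2).contDiffWithinAt

theorem chart_mem_maximalAtlas (i : 𝒜.Index) :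
    letI := 𝒜.chartedSpace; 𝒜.chart i ∈ IsManifold.maximalAtlas 𝓘(ℝ, E) ∞ X := by
  let _ := 𝒜.chartedSpace
  have := 𝒜.isManifold
  exact IsManifold.subset_maximalAtlas ⟨i, rfl⟩

theorem contMDiffOn_chart (i : 𝒜.Index) : letI := 𝒜.chartedSpace
    ContMDiffOn 𝓘(ℝ, E) 𝓘(ℝ, E) ∞ (𝒜.chart i) (𝒜.chart i).source := by
  let _ := 𝒜.chartedSpace
  have := 𝒜.isManifold
  exact contMDiffOn_of_mem_maximalAtlas (𝒜.chart_mem_maximalAtlas i)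

theorem contMDiffOn_chart_symm (i : 𝒜.Index) : letI := 𝒜.chartedSpace
    ContMDiffOn 𝓘(ℝ, E) 𝓘(ℝ, E) ∞ (𝒜.chart i).symm (𝒜.chart i).target := by
  let _ := 𝒜.chartedSpace
  have := 𝒜.isManifold
  exact contMDiffOn_symm_of_mem_maximalAtlas (𝒜.chart_mem_maximalAtlas i)

/-- The `1`-form with representatives `b i` in the charts of the family. -/
def glue (b : 𝒜.Index → E → E →L[ℝ] ℝ) : letI := 𝒜.chartedSpace; OneForm 𝓘(ℝ, E) X :=
  letI := 𝒜.chartedSpace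
  fun x => b (𝒜.pick x) (𝒜.chart (𝒜.pick x) x)

theorem pullbackRep_glue {b : 𝒜.Index → E → E →L[ℝ] ℝ}
    (hb : ∀ i j y, y ∈ (𝒜.chart i).target → (𝒜.chart i).symm y ∈ (𝒜.chart j).source →
      b i y = (b j (𝒜.chart j ((𝒜.chart i).symm y))).comp
        (fderiv ℝ (fun z => 𝒜.chart j ((𝒜.chart i).symm z)) y))
    (i : 𝒜.Index) {y : E} (hy : y ∈ (𝒜.chart i).target) :
    letI := 𝒜.chartedSpace
    pullbackRep (𝒜.chart i).symm (𝒜.glue b) y = b i y := by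
  let _ := 𝒜.chartedSpace
  have := 𝒜.isManifold
  set x := (𝒜.chart i).symm y with hx
  set j := 𝒜.pick x with hj
  have hxj : x ∈ (𝒜.chart j).source := 𝒜.mem_pick x
  have hd : MDifferentiableAt 𝓘(ℝ, E) 𝓘(ℝ, E) (𝒜.chart i).symm y :=
    ((𝒜.contMDiffOn_chart_symm i).contMDiffAt
      ((𝒜.chart i).open_target.mem_nhds hy)).mdifferentiableAt (by simp)
  have hj' : MDifferentiableAt 𝓘(ℝ, E) 𝓘(ℝ, E) (extChartAt 𝓘(ℝ, E) x) x :=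
    mdifferentiableAt_extChartAt (mem_chart_source E x)
  have hself := mfderiv_extChartAt_self (I := 𝓘(ℝ, E)) (x := x)
  have hcomp : fderiv ℝ (fun z => 𝒜.chart j ((𝒜.chart i).symm z)) y
      = (mfderiv 𝓘(ℝ, E) 𝓘(ℝ, E) (extChartAt 𝓘(ℝ, E) x) x).comp
          (mfderiv 𝓘(ℝ, E) 𝓘(ℝ, E) (𝒜.chart i).symm y) := by
    rw [← mfderiv_eq_fderiv]
    exact mfderiv_comp y hj' hd
  rw [hb i j y hy hxj, hcomp, hself]
  rfl

theorem isContactForm {β : letI := 𝒜.chartedSpace; OneForm 𝓘(ℝ, E) X}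
    {b : 𝒜.Index → E → E →L[ℝ] ℝ}
    (hβ : letI := 𝒜.chartedSpace
      ∀ i, ∀ y ∈ (𝒜.chart i).target, pullbackRep (𝒜.chart i).symm β y = b i y)
    (hb : ∀ i, ∀ y ∈ (𝒜.chart i).target, ContDiffAt ℝ ∞ (b i) y ∧ ContactAt (b i) y) :
    letI := 𝒜.chartedSpace
    haveI := 𝒜.isManifold
    IsContactForm 𝓘(ℝ, E) β := by
  let _ := 𝒜.chartedSpace
  have := 𝒜.isManifold
  refine (isContactForm_iff β).2 fun x => ?_
  set i := 𝒜.pick x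
  have hx : 𝒜.chart i x ∈ (𝒜.chart i).target := (𝒜.chart i).map_source (𝒜.mem_pick x)
  have he : chartRep 𝓘(ℝ, E) β x =ᶠ[𝓝 (𝒜.chart i x)] b i := by
    rw [chartRep_eq]
    filter_upwards [(𝒜.chart i).open_target.mem_nhds hx] with y hy
    exact hβ i y hy
  exact ⟨(hb i _ hx).1.congr_of_eventuallyEq he, (hb i _ hx).2.congr he⟩

end ChartFamily
end Family
end ContactCut

namespace ContactCut

variable {E : Type*} [NormedAddCommGroup E] [NormedSpace ℝ E]
  {N : Type*} [TopologicalSpace N] [ChartedSpace E N]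

/-- A free smooth circle action on an open subset `dom` of `N` preserving the `1`-form `α`,
extended to a function on all of `N`. -/
structure LocalCircleAction (α : OneForm 𝓘(ℝ, E) N) where
  /-- the domain of the action -/
  dom : Set N
  /-- the action -/
  act : Circle → N → N
  isOpen_dom : IsOpen dom
  act_mem : ∀ c, ∀ x ∈ dom, act c x ∈ dom
  act_one : ∀ x ∈ dom, act 1 x = x
  act_mul : ∀ c d, ∀ x ∈ dom, act (c * d) x = act c (act d x)
  act_free : ∀ c, ∀ x ∈ dom, act c x = x → c = 1
  smooth : ContMDiffOn ((𝓡 1).prod 𝓘(ℝ, E)) 𝓘(ℝ, E) ∞ (fun p : Circle × N => act p.1 p.2)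
    (univ ×ˢ dom)
  invariant : ∀ c, ∀ x ∈ dom, ∀ v : TangentSpace 𝓘(ℝ, E) x,
    α (act c x) (mfderiv 𝓘(ℝ, E) 𝓘(ℝ, E) (act c) x v) = α x v

namespace LocalCircleAction

variable {α : OneForm 𝓘(ℝ, E) N} (𝒰 : LocalCircleAction α)

/-- The moment map of the action. -/
def moment (x : N) : ℝ :=
  α (𝒰.act (Circle.exp 0) x) (mfderiv 𝓘(ℝ, ℝ) 𝓘(ℝ, E) (fun t : ℝ => 𝒰.act (Circle.exp t) x) 0
    (1 : ℝ))

theorem act_exp_zero {x : N} (hx : x ∈ 𝒰.dom) : 𝒰.act (Circle.exp 0) x = x := by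
  rw [Circle.exp_zero, 𝒰.act_one x hx]

theorem act_inv_act (c : Circle) {x : N} (hx : x ∈ 𝒰.dom) : 𝒰.act c⁻¹ (𝒰.act c x) = x := by
  rw [← 𝒰.act_mul _ _ _ hx, inv_mul_cancel, 𝒰.act_one x hx]

theorem act_act_inv (c : Circle) {x : N} (hx : x ∈ 𝒰.dom) : 𝒰.act c (𝒰.act c⁻¹ x) = x := by
  rw [← 𝒰.act_mul _ _ _ hx, mul_inv_cancel, 𝒰.act_one x hx]

theorem contMDiffAt_act {F : Type*} [NormedAddCommGroup F] [NormedSpace ℝ F] {H : Type*}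
    [TopologicalSpace H] {I : ModelWithCorners ℝ F H} {P : Type*} [TopologicalSpace P]
    [ChartedSpace H P] {c : P → Circle} {g : P → N} {p : P} (hc : ContMDiffAt I (𝓡 1) ∞ c p)
    (hg : ContMDiffAt I 𝓘(ℝ, E) ∞ g p) (hp : g p ∈ 𝒰.dom) :
    ContMDiffAt I 𝓘(ℝ, E) ∞ (fun p => 𝒰.act (c p) (g p)) p :=
  (𝒰.smooth.contMDiffAt ((isOpen_univ.prod 𝒰.isOpen_dom).mem_nhds ⟨mem_univ _, hp⟩)).comp p
    (hc.prodMk hg)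

theorem contMDiffAt_act_const (c : Circle) {x : N} (hx : x ∈ 𝒰.dom) :
    ContMDiffAt 𝓘(ℝ, E) 𝓘(ℝ, E) ∞ (𝒰.act c) x :=
  𝒰.contMDiffAt_act contMDiffAt_const contMDiffAt_id hx

theorem continuousOn_act : ContinuousOn (fun p : Circle × N => 𝒰.act p.1 p.2) (univ ×ˢ 𝒰.dom) :=
  𝒰.smooth.continuousOn

theorem contMDiffAt_orbit {x : N} (hx : x ∈ 𝒰.dom) (t : ℝ) :
    ContMDiffAt 𝓘(ℝ, ℝ) 𝓘(ℝ, E) ∞ (fun t : ℝ => 𝒰.act (Circle.exp t) x) t :=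
  𝒰.contMDiffAt_act contMDiff_circleExp.contMDiffAt contMDiffAt_const hx

section Flow

variable {V : Type*} [NormedAddCommGroup V] [NormedSpace ℝ V] {s : V → N}

/-- The map `(τ, v) ↦ exp(iτ) • s v`. -/
def flowOut (s : V → N) (p : ℝ × V) : N := 𝒰.act (Circle.exp p.1) (s p.2)

theorem contMDiffAt_flowOut {p : ℝ × V} (hs : ContMDiffAt 𝓘(ℝ, V) 𝓘(ℝ, E) ∞ s p.2)
    (hp : s p.2 ∈ 𝒰.dom) : ContMDiffAt 𝓘(ℝ, ℝ × V) 𝓘(ℝ, E) ∞ (𝒰.flowOut s) p := by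
  refine 𝒰.contMDiffAt_act (c := fun p : ℝ × V => Circle.exp p.1) ?_ ?_ hp
  · exact contMDiff_circleExp.contMDiffAt.comp p contDiffAt_fst.contMDiffAt
  · exact ContMDiffAt.comp p hs contDiffAt_snd.contMDiffAt

omit [NormedAddCommGroup V] [NormedSpace ℝ V] in
theorem flowOut_zero {v : V} (hv : s v ∈ 𝒰.dom) : 𝒰.flowOut s (0, v) = s v :=
  𝒰.act_exp_zero hv

omit [NormedAddCommGroup V] [NormedSpace ℝ V] in
theorem flowOut_add {v : V} (hv : s v ∈ 𝒰.dom) (t τ : ℝ) :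
    𝒰.flowOut s (t + τ, v) = 𝒰.act (Circle.exp t) (𝒰.flowOut s (τ, v)) := by
  simp only [flowOut]
  rw [Circle.exp_add, 𝒰.act_mul _ _ _ hv]

theorem pullbackRep_act {F : Type*} [NormedAddCommGroup F] [NormedSpace ℝ F] (c : Circle)
    {g : F → N} {y : F} (hg : ContMDiffAt 𝓘(ℝ, F) 𝓘(ℝ, E) ∞ g y) (hy : g y ∈ 𝒰.dom) :
    pullbackRep (fun y => 𝒰.act c (g y)) α y = pullbackRep g α y := by
  ext v
  rw [pullbackRep_apply, pullbackRep_apply]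
  have := mfderiv_comp y ((𝒰.contMDiffAt_act_const c hy).mdifferentiableAt (by simp))
    (hg.mdifferentiableAt (by simp))
  rw [← 𝒰.invariant c (g y) hy]
  exact congrArg (α (𝒰.act c (g y))) (DFunLike.congr_fun this v)

theorem pullbackRep_flowOut {v : V} (hs : ContMDiffAt 𝓘(ℝ, V) 𝓘(ℝ, E) ∞ s v)
    (hv : s v ∈ 𝒰.dom) (τ : ℝ) (a : ℝ × V) :
    pullbackRep (𝒰.flowOut s) α (τ, v) a = a.1 * 𝒰.moment (s v) + pullbackRep s α v a.2 := by
  have hA : ∀ t : ℝ, MDifferentiableAt 𝓘(ℝ, ℝ × V) 𝓘(ℝ, E) (𝒰.flowOut s) (t, v) := fun t =>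
    (𝒰.contMDiffAt_flowOut (p := (t, v)) hs hv).mdifferentiableAt (by simp)
  have h1 : pullbackRep (𝒰.flowOut s) α (0, v) (1, 0) = 𝒰.moment (s v) := by
    have hl : MDifferentiableAt 𝓘(ℝ, ℝ) 𝓘(ℝ, ℝ × V) (fun t : ℝ => (t, v)) 0 :=
      (by fun_prop : DifferentiableAt ℝ (fun t : ℝ => (t, v)) 0).mdifferentiableAt
    have hc := mfderiv_comp (I := 𝓘(ℝ, ℝ)) (0 : ℝ) (hA 0) hl
    have hl' : mfderiv 𝓘(ℝ, ℝ) 𝓘(ℝ, ℝ × V) (fun t : ℝ => (t, v)) 0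
        = ContinuousLinearMap.inl ℝ ℝ V := by
      rw [mfderiv_eq_fderiv]
      exact (hasFDerivAt_prodMk_left (𝕜 := ℝ) (0 : ℝ) v).fderiv
    rw [hl'] at hc
    have h := DFunLike.congr_fun hc (1 : ℝ)
    refine (congrArg (α (𝒰.flowOut s (0, v))) h).symm
  have h2 : ∀ w, pullbackRep (𝒰.flowOut s) α (0, v) (0, w) = pullbackRep s α v w := by
    intro w
    have hl : MDifferentiableAt 𝓘(ℝ, V) 𝓘(ℝ, ℝ × V) (fun v : V => ((0 : ℝ), v)) v :=
      (by fun_prop : DifferentiableAt ℝ (fun v : V => ((0 : ℝ), v)) v).mdifferentiableAt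
    have hc := mfderiv_comp (I := 𝓘(ℝ, V)) v (hA 0) hl
    have hl' : mfderiv 𝓘(ℝ, V) 𝓘(ℝ, ℝ × V) (fun v : V => ((0 : ℝ), v)) v
        = ContinuousLinearMap.inr ℝ ℝ V := by
      rw [mfderiv_eq_fderiv]
      exact (hasFDerivAt_prodMk_right (𝕜 := ℝ) (0 : ℝ) v).fderiv
    rw [hl'] at hc
    have h := DFunLike.congr_fun hc w
    refine (congrArg (α (𝒰.flowOut s (0, v))) h).symm.trans ?_
    change pullbackRep (fun v => 𝒰.act (Circle.exp 0) (s v)) α v w = _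
    rw [𝒰.pullbackRep_act _ hs hv]
  have h3 : pullbackRep (𝒰.flowOut s) α (τ, v) = pullbackRep (𝒰.flowOut s) α (0, v) := by
    have hev : (fun p : ℝ × V => 𝒰.flowOut s ((τ, 0) + p)) =ᶠ[𝓝 (0, v)]
        fun p => 𝒰.act (Circle.exp τ) (𝒰.flowOut s p) := by
      have : ∀ᶠ p : ℝ × V in 𝓝 (0, v), s p.2 ∈ 𝒰.dom :=
        (hs.continuousAt.comp (f := Prod.snd) (x := ((0 : ℝ), v))
          continuousAt_snd).preimage_mem_nhds (𝒰.isOpen_dom.mem_nhds hv)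
      filter_upwards [this] with p hp
      have := 𝒰.flowOut_add hp τ p.1
      rw [← this]
      congr 1
      ext <;> simp
    have e1 := pullbackRep_congr α hev
    rw [𝒰.pullbackRep_act _ (𝒰.contMDiffAt_flowOut (p := (0, v)) hs hv)
      (𝒰.act_mem _ _ hv)] at e1
    rw [← e1]
    refine ContinuousLinearMap.ext fun a => ?_
    have hshift : mfderiv 𝓘(ℝ, ℝ × V) 𝓘(ℝ, ℝ × V) (fun p : ℝ × V => (τ, (0 : V)) + p) (0, v)
        = ContinuousLinearMap.id ℝ (ℝ × V) := by
      rw [mfderiv_eq_fderiv, fderiv_const_add]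
      exact fderiv_id
    have hsd : MDifferentiableAt 𝓘(ℝ, ℝ × V) 𝓘(ℝ, ℝ × V) (fun p : ℝ × V => (τ, (0 : V)) + p) (0, v) :=
      (by fun_prop : DifferentiableAt ℝ (fun p : ℝ × V => (τ, (0 : V)) + p) (0, v)).mdifferentiableAt
    have hpt : (τ, (0 : V)) + (0, v) = (τ, v) := by simp
    have hc := mfderiv_comp (I := 𝓘(ℝ, ℝ × V)) (0, v) (hpt ▸ hA τ) hsd
    rw [hshift] at hc
    have h := DFunLike.congr_fun hc a
    have h' := congrArg (α (𝒰.flowOut s ((τ, (0 : V)) + (0, v)))) h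
    refine Eq.trans ?_ h'.symm
    change pullbackRep (𝒰.flowOut s) α (τ, v) a
      = pullbackRep (𝒰.flowOut s) α ((τ, (0 : V)) + (0, v)) a
    rw [hpt]
  have ha : a = a.1 • ((1 : ℝ), (0 : V)) + (0, a.2) := by ext <;> simp
  rw [h3]
  conv_lhs => rw [ha]
  rw [map_add, map_smul, h1, h2, smul_eq_mul]

end Flow

theorem moment_act (c : Circle) {x : N} (hx : x ∈ 𝒰.dom) : 𝒰.moment (𝒰.act c x) = 𝒰.moment x := by
  have h : (fun t : ℝ => 𝒰.act (Circle.exp t) (𝒰.act c x))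
      = fun t => 𝒰.act c (𝒰.act (Circle.exp t) x) := by
    funext t
    rw [← 𝒰.act_mul _ _ _ hx, ← 𝒰.act_mul _ _ _ hx, mul_comm]
  change pullbackRep (fun t : ℝ => 𝒰.act (Circle.exp t) (𝒰.act c x)) α 0 (1 : ℝ)
    = pullbackRep (fun t : ℝ => 𝒰.act (Circle.exp t) x) α 0 (1 : ℝ)
  rw [h, 𝒰.pullbackRep_act c (𝒰.contMDiffAt_orbit hx 0) (𝒰.act_mem _ _ hx)]

end LocalCircleAction
end ContactCut

namespace ContactCut

section LinearAlgebra

variable {E : Type*} [NormedAddCommGroup E] [NormedSpace ℝ E] [FiniteDimensional ℝ E]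
  {V : Type*} [NormedAddCommGroup V] [NormedSpace ℝ V] [FiniteDimensional ℝ V]

theorem exists_equiv_prod_apply_eq (h : Module.finrank ℝ E = Module.finrank ℝ V + 1) {x : E}
    (hx : x ≠ 0) : ∃ T : (ℝ × V) ≃L[ℝ] E, T (1, 0) = x := by
  have hf : Module.finrank ℝ (ℝ × V) = Module.finrank ℝ E := by
    rw [Module.finrank_prod, Module.finrank_self, h, add_comm]
  let T₀ : (ℝ × V) ≃L[ℝ] E := ContinuousLinearEquiv.ofFinrankEq hf
  have h0 : T₀ (1, 0) ≠ 0 := by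
    rw [Ne, map_eq_zero_iff _ T₀.injective]
    simp
  obtain ⟨A, hA⟩ := SeparatingDual.exists_continuousLinearEquiv_apply_eq (R := ℝ) h0 hx
  exact ⟨T₀.trans A, hA⟩

theorem exists_equiv_prod_fst_eq (h : Module.finrank ℝ E = Module.finrank ℝ V + 1)
    {l : E →L[ℝ] ℝ} (hl : l ≠ 0) : ∃ T : E ≃L[ℝ] (ℝ × V), ∀ x, (T x).1 = l x := by
  have hl' : Function.Surjective l.toLinearMap :=
    LinearMap.surjective (f := l.toLinearMap) (fun h => hl (by ext x; exact DFunLike.congr_fun h x))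
  have hk : Module.finrank ℝ (LinearMap.ker l.toLinearMap) = Module.finrank ℝ V := by
    have h1 := l.toLinearMap.finrank_range_add_finrank_ker
    rw [LinearMap.range_eq_top.2 hl', finrank_top, Module.finrank_self] at h1
    omega
  obtain ⟨P, hP⟩ := LinearMap.exists_leftInverse_of_injective
    (LinearMap.ker l.toLinearMap).subtype (Submodule.ker_subtype _)
  let e : LinearMap.ker l.toLinearMap ≃ₗ[ℝ] V := LinearEquiv.ofFinrankEq _ _ hk
  let T : E →ₗ[ℝ] ℝ × V := l.toLinearMap.prod (e.toLinearMap ∘ₗ P)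
  have hT : Function.Injective T := by
    rw [injective_iff_map_eq_zero]
    intro x hx
    have h1 : l x = 0 := congrArg Prod.fst hx
    have h2 : e (P x) = 0 := congrArg Prod.snd hx
    have h3 : P x = ⟨x, h1⟩ := DFunLike.congr_fun hP ⟨x, h1⟩
    rw [h3, map_eq_zero_iff _ e.injective] at h2
    exact congrArg Subtype.val h2
  have hf : Module.finrank ℝ E = Module.finrank ℝ (ℝ × V) := by
    rw [Module.finrank_prod, Module.finrank_self, h, add_comm]
  exact ⟨(LinearEquiv.ofInjectiveOfFinrankEq T hT hf).toContinuousLinearEquiv, fun x => rfl⟩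

end LinearAlgebra

section ProductForms

variable {V : Type*} [NormedAddCommGroup V] [NormedSpace ℝ V]

/-- The `1`-form `F(v) dτ + η(v)` on `ℝ × V`. -/
def flowForm (F : V → ℝ) (η : V → V →L[ℝ] ℝ) (p : ℝ × V) : ℝ × V →L[ℝ] ℝ :=
  F p.2 • ContinuousLinearMap.fst ℝ ℝ V + (η p.2).comp (ContinuousLinearMap.snd ℝ ℝ V)

theorem flowForm_apply (F : V → ℝ) (η : V → V →L[ℝ] ℝ) (p a : ℝ × V) :
    flowForm F η p a = a.1 * F p.2 + η p.2 a.2 := by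
  simp [flowForm, mul_comm]

theorem fderiv_flowForm {F : V → ℝ} {η : V → V →L[ℝ] ℝ} {p : ℝ × V}
    (hF : DifferentiableAt ℝ F p.2) (hη : DifferentiableAt ℝ η p.2) (a b : ℝ × V) :
    fderiv ℝ (flowForm F η) p a b = fderiv ℝ F p.2 a.2 * b.1 + fderiv ℝ η p.2 a.2 b.2 := by
  have h1 : HasFDerivAt (fun p : ℝ × V => F p.2)
      ((fderiv ℝ F p.2).comp (ContinuousLinearMap.snd ℝ ℝ V)) p :=
    hF.hasFDerivAt.comp p hasFDerivAt_snd
  have h2 : HasFDerivAt (fun p : ℝ × V => η p.2)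
      ((fderiv ℝ η p.2).comp (ContinuousLinearMap.snd ℝ ℝ V)) p :=
    hη.hasFDerivAt.comp p hasFDerivAt_snd
  have h3 := (h1.smul_const (ContinuousLinearMap.fst ℝ ℝ V)).add
    (h2.clm_comp (hasFDerivAt_const (ContinuousLinearMap.snd ℝ ℝ V) p))
  have h4 : fderiv ℝ (flowForm F η) p = _ := h3.fderiv
  rw [h4]
  simp

/-- If the form `F(v) dτ + η(v)` on `ℝ × V` satisfies the contact condition at a zero of `F`,
then `F` has a nonzero derivative there. -/
theorem ContactAt.fderiv_ne_zero {F : V → ℝ} {η : V → V →L[ℝ] ℝ} {p : ℝ × V}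
    (hF : DifferentiableAt ℝ F p.2) (hη : DifferentiableAt ℝ η p.2)
    (h : ContactAt (flowForm F η) p) (h0 : F p.2 = 0) : fderiv ℝ F p.2 ≠ 0 := by
  intro hd
  have := h.2 (1, 0) (by simp [flowForm_apply, h0]) fun v _ => by
    simp [fderiv_flowForm hF hη, hd]
  simp at this

variable {Y : Type*} [NormedAddCommGroup Y] [NormedSpace ℝ Y]

/-- The restriction to `{0} × Y` of a `1`-form on `ℝ × Y`. -/
def reducedForm (η : ℝ × Y → ℝ × Y →L[ℝ] ℝ) (y : Y) : Y →L[ℝ] ℝ :=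
  (η (0, y)).comp (ContinuousLinearMap.inr ℝ ℝ Y)

theorem fderiv_reducedForm {η : ℝ × Y → ℝ × Y →L[ℝ] ℝ} {y : Y}
    (hη : DifferentiableAt ℝ η (0, y)) (u w : Y) :
    fderiv ℝ (reducedForm η) y u w = fderiv ℝ η (0, y) (0, u) (0, w) := by
  have h1 : HasFDerivAt (fun y : Y => η (0, y))
      ((fderiv ℝ η (0, y)).comp (ContinuousLinearMap.inr ℝ ℝ Y)) y :=
    hη.hasFDerivAt.comp y (hasFDerivAt_prodMk_right (𝕜 := ℝ) (0 : ℝ) y)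
  have h2 : fderiv ℝ (reducedForm η) y = _ :=
    (h1.clm_comp (hasFDerivAt_const (ContinuousLinearMap.inr ℝ ℝ Y) y)).fderiv
  rw [h2]
  simp

/-- Contact reduction: the reduced form at level zero satisfies the contact condition. -/
theorem ContactAt.reducedForm {η : ℝ × Y → ℝ × Y →L[ℝ] ℝ} {τ : ℝ} {y : Y}
    (hη : DifferentiableAt ℝ η (0, y)) (h : ContactAt (flowForm Prod.fst η) (τ, ((0 : ℝ), y))) :
    ContactAt (reducedForm η) y := by
  have hd : ∀ a b : ℝ × ℝ × Y, fderiv ℝ (flowForm Prod.fst η) (τ, ((0 : ℝ), y)) a b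
      = a.2.1 * b.1 + fderiv ℝ η (0, y) a.2 b.2 := by
    intro a b
    rw [fderiv_flowForm differentiableAt_fst hη, fderiv_fst]
    rfl
  have hv : ∀ b : ℝ × ℝ × Y, flowForm Prod.fst η (τ, ((0 : ℝ), y)) b = η (0, y) b.2 := by
    intro b
    simp [flowForm_apply]
  have hsplit : ∀ (c : ℝ) (w : Y), ((c, w) : ℝ × Y) = c • (1, 0) + (0, w) := by
    intro c w
    ext <;> simp
  have hr : ∀ (c : ℝ) (w : Y), η (0, y) (c, w)
      = c * η (0, y) (1, 0) + ContactCut.reducedForm η y w := by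
    intro c w
    rw [hsplit c w, map_add, map_smul, smul_eq_mul]
    rfl
  have hne : ContactCut.reducedForm η y ≠ 0 := by
    intro h0
    have hg : η (0, y) (1, 0) ≠ 0 := by
      intro hg
      refine h.1 (ContinuousLinearMap.ext fun b => ?_)
      rw [hv, ← Prod.mk.eta (p := b.2), hr, hg, h0]
      simp
    have := h.2 (1, 0) (by simp [hv]) fun v hv' => by
      rw [hv, ← Prod.mk.eta (p := v.2), hr, h0] at hv'
      have : v.2.1 = 0 := by simpa [hg] using hv'
      simp [hd, this]
    simp at this
  refine ⟨hne, fun u hu hw => ?_⟩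
  obtain ⟨w₁, hw₁⟩ : ∃ w₁, ContactCut.reducedForm η y w₁ = - η (0, y) (1, 0) :=
    LinearMap.surjective (f := (ContactCut.reducedForm η y).toLinearMap)
      (fun h => hne (by ext x; exact DFunLike.congr_fun h x)) _
  set D := fderiv ℝ η (0, y) with hD
  set a : ℝ := D (0, u) (1, w₁) - D (1, w₁) (0, u) with ha
  have hU := h.2 (a, (0, u)) (by rw [hv, hr, hu]; simp) fun v hv' => by
    rw [hv, ← Prod.mk.eta (p := v.2), hr] at hv'
    have hk : ContactCut.reducedForm η y (v.2.2 - v.2.1 • w₁) = 0 := by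
      rw [map_sub, map_smul, hw₁, smul_eq_mul]
      linarith
    have hz := hw _ hk
    rw [fderiv_reducedForm hη, fderiv_reducedForm hη, ← hD] at hz
    have hv2 : v.2 = v.2.1 • ((1 : ℝ), w₁) + (0, v.2.2 - v.2.1 • w₁) := by
      ext <;> simp
    rw [hd, hd]
    have e1 : D (0, u) v.2 = v.2.1 * D (0, u) (1, w₁) + D (0, u) (0, v.2.2 - v.2.1 • w₁) := by
      conv_lhs => rw [hv2]
      rw [map_add, map_smul, smul_eq_mul]
    have e2 : D v.2 (0, u) = v.2.1 * D (1, w₁) (0, u) + D (0, v.2.2 - v.2.1 • w₁) (0, u) := by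
      conv_lhs => rw [hv2]
      rw [map_add, map_smul, add_apply, smul_apply, smul_eq_mul]
    simp only [e1, e2, ha]
    linarith
  have := congrArg (fun p : ℝ × ℝ × Y => p.2.2) hU
  exact this

/-- The real bilinear map `(z, ζ) ↦ Im (z̄ ζ)`. -/
def imForm : ℂ →L[ℝ] ℂ →L[ℝ] ℝ :=
  (ContinuousLinearMap.compL ℝ ℂ ℂ ℝ Complex.imCLM).comp
    ((ContinuousLinearMap.mul ℝ ℂ).comp (Complex.conjCLE : ℂ →L[ℝ] ℂ))

/-- The real bilinear map `(z, ζ) ↦ Re (z̄ ζ)`. -/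
def reForm : ℂ →L[ℝ] ℂ →L[ℝ] ℝ :=
  (ContinuousLinearMap.compL ℝ ℂ ℂ ℝ Complex.reCLM).comp
    ((ContinuousLinearMap.mul ℝ ℂ).comp (Complex.conjCLE : ℂ →L[ℝ] ℂ))

theorem imForm_apply (z ζ : ℂ) : imForm z ζ = z.re * ζ.im - z.im * ζ.re := by
  simp [imForm, sub_eq_add_neg]

theorem reForm_apply (z ζ : ℂ) : reForm z ζ = z.re * ζ.re + z.im * ζ.im := by
  simp [reForm]

theorem contDiff_normSq : ContDiff ℝ ∞ (Complex.normSq : ℂ → ℝ) := by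
  have : (Complex.normSq : ℂ → ℝ) = fun z => reForm z z := by
    funext z
    rw [reForm_apply, Complex.normSq_apply]
  rw [this]
  exact reForm.contDiff.clm_apply contDiff_id

theorem hasFDerivAt_normSq (z : ℂ) :
    HasFDerivAt (Complex.normSq : ℂ → ℝ) ((2 : ℝ) • reForm z) z := by
  have : (Complex.normSq : ℂ → ℝ) = fun z => reForm z z := by
    funext z
    rw [reForm_apply, Complex.normSq_apply]
  rw [this]
  refine (reForm.hasFDerivAt.clm_apply (hasFDerivAt_id z)).congr_fderiv ?_
  refine ContinuousLinearMap.ext fun ζ => ?_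
  simp [reForm_apply]
  ring

/-- The map `(z, y) ↦ (|z|², y)`. -/
def radial (p : ℂ × Y) : ℝ × Y := (Complex.normSq p.1, p.2)

theorem contDiff_radial : ContDiff ℝ ∞ (radial : ℂ × Y → ℝ × Y) :=
  (contDiff_normSq.comp contDiff_fst).prodMk contDiff_snd

theorem hasFDerivAt_radial (p : ℂ × Y) : HasFDerivAt (radial : ℂ × Y → ℝ × Y)
    ((((2 : ℝ) • reForm p.1).comp (ContinuousLinearMap.fst ℝ ℂ Y)).prod
      (ContinuousLinearMap.snd ℝ ℂ Y)) p :=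
  ((hasFDerivAt_normSq p.1).comp p hasFDerivAt_fst).prodMk hasFDerivAt_snd

/-- The `1`-form `Im (z̄ dz) + ρ^* η` on `ℂ × Y`, where `ρ (z, y) = (|z|², y)`. -/
def cutForm (η : ℝ × Y → ℝ × Y →L[ℝ] ℝ) (p : ℂ × Y) : ℂ × Y →L[ℝ] ℝ :=
  (imForm p.1).comp (ContinuousLinearMap.fst ℝ ℂ Y)
    + (η (radial p)).comp ((((2 : ℝ) • reForm p.1).comp (ContinuousLinearMap.fst ℝ ℂ Y)).prod
      (ContinuousLinearMap.snd ℝ ℂ Y))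

theorem cutForm_apply (η : ℝ × Y → ℝ × Y →L[ℝ] ℝ) (p a : ℂ × Y) :
    cutForm η p a = imForm p.1 a.1 + η (radial p) (2 * reForm p.1 a.1, a.2) := by
  simp [cutForm]

theorem contDiffAt_cutForm {η : ℝ × Y → ℝ × Y →L[ℝ] ℝ} {p : ℂ × Y}
    (hη : ContDiffAt ℝ ∞ η (radial p)) : ContDiffAt ℝ ∞ (cutForm η) p := by
  have h1 : ContDiffAt ℝ ∞ (fun p : ℂ × Y => η (radial p)) p :=
    ContDiffAt.comp p hη contDiff_radial.contDiffAt
  have h2 : ContDiff ℝ ∞ fun p : ℂ × Y => imForm p.1 := imForm.contDiff.comp contDiff_fst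
  have h4 : ContDiff ℝ ∞ fun p : ℂ × Y =>
      ((((2 : ℝ) • reForm p.1).comp (ContinuousLinearMap.fst ℝ ℂ Y)).prod
        (ContinuousLinearMap.snd ℝ ℂ Y)) := by
    have : (fun p : ℂ × Y => ((((2 : ℝ) • reForm p.1).comp (ContinuousLinearMap.fst ℝ ℂ Y)).prod
        (ContinuousLinearMap.snd ℝ ℂ Y))) = fderiv ℝ radial :=
      funext fun p => (hasFDerivAt_radial p).fderiv.symm
    rw [this]
    exact contDiff_radial.fderiv_right (by norm_cast)
  exact ((h2.contDiffAt).clm_comp contDiffAt_const).add (h1.clm_comp h4.contDiffAt)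

theorem fderiv_cutForm {η : ℝ × Y → ℝ × Y →L[ℝ] ℝ} {y : Y}
    (hη : DifferentiableAt ℝ η (0, y)) (a b : ℂ × Y) :
    fderiv ℝ (cutForm η) (0, y) a b = imForm a.1 b.1 + fderiv ℝ η (0, y) (0, a.2) (0, b.2)
      + η (0, y) (2 * reForm a.1 b.1, 0) := by
  have hp : radial ((0 : ℂ), y) = (0, y) := by simp [radial]
  have h1 : HasFDerivAt (fun p : ℂ × Y => η (radial p))
      ((fderiv ℝ η (0, y)).comp ((((2 : ℝ) • reForm 0).comp (ContinuousLinearMap.fst ℝ ℂ Y)).prod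
      (ContinuousLinearMap.snd ℝ ℂ Y))) ((0 : ℂ), y) := by
    refine HasFDerivAt.comp (g := η) _ ?_ (hasFDerivAt_radial ((0 : ℂ), y))
    rw [hp]
    exact hη.hasFDerivAt
  set T : ℂ × Y → ℂ × Y →L[ℝ] ℝ × Y := fderiv ℝ radial with hT
  have hTv : ∀ p, T p = (((2 : ℝ) • reForm p.1).comp (ContinuousLinearMap.fst ℝ ℂ Y)).prod
      (ContinuousLinearMap.snd ℝ ℂ Y) := fun p => (hasFDerivAt_radial p).fderiv
  have hTd : DifferentiableAt ℝ T ((0 : ℂ), y) :=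
    ((contDiff_radial.fderiv_right (m := ∞) (by norm_cast)).differentiable (by simp)) _
  have hTb : fderiv ℝ T ((0 : ℂ), y) a b = (2 * reForm a.1 b.1, 0) := by
    have e1 : fderiv ℝ (fun p => T p b) ((0 : ℂ), y) a = fderiv ℝ T ((0 : ℂ), y) a b := by
      rw [fderiv_clm_apply hTd (differentiableAt_const b)]
      simp
    have e2 : (fun p => T p b) = fun p : ℂ × Y => (2 * reForm p.1 b.1, b.2) := by
      funext p
      rw [hTv]
      simp
    have e3 : HasFDerivAt (fun p : ℂ × Y => reForm p.1) (reForm.comp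
        (ContinuousLinearMap.fst ℝ ℂ Y)) ((0 : ℂ), y) := reForm.hasFDerivAt.comp _ hasFDerivAt_fst
    have e4 := ((e3.clm_apply (hasFDerivAt_const b.1 ((0 : ℂ), y))).const_mul (2 : ℝ)).prodMk
      (hasFDerivAt_const b.2 ((0 : ℂ), y))
    rw [← e1, e2, e4.fderiv]
    simp
  have e5 : HasFDerivAt (fun p : ℂ × Y => imForm p.1) (imForm.comp
        (ContinuousLinearMap.fst ℝ ℂ Y)) ((0 : ℂ), y) := imForm.hasFDerivAt.comp _ hasFDerivAt_fst
  have e6 := (e5.clm_comp (hasFDerivAt_const (ContinuousLinearMap.fst ℝ ℂ Y) ((0 : ℂ), y))).add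
    (h1.clm_comp hTd.hasFDerivAt)
  have e7 : cutForm η = fun p : ℂ × Y => (imForm p.1).comp (ContinuousLinearMap.fst ℝ ℂ Y)
      + (η (radial p)).comp (T p) := by
    funext p
    rw [hTv]
    rfl
  have e8 := e6.fderiv
  rw [Pi.add_def, ← e7] at e8
  rw [e8]
  simp [hTb, hTv, hp]
  ring

theorem ContactAt.cutForm {η : ℝ × Y → ℝ × Y →L[ℝ] ℝ} {y : Y}
    (hη : DifferentiableAt ℝ η (0, y)) (h : ContactAt (ContactCut.reducedForm η) y) :
    ContactAt (cutForm η) ((0 : ℂ), y) := by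
  have hv : ∀ a : ℂ × Y, ContactCut.cutForm η ((0 : ℂ), y) a
      = ContactCut.reducedForm η y a.2 := by
    intro a
    rw [cutForm_apply]
    simp [radial, ContactCut.reducedForm]
  have hd : ∀ a b : ℂ × Y, fderiv ℝ (ContactCut.cutForm η) (0, y) a b
      - fderiv ℝ (ContactCut.cutForm η) (0, y) b a = 2 * imForm a.1 b.1
        + (fderiv ℝ (ContactCut.reducedForm η) y a.2 b.2
          - fderiv ℝ (ContactCut.reducedForm η) y b.2 a.2) := by
    intro a b
    have : reForm b.1 a.1 = reForm a.1 b.1 := by simp only [reForm_apply]; ring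
    rw [fderiv_cutForm hη, fderiv_cutForm hη, fderiv_reducedForm hη, fderiv_reducedForm hη, this]
    simp only [imForm_apply]
    ring
  refine ⟨fun h0 => h.1 ?_, fun u hu hw => ?_⟩
  · refine ContinuousLinearMap.ext fun w => ?_
    rw [← hv (0, w), h0]
    rfl
  · rw [hv] at hu
    have h1 : u.1 = 0 := by
      have := hw (Complex.I * u.1, 0) (by rw [hv]; simp)
      rw [hd] at this
      simp [imForm_apply] at this
      have h3 : u.1.re * u.1.re + u.1.im * u.1.im = 0 := by linarith
      rwa [← Complex.normSq_apply, Complex.normSq_eq_zero] at h3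
    have h2 : u.2 = 0 := by
      refine h.2 _ hu fun w hw' => ?_
      have := hw (0, w) (by rw [hv]; exact hw')
      rw [hd] at this
      simpa using this
    exact Prod.ext h1 h2

end ProductForms
end ContactCut

namespace ContactCut

variable {E : Type*} [NormedAddCommGroup E] [NormedSpace ℝ E]
  {N : Type*} [TopologicalSpace N] [ChartedSpace E N] [IsManifold 𝓘(ℝ, E) ∞ N]
  {F : Type*} [NormedAddCommGroup F] [NormedSpace ℝ F]

theorem fderiv_extChartAt_comp {g : F → N} {y : F} (hg : MDifferentiableAt 𝓘(ℝ, F) 𝓘(ℝ, E) g y) :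
    fderiv ℝ (fun z => extChartAt 𝓘(ℝ, E) (g y) (g z)) y = mfderiv 𝓘(ℝ, F) 𝓘(ℝ, E) g y := by
  have h := mfderiv_comp (I := 𝓘(ℝ, F)) y
    (mdifferentiableAt_extChartAt (I := 𝓘(ℝ, E)) (mem_chart_source E (g y))) hg
  rw [mfderiv_extChartAt_self, mfderiv_eq_fderiv] at h
  exact h

namespace LocalCircleAction

variable {α : OneForm 𝓘(ℝ, E) N} (𝒰 : LocalCircleAction α)

omit [IsManifold 𝓘(ℝ, E) ∞ N] in
theorem mfderiv_orbit {x : N} (hx : x ∈ 𝒰.dom) (t : ℝ) :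
    mfderiv 𝓘(ℝ, ℝ) 𝓘(ℝ, E) (fun t : ℝ => 𝒰.act (Circle.exp t) x) t (1 : ℝ)
      = mfderiv 𝓘(ℝ, E) 𝓘(ℝ, E) (𝒰.act (Circle.exp t)) (𝒰.act (Circle.exp 0) x)
        (mfderiv 𝓘(ℝ, ℝ) 𝓘(ℝ, E) (fun t : ℝ => 𝒰.act (Circle.exp t) x) 0 (1 : ℝ)) := by
  have h : (fun τ : ℝ => 𝒰.act (Circle.exp (t + τ)) x)
      = 𝒰.act (Circle.exp t) ∘ fun τ : ℝ => 𝒰.act (Circle.exp τ) x := by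
    funext τ
    rw [Circle.exp_add, 𝒰.act_mul _ _ _ hx, Function.comp_apply]
  have hsd : HasMFDerivAt 𝓘(ℝ, ℝ) 𝓘(ℝ, ℝ) (fun τ : ℝ => t + τ) 0 (ContinuousLinearMap.id ℝ ℝ) :=
    ((hasFDerivAt_id (𝕜 := ℝ) (0 : ℝ)).const_add t).hasMFDerivAt
  have ht : t + 0 = t := add_zero t
  have h1 := mfderiv_comp (I := 𝓘(ℝ, ℝ)) (0 : ℝ)
    (ht ▸ (𝒰.contMDiffAt_orbit hx t).mdifferentiableAt (by simp)) hsd.mdifferentiableAt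
  have h2 := mfderiv_comp (I := 𝓘(ℝ, ℝ)) (0 : ℝ)
    ((𝒰.contMDiffAt_act_const (Circle.exp t) (𝒰.act_mem (Circle.exp 0) x hx)).mdifferentiableAt
      (by simp)) ((𝒰.contMDiffAt_orbit hx 0).mdifferentiableAt (by simp))
  rw [← h] at h2
  rw [hsd.mfderiv] at h1
  have h3 : mfderiv 𝓘(ℝ, ℝ) 𝓘(ℝ, E) (fun t : ℝ => 𝒰.act (Circle.exp t) x) (t + 0) (1 : ℝ)
      = mfderiv 𝓘(ℝ, ℝ) 𝓘(ℝ, E) (fun τ : ℝ => 𝒰.act (Circle.exp (t + τ)) x) 0 (1 : ℝ) :=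
    (DFunLike.congr_fun h1 (1 : ℝ)).symm
  have h4 := DFunLike.congr_fun h2 (1 : ℝ)
  rw [ht] at h3
  exact h3.trans h4

/-- A free action has no stationary points. -/
theorem mfderiv_orbit_ne_zero {x : N} (hx : x ∈ 𝒰.dom) :
    mfderiv 𝓘(ℝ, ℝ) 𝓘(ℝ, E) (fun t : ℝ => 𝒰.act (Circle.exp t) x) 0 (1 : ℝ) ≠ 0 := by
  intro h0
  have h1 : ∀ t, mfderiv 𝓘(ℝ, ℝ) 𝓘(ℝ, E) (fun t : ℝ => 𝒰.act (Circle.exp t) x) t = 0 := by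
    intro t
    refine ContinuousLinearMap.ext_ring ?_
    refine (𝒰.mfderiv_orbit hx t).trans ?_
    rw [h0]
    exact map_zero _
  set γ : ℝ → N := fun t => 𝒰.act (Circle.exp t) x with hγ
  set φ := extChartAt 𝓘(ℝ, E) x
  have hγ0 : γ 0 = x := 𝒰.act_exp_zero hx
  have hsrc : ∀ᶠ t in 𝓝 (0 : ℝ), γ t ∈ (chartAt E x).source :=
    (𝒰.contMDiffAt_orbit hx 0).continuousAt.preimage_mem_nhds
      ((chartAt E x).open_source.mem_nhds (by rw [𝒰.act_exp_zero hx]; exact mem_chart_source E x))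
  obtain ⟨ε, hε, hball⟩ := Metric.eventually_nhds_iff_ball.1 hsrc
  have hd : ∀ t ∈ Metric.ball (0 : ℝ) ε, HasFDerivAt (fun t => φ (γ t)) (0 : ℝ →L[ℝ] E) t := by
    intro t ht
    have h2 : HasMFDerivAt 𝓘(ℝ, ℝ) 𝓘(ℝ, E) γ t 0 := by
      have := ((𝒰.contMDiffAt_orbit hx t).mdifferentiableAt (by simp)).hasMFDerivAt
      rwa [h1 t] at this
    have h3 := (mdifferentiableAt_extChartAt (I := 𝓘(ℝ, E)) (hball t ht)).hasMFDerivAt.comp t h2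
    have h4 := hasMFDerivAt_iff_hasFDerivAt.1 h3
    refine h4.congr_fderiv ?_
    exact ContinuousLinearMap.comp_zero _
  have hconst : ∀ t ∈ Metric.ball (0 : ℝ) ε, φ (γ t) = φ (γ 0) := fun t ht =>
    Metric.isOpen_ball.is_const_of_fderiv_eq_zero (𝕜 := ℝ) (convex_ball _ _).isPreconnected
      (fun t ht => (hd t ht).differentiableAt.differentiableWithinAt)
      (fun t ht => (hd t ht).fderiv) ht (Metric.mem_ball_self hε)
  set t := min (ε / 2) 1 with ht
  have ht0 : 0 < t := by positivity
  have htε : t ∈ Metric.ball (0 : ℝ) ε := by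
    rw [Metric.mem_ball, dist_zero_right, Real.norm_of_nonneg ht0.le]
    exact (min_le_left _ _).trans_lt (half_lt_self hε)
  have heq : γ t = γ 0 := φ.injOn (by simpa [φ] using hball t htε)
    (by simpa [φ] using hball 0 (Metric.mem_ball_self hε)) (hconst t htε)
  rw [hγ0] at heq
  have h5 := 𝒰.act_free _ _ hx heq
  have h6 := Circle.arg_exp (x := t) (by linarith [Real.pi_pos])
    ((min_le_right _ _).trans (by linarith [Real.pi_gt_three]))
  rw [h5] at h6
  simp at h6
  exact ht0.ne h6

end LocalCircleAction
end ContactCut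

namespace ContactCut

variable {E : Type*} [NormedAddCommGroup E] [NormedSpace ℝ E]
  {N : Type*} [TopologicalSpace N] [ChartedSpace E N]

variable (E) in
/-- The derivative of a map from a normed space to a manifold, as a map into the model space. -/
def modelDeriv {F : Type*} [NormedAddCommGroup F] [NormedSpace ℝ F] (g : F → N) (y : F) :
    F →L[ℝ] E :=
  mfderiv 𝓘(ℝ, F) 𝓘(ℝ, E) g y

namespace LocalCircleAction

variable {α : OneForm 𝓘(ℝ, E) N} (𝒰 : LocalCircleAction α)
  {V : Type*} [NormedAddCommGroup V] [NormedSpace ℝ V] {s : V → N}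

theorem mfderiv_flowOut_zero {v : V} (hs : ContMDiffAt 𝓘(ℝ, V) 𝓘(ℝ, E) ∞ s v)
    (hv : s v ∈ 𝒰.dom) (a : ℝ) (w : V) :
    modelDeriv E (𝒰.flowOut s) (0, v) (a, w)
      = a • modelDeriv E (fun t : ℝ => 𝒰.act (Circle.exp t) (s v)) 0 1 + modelDeriv E s v w := by
  have hA : MDifferentiableAt 𝓘(ℝ, ℝ × V) 𝓘(ℝ, E) (𝒰.flowOut s) (0, v) :=
    (𝒰.contMDiffAt_flowOut (p := (0, v)) hs hv).mdifferentiableAt (by simp)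
  have h1 : modelDeriv E (𝒰.flowOut s) (0, v) ((1 : ℝ), (0 : V))
      = modelDeriv E (fun t : ℝ => 𝒰.act (Circle.exp t) (s v)) 0 (1 : ℝ) := by
    have hl : HasMFDerivAt 𝓘(ℝ, ℝ) 𝓘(ℝ, ℝ × V) (fun t : ℝ => (t, v)) 0
        (ContinuousLinearMap.inl ℝ ℝ V) :=
      (hasFDerivAt_prodMk_left (𝕜 := ℝ) (0 : ℝ) v).hasMFDerivAt
    have hc := mfderiv_comp (I := 𝓘(ℝ, ℝ)) (0 : ℝ) hA hl.mdifferentiableAt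
    rw [hl.mfderiv] at hc
    exact (DFunLike.congr_fun hc (1 : ℝ)).symm
  have h2 : modelDeriv E (𝒰.flowOut s) (0, v) ((0 : ℝ), w) = modelDeriv E s v w := by
    have hl : HasMFDerivAt 𝓘(ℝ, V) 𝓘(ℝ, ℝ × V) (fun v : V => ((0 : ℝ), v)) v
        (ContinuousLinearMap.inr ℝ ℝ V) :=
      (hasFDerivAt_prodMk_right (𝕜 := ℝ) (0 : ℝ) v).hasMFDerivAt
    have hc := mfderiv_comp (I := 𝓘(ℝ, V)) v hA hl.mdifferentiableAt
    rw [hl.mfderiv] at hc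
    have hev : 𝒰.flowOut s ∘ (fun v : V => ((0 : ℝ), v)) =ᶠ[𝓝 v] s := by
      filter_upwards [hs.continuousAt.preimage_mem_nhds (𝒰.isOpen_dom.mem_nhds hv)] with z hz
      exact 𝒰.flowOut_zero hz
    rw [hev.mfderiv_eq] at hc
    exact (DFunLike.congr_fun hc w).symm
  have ha : ((a, w) : ℝ × V) = a • ((1 : ℝ), (0 : V)) + (0, w) := by ext <;> simp
  rw [ha, map_add, map_smul, h1, h2]

variable {D : Set V}

theorem pullbackRep_flowOut_eq_flowForm (hD : IsOpen D) (hs : ContMDiffOn 𝓘(ℝ, V) 𝓘(ℝ, E) ∞ s D)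
    (hdom : MapsTo s D 𝒰.dom) {p : ℝ × V} (hp : p.2 ∈ D) :
    pullbackRep (𝒰.flowOut s) α p
      = flowForm (fun v => 𝒰.moment (s v)) (pullbackRep s α) p := by
  refine ContinuousLinearMap.ext fun a => ?_
  rw [flowForm_apply]
  exact 𝒰.pullbackRep_flowOut (hs.contMDiffAt (hD.mem_nhds hp)) (hdom hp) p.1 a

variable [IsManifold 𝓘(ℝ, E) ∞ N]

theorem contDiffAt_moment (hα : IsSmoothForm 𝓘(ℝ, E) α) (hD : IsOpen D)
    (hs : ContMDiffOn 𝓘(ℝ, V) 𝓘(ℝ, E) ∞ s D) (hdom : MapsTo s D 𝒰.dom) {v : V} (hv : v ∈ D) :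
    ContDiffAt ℝ ∞ (fun v => 𝒰.moment (s v)) v := by
  have hsv := hs.contMDiffAt (hD.mem_nhds hv)
  have h1 : ContDiffAt ℝ ∞ (fun v : V => pullbackRep (𝒰.flowOut s) α (0, v) (1, 0)) v := by
    refine ContDiffAt.clm_apply ?_ contDiffAt_const
    exact ContDiffAt.comp v (hα.contDiffAt_pullbackRep
      (𝒰.contMDiffAt_flowOut (p := (0, v)) hsv (hdom hv)))
      (contDiffAt_const.prodMk contDiffAt_id)
  refine h1.congr_of_eventuallyEq ?_
  filter_upwards [hD.mem_nhds hv] with z hz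
  rw [𝒰.pullbackRep_flowOut_eq_flowForm hD hs hdom (p := (0, z)) hz, flowForm_apply]
  simp

variable [FiniteDimensional ℝ E] [FiniteDimensional ℝ V]

theorem exists_section (hα : IsContactForm 𝓘(ℝ, E) α)
    (hV : Module.finrank ℝ E = Module.finrank ℝ V + 1) {x : N} (hx : x ∈ 𝒰.dom)
    (hm : 𝒰.moment x = 0) :
    ∃ (s : V → N) (D : Set V), IsOpen D ∧ (0 : V) ∈ D ∧ s 0 = x ∧
      ContMDiffOn 𝓘(ℝ, V) 𝓘(ℝ, E) ∞ s D ∧ MapsTo s D 𝒰.dom ∧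
      Function.Bijective (mfderiv 𝓘(ℝ, ℝ × V) 𝓘(ℝ, E) (𝒰.flowOut s) (0, 0)) ∧
      fderiv ℝ (fun v => 𝒰.moment (s v)) 0 ≠ 0 := by
  obtain ⟨T, hT⟩ := exists_equiv_prod_apply_eq (E := E) (V := V) hV (𝒰.mfderiv_orbit_ne_zero hx)
  set φ := extChartAt 𝓘(ℝ, E) x with hφ
  set l : V → E := fun v => φ x + T (0, v) with hl
  have hlc : ContDiff ℝ ∞ l :=
    contDiff_const.add (T.contDiff.comp (contDiff_const.prodMk contDiff_id))
  have hl0 : l 0 = φ x := by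
    have : ((0 : ℝ), (0 : V)) = 0 := rfl
    simp [hl, this]
  set s : V → N := fun v => φ.symm (l v) with hs
  have hs0 : s 0 = x := by rw [hs]; simp only [hl0]; exact extChartAt_to_inv x
  have hφs : ContMDiffOn 𝓘(ℝ, E) 𝓘(ℝ, E) ∞ φ.symm φ.target := contMDiffOn_extChartAt_symm x
  have hto : IsOpen φ.target := isOpen_extChartAt_target x
  set D₁ : Set E := φ.target ∩ φ.symm ⁻¹' 𝒰.dom with hD₁
  have hD₁o : IsOpen D₁ := hφs.continuousOn.isOpen_inter_preimage hto 𝒰.isOpen_dom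
  set D : Set V := l ⁻¹' D₁ with hD
  have hDo : IsOpen D := hD₁o.preimage hlc.continuous
  have h0 : (0 : V) ∈ D := by
    refine ⟨?_, ?_⟩
    · rw [hl0]; exact mem_extChartAt_target x
    · change s 0 ∈ 𝒰.dom
      rwa [hs0]
  have hsD : ContMDiffOn 𝓘(ℝ, V) 𝓘(ℝ, E) ∞ s D :=
    hφs.comp hlc.contMDiff.contMDiffOn fun v hv => hv.1
  have hdom : MapsTo s D 𝒰.dom := fun v hv => hv.2
  have hs0' := hsD.contMDiffAt (hDo.mem_nhds h0)
  have hds : ∀ w, modelDeriv E s 0 w = T (0, w) := by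
    intro w
    rw [modelDeriv, ← fderiv_extChartAt_comp (hs0'.mdifferentiableAt (by simp)), hs0]
    have hev : (fun z => φ (s z)) =ᶠ[𝓝 0] l := by
      filter_upwards [hDo.mem_nhds h0] with z hz
      exact φ.right_inv hz.1
    have hfl : HasFDerivAt l ((T : (ℝ × V) →L[ℝ] E).comp (ContinuousLinearMap.inr ℝ ℝ V)) 0 :=
      (T.hasFDerivAt.comp (0 : V) (hasFDerivAt_prodMk_right (𝕜 := ℝ) (0 : ℝ) (0 : V))).const_add _
    rw [hev.fderiv_eq, hfl.fderiv]
    rfl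
  have hbij : Function.Bijective (mfderiv 𝓘(ℝ, ℝ × V) 𝓘(ℝ, E) (𝒰.flowOut s) (0, 0)) := by
    have : ∀ p : ℝ × V, modelDeriv E (𝒰.flowOut s) (0, 0) p = T p := by
      rintro ⟨a, w⟩
      rw [𝒰.mfderiv_flowOut_zero hs0' (hdom h0), hds, hs0]
      have ha : ((a, w) : ℝ × V) = a • ((1 : ℝ), (0 : V)) + (0, w) := by ext <;> simp
      rw [ha, map_add, map_smul, hT]
      rfl
    have h' : (modelDeriv E (𝒰.flowOut s) (0, 0) : ℝ × V → E) = T := funext this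
    have h'' : Function.Bijective (modelDeriv E (𝒰.flowOut s) (0, 0)) := h' ▸ T.bijective
    exact h''
  refine ⟨s, D, hDo, h0, hs0, hsD, hdom, hbij, ?_⟩
  have hc := hα.contactAt_pullbackRep (𝒰.contMDiffAt_flowOut (p := (0, 0)) hs0' (hdom h0)) hbij
  have hev : flowForm (fun v => 𝒰.moment (s v)) (pullbackRep s α)
      =ᶠ[𝓝 ((0 : ℝ), (0 : V))] pullbackRep (𝒰.flowOut s) α := by
    filter_upwards [(hDo.preimage continuous_snd).mem_nhds (x := ((0 : ℝ), (0 : V))) h0] with p hp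
    exact (𝒰.pullbackRep_flowOut_eq_flowForm hDo hsD hdom hp).symm
  refine ContactAt.fderiv_ne_zero (p := ((0 : ℝ), (0 : V)))
    ((𝒰.contDiffAt_moment hα.smooth hDo hsD hdom h0).differentiableAt (by simp))
    ((hα.smooth.contDiffAt_pullbackRep hs0').differentiableAt (by simp)) (hc.congr hev) ?_
  rw [hs0, hm]

theorem two_le_finrank (hα : IsContactForm 𝓘(ℝ, E) α) {x : N} (hx : x ∈ 𝒰.dom)
    (hm : 𝒰.moment x = 0) : 2 ≤ Module.finrank ℝ E := by
  have h1 : 1 ≤ Module.finrank ℝ E := by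
    have : Nontrivial E := ⟨⟨_, _, 𝒰.mfderiv_orbit_ne_zero hx⟩⟩
    exact Module.finrank_pos
  obtain ⟨m, hm'⟩ := Nat.exists_eq_add_of_le' h1
  by_contra hlt
  obtain ⟨s, D, -, -, -, -, -, -, hF⟩ := 𝒰.exists_section (V := EuclideanSpace ℝ (Fin m)) hα
    (by simpa using hm') hx hm
  have : m = 0 := by omega
  subst this
  exact hF (Subsingleton.elim _ _)

variable {Y : Type*} [NormedAddCommGroup Y] [NormedSpace ℝ Y] [FiniteDimensional ℝ Y]

theorem exists_adapted_section (hα : IsContactForm 𝓘(ℝ, E) α)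
    (hY : Module.finrank ℝ E = Module.finrank ℝ Y + 2) {x : N} (hx : x ∈ 𝒰.dom)
    (hm : 𝒰.moment x = 0) :
    ∃ (s : ℝ × Y → N) (D : Set (ℝ × Y)) (v₀ : ℝ × Y), IsOpen D ∧ v₀ ∈ D ∧ s v₀ = x ∧
      ContMDiffOn 𝓘(ℝ, ℝ × Y) 𝓘(ℝ, E) ∞ s D ∧ MapsTo s D 𝒰.dom ∧
      Function.Bijective (mfderiv 𝓘(ℝ, ℝ × ℝ × Y) 𝓘(ℝ, E) (𝒰.flowOut s) (0, v₀)) ∧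
      ∀ v ∈ D, 𝒰.moment (s v) = v.1 := by
  have hV : Module.finrank ℝ E = Module.finrank ℝ (ℝ × Y) + 1 := by
    rw [Module.finrank_prod, Module.finrank_self, hY]; ring
  obtain ⟨s, D, hD, h0, hs0, hs, hdom, hbij, hF⟩ := 𝒰.exists_section (V := ℝ × Y) hα hV hx hm
  set F : ℝ × Y → ℝ := fun v => 𝒰.moment (s v) with hFdef
  have hFs : ∀ v ∈ D, ContDiffAt ℝ ∞ F v := fun v hv =>
    𝒰.contDiffAt_moment hα.smooth hD hs hdom hv
  obtain ⟨L, hL⟩ := exists_equiv_prod_fst_eq (E := ℝ × Y) (V := Y)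
    (by rw [Module.finrank_prod, Module.finrank_self, add_comm]) hF
  set c : ℝ × Y → ℝ × Y := fun v => (F v, (L v).2) with hc
  have hcs : ContDiffOn ℝ ∞ c D := fun v hv =>
    ((hFs v hv).prodMk (contDiffAt_snd.comp v L.contDiff.contDiffAt)).contDiffWithinAt
  have hcd : HasFDerivAt c (L : ℝ × Y →L[ℝ] ℝ × Y) 0 := by
    refine (((hFs 0 h0).differentiableAt (by simp)).hasFDerivAt.prodMk
      (hasFDerivAt_snd.comp (0 : ℝ × Y) L.hasFDerivAt)).congr_fderiv ?_
    refine ContinuousLinearMap.ext fun v => Prod.ext ?_ rfl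
    exact (hL v).symm
  obtain ⟨e, he0, heD, hec, hes⟩ := exists_openPartialHomeomorph_of_hasFDerivAt hD hcs h0 L hcd
  have hev0 : e 0 ∈ e.target := e.map_source he0
  have hl0 : e.symm (e 0) = 0 := e.left_inv he0
  have hmaps : MapsTo e.symm e.target D := fun v hv => heD (e.map_target hv)
  have hs' : ContMDiffOn 𝓘(ℝ, ℝ × Y) 𝓘(ℝ, E) ∞ (fun v => s (e.symm v)) e.target :=
    hs.comp hes.contMDiffOn hmaps
  refine ⟨fun v => s (e.symm v), e.target, e 0, e.open_target, hev0, by simp only [hl0, hs0], hs',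
    fun v hv => hdom (hmaps hv), ?_, fun v hv => ?_⟩
  · have hsymm : HasFDerivAt e.symm (L.symm : ℝ × Y →L[ℝ] ℝ × Y) (e 0) := by
      refine e.hasFDerivAt_symm hev0 ?_
      rw [hl0]
      have : (e : ℝ × Y → ℝ × Y) = c := funext hec
      rwa [this]
    have h1 : HasMFDerivAt 𝓘(ℝ, ℝ × ℝ × Y) 𝓘(ℝ, ℝ × ℝ × Y)
        (Prod.map id e.symm : ℝ × ℝ × Y → ℝ × ℝ × Y) (0, e 0)
        ((ContinuousLinearMap.id ℝ ℝ).prodMap (L.symm : ℝ × Y →L[ℝ] ℝ × Y)) :=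
      (HasFDerivAt.prodMap (p := ((0 : ℝ), e 0)) (hasFDerivAt_id (0 : ℝ)) hsymm).hasMFDerivAt
    have h2 : MDifferentiableAt 𝓘(ℝ, ℝ × ℝ × Y) 𝓘(ℝ, E) (𝒰.flowOut s) (0, e.symm (e 0)) := by
      rw [hl0]
      exact (𝒰.contMDiffAt_flowOut (p := ((0 : ℝ), (0 : ℝ × Y)))
        (hs.contMDiffAt (hD.mem_nhds h0)) (hdom h0)).mdifferentiableAt (by simp)
    have h3 := mfderiv_comp (I := 𝓘(ℝ, ℝ × ℝ × Y)) ((0 : ℝ), e 0) h2 h1.mdifferentiableAt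
    have h4 : 𝒰.flowOut s ∘ (Prod.map id e.symm : ℝ × ℝ × Y → ℝ × ℝ × Y)
      = 𝒰.flowOut fun v => s (e.symm v) := rfl
    rw [h4, h1.mfderiv] at h3
    have h5 : modelDeriv E (𝒰.flowOut fun v => s (e.symm v)) (0, e 0)
        = (modelDeriv E (𝒰.flowOut s) (0, e.symm (e 0))).comp
          ((ContinuousLinearMap.id ℝ ℝ).prodMap (L.symm : ℝ × Y →L[ℝ] ℝ × Y)) := h3
    rw [hl0] at h5
    have h6 : Function.Bijective (modelDeriv E (𝒰.flowOut fun v => s (e.symm v)) (0, e 0)) := by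
      have h7 : Function.Bijective (modelDeriv E (𝒰.flowOut s) (0, 0)) := hbij
      rw [h5, ContinuousLinearMap.coe_comp]
      exact h7.comp (Function.Bijective.prodMap Function.bijective_id L.symm.bijective)
    exact h6
  · have := e.right_inv hv
    rw [hec] at this
    exact congrArg Prod.fst this

end LocalCircleAction
end ContactCut

namespace ContactCut

variable {E : Type*} [NormedAddCommGroup E] [NormedSpace ℝ E] [FiniteDimensional ℝ E]
  {N : Type*} [TopologicalSpace N] [T2Space N] [ChartedSpace E N] [IsManifold 𝓘(ℝ, E) ∞ N]
  {Y : Type*} [NormedAddCommGroup Y] [NormedSpace ℝ Y] [FiniteDimensional ℝ Y]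

namespace LocalCircleAction

variable {α : OneForm 𝓘(ℝ, E) N} (𝒰 : LocalCircleAction α)

omit [FiniteDimensional ℝ E] [T2Space N] [IsManifold 𝓘(ℝ, E) ∞ N] in
theorem isOpen_preimage_act (c : Circle) {O : Set N} (hO : IsOpen O) :
    IsOpen (𝒰.dom ∩ 𝒰.act c ⁻¹' O) := by
  have : ContinuousOn (𝒰.act c) 𝒰.dom := fun x hx =>
    (𝒰.contMDiffAt_act_const c hx).continuousAt.continuousWithinAt
  exact this.isOpen_inter_preimage 𝒰.isOpen_dom hO

omit [FiniteDimensional ℝ E] in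
/-- A section transverse to the orbits can be shrunk so that it meets each orbit at most once,
and its flow-out has a smooth local inverse. -/
theorem exists_injective_section {s : ℝ × Y → N} {D : Set (ℝ × Y)} {v₀ : ℝ × Y} (hD : IsOpen D)
    (hv₀ : v₀ ∈ D) (hs : ContMDiffOn 𝓘(ℝ, ℝ × Y) 𝓘(ℝ, E) ∞ s D) (hdom : MapsTo s D 𝒰.dom)
    (hbij : Function.Bijective (modelDeriv E (𝒰.flowOut s) (0, v₀))) :
    ∃ (D' : Set (ℝ × Y)) (Q : Set N) (r : N → ℝ × ℝ × Y), IsOpen D' ∧ D' ⊆ D ∧ v₀ ∈ D' ∧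
      (∀ c c' v v', v ∈ D' → v' ∈ D' → 𝒰.act c (s v) = 𝒰.act c' (s v') → c = c' ∧ v = v') ∧
      IsOpen Q ∧ MapsTo s D' Q ∧ ContMDiffOn 𝓘(ℝ, E) 𝓘(ℝ, ℝ × ℝ × Y) ∞ r Q ∧
      ∀ x ∈ Q, (r x).2 ∈ D' ∧ 𝒰.flowOut s (r x) = x := by
  set A := 𝒰.flowOut s with hA
  set x₀ := A (0, v₀) with hx₀
  set φ := extChartAt 𝓘(ℝ, E) x₀ with hφ
  have hDo : IsOpen (Prod.snd ⁻¹' D : Set (ℝ × ℝ × Y)) := hD.preimage continuous_snd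
  have hAs : ContMDiffOn 𝓘(ℝ, ℝ × ℝ × Y) 𝓘(ℝ, E) ∞ A (Prod.snd ⁻¹' D) := fun p hp =>
    (𝒰.contMDiffAt_flowOut (hs.contMDiffAt (hD.mem_nhds hp)) (hdom hp)).contMDiffWithinAt
  set O := (Prod.snd ⁻¹' D : Set (ℝ × ℝ × Y)) ∩ A ⁻¹' (chartAt E x₀).source with hO
  have hOo : IsOpen O := hAs.continuousOn.isOpen_inter_preimage hDo (chartAt E x₀).open_source
  have h0O : ((0 : ℝ), v₀) ∈ O := ⟨hv₀, mem_chart_source E x₀⟩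
  have hψ : ContDiffOn ℝ ∞ (fun p => φ (A p)) O := by
    refine ContMDiffOn.contDiffOn ?_
    exact (contMDiffOn_extChartAt (n := ∞)).comp (hAs.mono inter_subset_left) fun p hp => hp.2
  let B : (ℝ × ℝ × Y) ≃L[ℝ] E :=
    (LinearEquiv.ofBijective (modelDeriv E A (0, v₀)).toLinearMap hbij).toContinuousLinearEquiv
  have hdA : MDifferentiableAt 𝓘(ℝ, ℝ × ℝ × Y) 𝓘(ℝ, E) A (0, v₀) :=
    (hAs.contMDiffAt (hDo.mem_nhds hv₀)).mdifferentiableAt (by simp)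
  have hB : HasFDerivAt (fun p => φ (A p)) (B : ℝ × ℝ × Y →L[ℝ] E) (0, v₀) := by
    have h1 := ((hψ.contDiffAt (hOo.mem_nhds h0O)).differentiableAt (by simp)).hasFDerivAt
    refine h1.congr_fderiv ?_
    rw [fderiv_extChartAt_comp hdA]
    rfl
  obtain ⟨e, he0, heO, heq, hes⟩ := exists_openPartialHomeomorph_of_hasFDerivAt hOo hψ h0O B hB
  obtain ⟨J₀, hJ₀, D₁', hD₁', hJD⟩ := mem_nhds_prod_iff.1 (e.open_source.mem_nhds he0)
  obtain ⟨ε, hε, hJε⟩ := Metric.mem_nhds_iff.1 hJ₀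
  obtain ⟨D₁, hD₁s, hD₁o, hD₁⟩ := mem_nhds_iff.1 hD₁'
  have hbox : Metric.ball (0 : ℝ) ε ×ˢ D₁ ⊆ e.source :=
    (prod_mono hJε hD₁s).trans hJD
  have hD₁D : D₁ ⊆ D := fun v hv =>
    (heO (hbox (show ((0 : ℝ), v) ∈ _ from ⟨Metric.mem_ball_self hε, hv⟩))).1
  set J : Set Circle := Circle.exp '' Metric.ball (0 : ℝ) ε with hJ
  have hJo : IsOpen J := isLocalHomeomorph_circleExp.isOpenMap _ Metric.isOpen_ball
  set S : Set (Circle × (ℝ × Y) × (ℝ × Y)) := (univ ×ˢ D₁ ×ˢ D₁) ∩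
    (fun p => (𝒰.act p.1 (s p.2.1), s p.2.2)) ⁻¹' (diagonal N)ᶜ with hS
  have hSo : IsOpen S := by
    refine ContinuousOn.isOpen_inter_preimage ?_ (isOpen_univ.prod (hD₁o.prod hD₁o))
      isClosed_diagonal.isOpen_compl
    have hsc : ContinuousOn s D₁ := hs.continuousOn.mono hD₁D
    refine ContinuousOn.prodMk ?_ ?_
    · refine 𝒰.continuousOn_act.comp (f := fun p : Circle × (ℝ × Y) × (ℝ × Y) => (p.1, s p.2.1))
        (continuousOn_fst.prodMk (hsc.comp (by fun_prop) fun p hp => hp.2.1)) fun p hp => ?_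
      exact ⟨mem_univ _, hdom (hD₁D hp.2.1)⟩
    · exact hsc.comp (by fun_prop) fun p hp => hp.2.2
  have hCS : Jᶜ ×ˢ {(v₀, v₀)} ⊆ S := by
    rintro ⟨c, p⟩ ⟨hc, hp⟩
    rw [mem_singleton_iff] at hp
    subst hp
    refine ⟨⟨mem_univ _, hD₁, hD₁⟩, fun h => hc ?_⟩
    have := 𝒰.act_free c (s v₀) (hdom hv₀) h
    exact ⟨0, Metric.mem_ball_self hε, by rw [this, Circle.exp_zero]⟩
  obtain ⟨u, w, -, hwo, hCu, hvw, huw⟩ := generalized_tube_lemma hJo.isClosed_compl.isCompact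
    isCompact_singleton hSo hCS
  obtain ⟨D₂, hD₂, D₃, hD₃, hD₂₃⟩ := mem_nhds_prod_iff.1 (hwo.mem_nhds (hvw rfl))
  obtain ⟨D₄, hD₄s, hD₄o, hD₄⟩ := mem_nhds_iff.1 (Filter.inter_mem hD₂ hD₃)
  set D' := D₁ ∩ D₄ with hD'
  have hD'o : IsOpen D' := hD₁o.inter hD₄o
  have hinj₁ : ∀ c v v', v ∈ D' → v' ∈ D' → 𝒰.act c (s v) = s v' → c = 1 ∧ v = v' := by
    intro c v v' hv hv' h
    by_cases hc : c ∈ J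
    · obtain ⟨τ, hτ, rfl⟩ := hc
      have h1 : e (τ, v) = e (0, v') := by
        rw [heq, heq]
        change φ (𝒰.act (Circle.exp τ) (s v)) = φ (𝒰.flowOut s (0, v'))
        rw [h, 𝒰.flowOut_zero (hdom (hD₁D hv'.1))]
      have h2 := e.injOn (hbox ⟨hτ, hv.1⟩) (hbox ⟨Metric.mem_ball_self hε, hv'.1⟩) h1
      rw [Prod.mk.injEq] at h2
      exact ⟨by rw [h2.1, Circle.exp_zero], h2.2⟩
    · exact absurd h (huw (show (c, v, v') ∈ u ×ˢ w from
        ⟨hCu hc, hD₂₃ ⟨(hD₄s hv.2).1, (hD₄s hv'.2).2⟩⟩)).2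
  set box := Metric.ball (0 : ℝ) ε ×ˢ D' with hbox'
  have hboxs : box ⊆ e.source := (prod_mono_right inter_subset_left).trans hbox
  have himg : IsOpen (e '' box) :=
    e.isOpen_image_of_subset_source (Metric.isOpen_ball.prod hD'o) hboxs
  set Q := (chartAt E x₀).source ∩ φ ⁻¹' (e '' box) with hQ
  refine ⟨D', Q, fun x => e.symm (φ x), hD'o, inter_subset_left.trans hD₁D, ⟨hD₁, hD₄⟩, ?_, ?_,
    ?_, ?_, ?_⟩
  · intro c c' v v' hv hv' h
    have h1 : 𝒰.act (c'⁻¹ * c) (s v) = s v' := by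
      rw [𝒰.act_mul _ _ _ (hdom (hD₁D hv.1)), h, 𝒰.act_inv_act _ (hdom (hD₁D hv'.1))]
    obtain ⟨h2, h3⟩ := hinj₁ _ v v' hv hv' h1
    exact ⟨(inv_mul_eq_one.1 h2).symm, h3⟩
  · have : ContinuousOn φ (chartAt E x₀).source := by
      have := continuousOn_extChartAt (I := 𝓘(ℝ, E)) x₀
      rwa [extChartAt_source] at this
    exact this.isOpen_inter_preimage (chartAt E x₀).open_source himg
  · intro v hv
    have hb : ((0 : ℝ), v) ∈ box := ⟨Metric.mem_ball_self hε, hv⟩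
    have h1 : A (0, v) = s v := 𝒰.flowOut_zero (hdom (hD₁D hv.1))
    rw [← h1]
    exact ⟨(heO (hboxs hb)).2, (0, v), hb, heq _⟩
  · refine hes.contMDiffOn.comp ((contMDiffOn_extChartAt (n := ∞)).mono inter_subset_left) ?_
    rintro x ⟨-, p, hp, hpx⟩
    rw [mem_preimage, ← hpx]
    exact e.map_source (hboxs hp)
  · rintro x ⟨hxs, p, hp, hpx⟩
    have h1 : e.symm (φ x) = p := by rw [← hpx, e.left_inv (hboxs hp)]
    simp only [h1]
    refine ⟨hp.2, ?_⟩
    rw [heq] at hpx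
    exact φ.injOn (by rw [extChartAt_source]; exact (heO (hboxs hp)).2)
      (by rw [extChartAt_source]; exact hxs) hpx

end LocalCircleAction

/-- A slice for the action: an invariant open set `W` identified by `(angle, coord)` with
`Circle × D`, such that the first coordinate of `coord` is the moment map. -/
structure Slice {α : OneForm 𝓘(ℝ, E) N} (𝒰 : LocalCircleAction α) (Y : Type*)
    [NormedAddCommGroup Y] [NormedSpace ℝ Y] where
  /-- the parameter domain -/
  D : Set (ℝ × Y)
  /-- the invariant domain -/
  W : Set N
  /-- the section -/
  sec : ℝ × Y → N
  /-- the angular coordinate -/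
  angle : N → Circle
  /-- the invariant coordinates -/
  coord : N → ℝ × Y
  finrank_eq : Module.finrank ℝ E = Module.finrank ℝ Y + 2
  isOpen_D : IsOpen D
  isOpen_W : IsOpen W
  W_subset : W ⊆ 𝒰.dom
  smooth_sec : ContMDiffOn 𝓘(ℝ, ℝ × Y) 𝓘(ℝ, E) ∞ sec D
  smooth_angle : ContMDiffOn 𝓘(ℝ, E) (𝓡 1) ∞ angle W
  smooth_coord : ContMDiffOn 𝓘(ℝ, E) 𝓘(ℝ, ℝ × Y) ∞ coord W
  act_sec_mem : ∀ c, ∀ v ∈ D, 𝒰.act c (sec v) ∈ W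
  angle_act_sec : ∀ c, ∀ v ∈ D, angle (𝒰.act c (sec v)) = c
  coord_act_sec : ∀ c, ∀ v ∈ D, coord (𝒰.act c (sec v)) = v
  coord_mem : ∀ x ∈ W, coord x ∈ D
  act_angle : ∀ x ∈ W, 𝒰.act (angle x) (sec (coord x)) = x
  sec_mem_dom : ∀ v ∈ D, sec v ∈ 𝒰.dom
  moment_sec : ∀ v ∈ D, 𝒰.moment (sec v) = v.1

namespace LocalCircleAction

variable {α : OneForm 𝓘(ℝ, E) N} (𝒰 : LocalCircleAction α)

open Classical in
theorem exists_slice (hα : IsContactForm 𝓘(ℝ, E) α)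
    (hY : Module.finrank ℝ E = Module.finrank ℝ Y + 2) {x : N} (hx : x ∈ 𝒰.dom)
    (hm : 𝒰.moment x = 0) : ∃ σ : Slice 𝒰 Y, x ∈ σ.W ∧ σ.angle x = 1 := by
  obtain ⟨s, D₀, v₀, hD₀, hv₀', hsv₀, hs₀, hdom₀, hbij, hmom⟩ :=
    𝒰.exists_adapted_section (Y := Y) hα hY hx hm
  obtain ⟨D, Q, r, hD, hDD, hv₀, hinj, hQ, hsQ, hr, hrQ⟩ :=
    𝒰.exists_injective_section hD₀ hv₀' hs₀ hdom₀ hbij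
  have hdom : MapsTo s D 𝒰.dom := hdom₀.mono_left hDD
  set W : Set N := {x | ∃ p : Circle × ℝ × Y, p.2 ∈ D ∧ 𝒰.act p.1 (s p.2) = x} with hW
  set θ : N → Circle × ℝ × Y := fun x => if h : x ∈ W then h.choose else (1, v₀) with hθ
  have hθ₁ : ∀ x ∈ W, (θ x).2 ∈ D ∧ 𝒰.act (θ x).1 (s (θ x).2) = x := by
    intro x hx
    simp only [hθ, dif_pos hx]
    exact hx.choose_spec
  have hθ₂ : ∀ c v, v ∈ D → θ (𝒰.act c (s v)) = (c, v) := by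
    intro c v hv
    obtain ⟨h1, h2⟩ := hθ₁ _ ⟨(c, v), hv, rfl⟩
    obtain ⟨h3, h4⟩ := hinj _ _ _ _ h1 hv h2
    exact Prod.ext h3 h4
  have hloc : ∀ c, ∀ y ∈ 𝒰.dom ∩ 𝒰.act c⁻¹ ⁻¹' Q,
      (r (𝒰.act c⁻¹ y)).2 ∈ D ∧
        𝒰.act (c * Circle.exp (r (𝒰.act c⁻¹ y)).1) (s (r (𝒰.act c⁻¹ y)).2) = y := by
    intro c y hy
    obtain ⟨h1, h2⟩ := hrQ _ hy.2
    refine ⟨h1, ?_⟩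
    rw [𝒰.act_mul _ _ _ (hdom h1)]
    change 𝒰.act c (𝒰.flowOut s (r (𝒰.act c⁻¹ y))) = y
    rw [h2, 𝒰.act_act_inv _ hy.1]
  have hself : ∀ c v, v ∈ D → 𝒰.act c (s v) ∈ 𝒰.dom ∩ 𝒰.act c⁻¹ ⁻¹' Q := by
    intro c v hv
    refine ⟨𝒰.act_mem _ _ (hdom hv), ?_⟩
    rw [mem_preimage, 𝒰.act_inv_act _ (hdom hv)]
    exact hsQ hv
  have hWdom : W ⊆ 𝒰.dom := by
    rintro _ ⟨p, hp, rfl⟩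
    exact 𝒰.act_mem _ _ (hdom hp)
  have hWo : IsOpen W := by
    refine isOpen_iff_forall_mem_open.2 ?_
    rintro _ ⟨⟨c, v⟩, hv, rfl⟩
    exact ⟨_, fun y hy => ⟨(_, _), hloc c y hy⟩, 𝒰.isOpen_preimage_act c⁻¹ hQ, hself c v hv⟩
  have hθev : ∀ c v, v ∈ D → θ =ᶠ[𝓝 (𝒰.act c (s v))] fun y =>
      (c * Circle.exp (r (𝒰.act c⁻¹ y)).1, (r (𝒰.act c⁻¹ y)).2) := by
    intro c v hv
    filter_upwards [(𝒰.isOpen_preimage_act c⁻¹ hQ).mem_nhds (hself c v hv)] with y hy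
    obtain ⟨h1, h2⟩ := hloc c y hy
    have := hθ₂ (c * Circle.exp (r (𝒰.act c⁻¹ y)).1) _ h1
    rwa [h2] at this
  have hrs : ∀ c v, v ∈ D → ContMDiffAt 𝓘(ℝ, E) 𝓘(ℝ, ℝ × ℝ × Y) ∞ (fun y => r (𝒰.act c⁻¹ y))
      (𝒰.act c (s v)) := by
    intro c v hv
    have h1 := hself c v hv
    exact ContMDiffAt.comp (𝒰.act c (s v)) (hr.contMDiffAt (hQ.mem_nhds h1.2))
      (𝒰.contMDiffAt_act_const c⁻¹ h1.1)
  let σ : Slice 𝒰 Y :=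
  { D := D
    W := W
    sec := s
    angle := fun x => (θ x).1
    coord := fun x => (θ x).2
    finrank_eq := hY
    isOpen_D := hD
    isOpen_W := hWo
    W_subset := hWdom
    smooth_sec := hs₀.mono hDD
    smooth_angle := by
      rintro _ ⟨⟨c, v⟩, hv, rfl⟩
      refine ContMDiffAt.contMDiffWithinAt ?_
      have h1 : ContMDiffAt 𝓘(ℝ, E) (𝓡 1) ∞ (fun y => c * Circle.exp (r (𝒰.act c⁻¹ y)).1)
          (𝒰.act c (s v)) := by
        refine ContMDiffAt.mul contMDiffAt_const ?_
        exact contMDiff_circleExp.contMDiffAt.comp _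
          (contDiff_fst.contMDiff.contMDiffAt.comp _ (hrs c v hv))
      refine h1.congr_of_eventuallyEq ?_
      filter_upwards [hθev c v hv] with y hy
      rw [hy]
    smooth_coord := by
      rintro _ ⟨⟨c, v⟩, hv, rfl⟩
      refine ContMDiffAt.contMDiffWithinAt ?_
      refine (contDiff_snd.contMDiff.contMDiffAt.comp _ (hrs c v hv)).congr_of_eventuallyEq ?_
      filter_upwards [hθev c v hv] with y hy
      rw [hy]
      rfl
    act_sec_mem := fun c v hv => ⟨(c, v), hv, rfl⟩
    angle_act_sec := fun c v hv => by rw [hθ₂ c v hv]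
    coord_act_sec := fun c v hv => by rw [hθ₂ c v hv]
    coord_mem := fun x hx => (hθ₁ x hx).1
    act_angle := fun x hx => (hθ₁ x hx).2
    sec_mem_dom := hdom
    moment_sec := fun v hv => hmom v (hDD hv) }
  have hx1 : 𝒰.act 1 (s v₀) = x := by rw [hsv₀, 𝒰.act_one x hx]
  refine ⟨σ, ⟨(1, v₀), hv₀, hx1⟩, ?_⟩
  change (θ x).1 = 1
  rw [← hx1, hθ₂ 1 v₀ hv₀]

end LocalCircleAction
end ContactCut

namespace ContactCut

section ToCircle

/-- The angular part of a complex number, with value `1` at `0`. -/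
def toCircle (z : ℂ) : Circle := Circle.exp z.arg

theorem norm_mul_toCircle (z : ℂ) : (‖z‖ : ℂ) * (toCircle z : ℂ) = z := by
  rw [toCircle, Circle.coe_exp, Complex.norm_mul_exp_arg_mul_I]

theorem toCircle_real_mul {r : ℝ} (hr : 0 < r) (c : Circle) : toCircle (r * (c : ℂ)) = c := by
  rw [toCircle, Complex.arg_real_mul _ hr, Circle.exp_arg]

theorem toCircle_eq_mul_exp {z z₀ : ℂ} (hz : z ≠ 0) (h₀ : z₀ ≠ 0) :
    toCircle z = toCircle z₀ * Circle.exp (z / z₀).arg := by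
  change toCircle z = toCircle z₀ * toCircle (z / z₀)
  have h1 := norm_mul_toCircle z
  have h2 := norm_mul_toCircle z₀
  have h3 := norm_mul_toCircle (z / z₀)
  have hn : (‖z‖ : ℂ) ≠ 0 := by simpa using hz
  have h4 : (‖z‖ : ℂ) = ‖z₀‖ * ‖z / z₀‖ := by
    have : (‖z₀‖ : ℂ) ≠ 0 := by simpa using h₀
    rw [norm_div]
    push_cast
    field_simp
  refine Circle.ext (mul_left_cancel₀ hn ?_)
  rw [h1, Circle.coe_mul, h4, mul_mul_mul_comm, h2, h3]
  field_simp

theorem hasFDerivAt_arg_div {z₀ : ℂ} (h₀ : z₀ ≠ 0) :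
    HasFDerivAt (fun z : ℂ => (z / z₀).arg) ((Complex.normSq z₀)⁻¹ • imForm z₀) z₀ := by
  have h1 : HasDerivAt (fun z : ℂ => z / z₀) (1 / z₀) z₀ := (hasDerivAt_id z₀).div_const z₀
  have hs : z₀ / z₀ ∈ Complex.slitPlane := by rw [div_self h₀]; exact Complex.one_mem_slitPlane
  have h2 := (h1.clog hs).hasFDerivAt.restrictScalars ℝ
  have h3 := (Complex.imCLM.hasFDerivAt (x := Complex.log (z₀ / z₀))).comp z₀ h2
  refine (h3.congr_of_eventuallyEq ?_).congr_fderiv ?_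
  · exact Filter.Eventually.of_forall fun z => (Complex.log_im _).symm
  · refine ContinuousLinearMap.ext fun ζ => ?_
    have hi : (ζ / z₀).im = (Complex.normSq z₀)⁻¹ * imForm z₀ ζ := by
      rw [imForm_apply, Complex.div_im]
      ring
    rw [smul_apply, smul_eq_mul, ← hi]
    simp [div_self h₀, div_eq_mul_inv]

theorem contDiffAt_arg {z : ℂ} (hz : z ∈ Complex.slitPlane) : ContDiffAt ℝ ∞ Complex.arg z := by
  have h1 : ContDiffAt ℝ ∞ Complex.log z := (Complex.contDiffAt_log hz).restrict_scalars ℝ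
  exact (Complex.imCLM.contDiff.contDiffAt.comp z h1).congr_of_eventuallyEq
    (Filter.Eventually.of_forall fun z => (Complex.log_im _).symm)

theorem contMDiff_coe_circle : ContMDiff (𝓡 1) 𝓘(ℝ, ℂ) ∞ (fun c : Circle => (c : ℂ)) := by
  have : Fact (Module.finrank ℝ ℂ = 1 + 1) := finrank_real_complex_fact'
  exact (contMDiff_coe_sphere (E := ℂ) (n := 1) (m := ∞))

end ToCircle

section Derivatives

variable {E : Type*} [NormedAddCommGroup E] [NormedSpace ℝ E]
  {N : Type*} [TopologicalSpace N] [ChartedSpace E N]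
  {F : Type*} [NormedAddCommGroup F] [NormedSpace ℝ F]
  {F' : Type*} [NormedAddCommGroup F'] [NormedSpace ℝ F']

theorem pullbackRep_comp (α : OneForm 𝓘(ℝ, E) N) {f : F → N} {g : F' → F} {y : F'}
    (hf : MDifferentiableAt 𝓘(ℝ, F) 𝓘(ℝ, E) f (g y)) (hg : DifferentiableAt ℝ g y) :
    pullbackRep (fun y => f (g y)) α y = (pullbackRep f α (g y)).comp (fderiv ℝ g y) := by
  refine ContinuousLinearMap.ext fun v => ?_
  have h := mfderiv_comp (I := 𝓘(ℝ, F')) y hf hg.mdifferentiableAt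
  rw [mfderiv_eq_fderiv] at h
  exact congrArg (α (f (g y))) (DFunLike.congr_fun h v)

theorem bijective_modelDeriv_of_leftInverse [FiniteDimensional ℝ E] [FiniteDimensional ℝ F]
    (hdim : Module.finrank ℝ E = Module.finrank ℝ F) {g : F → N} {r : N → F} {y : F}
    (hg : ContMDiffAt 𝓘(ℝ, F) 𝓘(ℝ, E) ∞ g y) (hr : ContMDiffAt 𝓘(ℝ, E) 𝓘(ℝ, F) ∞ r (g y))
    (h : ∀ᶠ z in 𝓝 y, r (g z) = z) : Function.Bijective (modelDeriv E g y) := by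
  have hc := mfderiv_comp (I := 𝓘(ℝ, F)) y (hr.mdifferentiableAt (by simp))
    (hg.mdifferentiableAt (by simp))
  have he : r ∘ g =ᶠ[𝓝 y] id := h
  rw [he.mfderiv_eq, mfderiv_id] at hc
  have hinj : Function.Injective (modelDeriv E g y) := by
    refine Function.LeftInverse.injective (g := mfderiv 𝓘(ℝ, E) 𝓘(ℝ, F) r (g y)) fun v => ?_
    exact (DFunLike.congr_fun hc v).symm
  exact ⟨hinj, (LinearMap.injective_iff_surjective_of_finrank_eq_finrank
    (f := (modelDeriv E g y).toLinearMap) hdim.symm).1 hinj⟩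

end Derivatives

namespace Slice

variable {E : Type*} [NormedAddCommGroup E] [NormedSpace ℝ E] [FiniteDimensional ℝ E]
  {N : Type*} [TopologicalSpace N] [T2Space N] [ChartedSpace E N] [IsManifold 𝓘(ℝ, E) ∞ N]
  {Y : Type*} [NormedAddCommGroup Y] [NormedSpace ℝ Y] [FiniteDimensional ℝ Y]
  {α : OneForm 𝓘(ℝ, E) N} {𝒰 : LocalCircleAction α} (σ : Slice 𝒰 Y)

omit [T2Space N] [IsManifold 𝓘(ℝ, E) ∞ N] [FiniteDimensional ℝ E] [FiniteDimensional ℝ Y]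

theorem act_eq (c : Circle) {x : N} (hx : x ∈ σ.W) :
    𝒰.act c x = 𝒰.act (c * σ.angle x) (σ.sec (σ.coord x)) := by
  rw [𝒰.act_mul _ _ _ (σ.sec_mem_dom _ (σ.coord_mem x hx)), σ.act_angle x hx]

theorem act_mem (c : Circle) {x : N} (hx : x ∈ σ.W) : 𝒰.act c x ∈ σ.W := by
  rw [σ.act_eq c hx]
  exact σ.act_sec_mem _ _ (σ.coord_mem x hx)

theorem angle_act (c : Circle) {x : N} (hx : x ∈ σ.W) : σ.angle (𝒰.act c x) = c * σ.angle x := by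
  rw [σ.act_eq c hx, σ.angle_act_sec _ _ (σ.coord_mem x hx)]

theorem coord_act (c : Circle) {x : N} (hx : x ∈ σ.W) : σ.coord (𝒰.act c x) = σ.coord x := by
  rw [σ.act_eq c hx, σ.coord_act_sec _ _ (σ.coord_mem x hx)]

theorem moment_eq {x : N} (hx : x ∈ σ.W) : 𝒰.moment x = (σ.coord x).1 := by
  have h := σ.coord_mem x hx
  conv_lhs => rw [← σ.act_angle x hx]
  rw [𝒰.moment_act _ (σ.sec_mem_dom _ h), σ.moment_sec _ h]

/-- Polar coordinates around the zero level of the moment map: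
`(z, y) ↦ (z / |z|) • sec (|z|², y)`. -/
def polar (p : ℂ × Y) : N := 𝒰.act (toCircle p.1) (σ.sec (radial p))

theorem polar_eventuallyEq {p₀ : ℂ × Y} (h₀ : p₀.1 ≠ 0) (hp₀ : radial p₀ ∈ σ.D) :
    σ.polar =ᶠ[𝓝 p₀] fun p => 𝒰.act (toCircle p₀.1)
      (𝒰.flowOut σ.sec ((p.1 / p₀.1).arg, radial p)) := by
  have h1 : ∀ᶠ p : ℂ × Y in 𝓝 p₀, p.1 ≠ 0 :=
    (isOpen_ne.preimage continuous_fst).mem_nhds h₀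
  have h2 : ∀ᶠ p : ℂ × Y in 𝓝 p₀, radial p ∈ σ.D :=
    (σ.isOpen_D.preimage contDiff_radial.continuous).mem_nhds hp₀
  filter_upwards [h1, h2] with p hp hp'
  rw [polar, toCircle_eq_mul_exp hp h₀, 𝒰.act_mul _ _ _ (σ.sec_mem_dom _ hp')]
  rfl

theorem contDiffAt_angular {p₀ : ℂ × Y} (h₀ : p₀.1 ≠ 0) :
    ContDiffAt ℝ ∞ (fun p : ℂ × Y => ((p.1 / p₀.1).arg, radial p)) p₀ := by
  refine ContDiffAt.prodMk ?_ contDiff_radial.contDiffAt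
  refine ContDiffAt.comp (g := Complex.arg) p₀ (contDiffAt_arg ?_) ?_
  · rw [div_self h₀]; exact Complex.one_mem_slitPlane
  · exact contDiffAt_fst.mul contDiffAt_const

theorem contMDiffAt_flowOut_sec {p : ℝ × ℝ × Y} (hp : p.2 ∈ σ.D) :
    ContMDiffAt 𝓘(ℝ, ℝ × ℝ × Y) 𝓘(ℝ, E) ∞ (𝒰.flowOut σ.sec) p :=
  𝒰.contMDiffAt_flowOut (σ.smooth_sec.contMDiffAt (σ.isOpen_D.mem_nhds hp)) (σ.sec_mem_dom _ hp)

theorem contMDiffAt_polar {p₀ : ℂ × Y} (h₀ : p₀.1 ≠ 0) (hp₀ : radial p₀ ∈ σ.D) :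
    ContMDiffAt 𝓘(ℝ, ℂ × Y) 𝓘(ℝ, E) ∞ σ.polar p₀ := by
  refine ContMDiffAt.congr_of_eventuallyEq ?_ (σ.polar_eventuallyEq h₀ hp₀)
  refine 𝒰.contMDiffAt_act contMDiffAt_const ?_ (𝒰.act_mem _ _ (σ.sec_mem_dom _ hp₀))
  exact ContMDiffAt.comp p₀ (σ.contMDiffAt_flowOut_sec (p := ((p₀.1 / p₀.1).arg, radial p₀)) hp₀)
    (contDiffAt_angular h₀).contMDiffAt

theorem pullbackRep_flowOut_sec {p : ℝ × ℝ × Y} (hp : p.2 ∈ σ.D) :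
    pullbackRep (𝒰.flowOut σ.sec) α p = flowForm Prod.fst (pullbackRep σ.sec α) p := by
  rw [𝒰.pullbackRep_flowOut_eq_flowForm σ.isOpen_D σ.smooth_sec σ.sec_mem_dom hp]
  refine ContinuousLinearMap.ext fun a => ?_
  rw [flowForm_apply, flowForm_apply, σ.moment_sec _ hp]

theorem pullbackRep_polar {p₀ : ℂ × Y} (h₀ : p₀.1 ≠ 0) (hp₀ : radial p₀ ∈ σ.D) :
    pullbackRep σ.polar α p₀ = cutForm (pullbackRep σ.sec α) p₀ := by
  have hs := contDiffAt_angular h₀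
  have hf := σ.contMDiffAt_flowOut_sec (p := ((p₀.1 / p₀.1).arg, radial p₀)) hp₀
  have hd : HasFDerivAt (fun p : ℂ × Y => ((p.1 / p₀.1).arg, radial p)) _ p₀ :=
    ((hasFDerivAt_arg_div h₀).comp p₀ hasFDerivAt_fst).prodMk (hasFDerivAt_radial p₀)
  rw [pullbackRep_congr α (σ.polar_eventuallyEq h₀ hp₀),
    𝒰.pullbackRep_act _ (g := fun p => 𝒰.flowOut σ.sec ((p.1 / p₀.1).arg, radial p))
      (ContMDiffAt.comp p₀ hf hs.contMDiffAt) (𝒰.act_mem _ _ (σ.sec_mem_dom _ hp₀)),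
    pullbackRep_comp α (f := 𝒰.flowOut σ.sec) (g := fun p : ℂ × Y => ((p.1 / p₀.1).arg, radial p))
      (hf.mdifferentiableAt (by simp))
      (hs.differentiableAt (by simp)), σ.pullbackRep_flowOut_sec hp₀, hd.fderiv]
  refine ContinuousLinearMap.ext fun a => ?_
  have hn : Complex.normSq p₀.1 ≠ 0 := by simpa using h₀
  rw [ContinuousLinearMap.comp_apply, flowForm_apply, cutForm_apply]
  congr 1
  simp only [ContinuousLinearMap.prod_apply, ContinuousLinearMap.comp_apply,
    smul_apply, ContinuousLinearMap.coe_fst', radial, smul_eq_mul]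
  field_simp

theorem contMDiffAt_arg_angle {x : N} (hx : x ∈ σ.W)
    (h : (σ.angle x : ℂ) ∈ Complex.slitPlane) :
    ContMDiffAt 𝓘(ℝ, E) 𝓘(ℝ, ℝ) ∞ (fun x => (σ.angle x : ℂ).arg) x := by
  have h1 := σ.smooth_angle.contMDiffAt (σ.isOpen_W.mem_nhds hx)
  have h2 : ContMDiffAt 𝓘(ℝ, E) 𝓘(ℝ, ℂ) ∞ (fun x => (σ.angle x : ℂ)) x :=
    contMDiff_coe_circle.contMDiffAt.comp x h1
  exact ContMDiffAt.comp (g := Complex.arg) x (contDiffAt_arg h).contMDiffAt h2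

theorem contMDiffAt_coord {x : N} (hx : x ∈ σ.W) :
    ContMDiffAt 𝓘(ℝ, E) 𝓘(ℝ, ℝ × Y) ∞ σ.coord x :=
  σ.smooth_coord.contMDiffAt (σ.isOpen_W.mem_nhds hx)

theorem contDiffAt_pullbackRep_sec [IsManifold 𝓘(ℝ, E) ∞ N] (hα : IsSmoothForm 𝓘(ℝ, E) α)
    {v : ℝ × Y} (hv : v ∈ σ.D) : ContDiffAt ℝ ∞ (pullbackRep σ.sec α) v :=
  hα.contDiffAt_pullbackRep (σ.smooth_sec.contMDiffAt (σ.isOpen_D.mem_nhds hv))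

theorem flowOut_sec_leftInverse {p : ℝ × ℝ × Y} (h1 : p.1 ∈ Ioo (-Real.pi) Real.pi)
    (h2 : p.2 ∈ σ.D) : ((σ.angle (𝒰.flowOut σ.sec p) : ℂ).arg, σ.coord (𝒰.flowOut σ.sec p)) = p := by
  refine Prod.ext ?_ (σ.coord_act_sec _ _ h2)
  simp only [LocalCircleAction.flowOut]
  rw [σ.angle_act_sec _ _ h2, Circle.arg_exp h1.1 h1.2.le]

theorem exp_mem_slitPlane {t : ℝ} (ht : t ∈ Ioo (-Real.pi) Real.pi) :
    (Circle.exp t : ℂ) ∈ Complex.slitPlane := by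
  rw [Complex.mem_slitPlane_iff_arg, Circle.arg_exp ht.1 ht.2.le]
  exact ⟨ht.2.ne, Circle.coe_ne_zero _⟩

theorem contactAt_reducedForm [IsManifold 𝓘(ℝ, E) ∞ N] [FiniteDimensional ℝ E]
    [FiniteDimensional ℝ Y] (hα : IsContactForm 𝓘(ℝ, E) α) {y : Y} (hy : ((0 : ℝ), y) ∈ σ.D) :
    ContactAt (reducedForm (pullbackRep σ.sec α)) y := by
  have h0 : (0 : ℝ) ∈ Ioo (-Real.pi) Real.pi := ⟨by linarith [Real.pi_pos], Real.pi_pos⟩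
  have hmem : 𝒰.flowOut σ.sec (0, (0, y)) ∈ σ.W := σ.act_sec_mem _ _ hy
  have hsl : (σ.angle (𝒰.flowOut σ.sec (0, (0, y))) : ℂ) ∈ Complex.slitPlane := by
    have : σ.angle (𝒰.flowOut σ.sec (0, (0, y))) = Circle.exp 0 := σ.angle_act_sec _ _ hy
    rw [this]
    exact exp_mem_slitPlane h0
  have hdim : Module.finrank ℝ E = Module.finrank ℝ (ℝ × ℝ × Y) := by
    simp [σ.finrank_eq]
    ring
  have hc := hα.contactAt_pullbackRep (σ.contMDiffAt_flowOut_sec (p := (0, (0, y))) hy)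
    (bijective_modelDeriv_of_leftInverse (E := E) hdim
      (σ.contMDiffAt_flowOut_sec hy) (r := fun x => ((σ.angle x : ℂ).arg, σ.coord x))
      ((σ.contMDiffAt_arg_angle hmem hsl).prodMk_space (σ.contMDiffAt_coord hmem)) (by
        filter_upwards [(isOpen_Ioo.prod σ.isOpen_D).mem_nhds (show ((0 : ℝ), (0 : ℝ), y) ∈ _ from
          ⟨h0, hy⟩)] with p hp
        exact σ.flowOut_sec_leftInverse hp.1 hp.2))
  refine ContactAt.reducedForm (τ := 0)
    ((σ.contDiffAt_pullbackRep_sec hα.smooth hy).differentiableAt (by simp)) (hc.congr ?_)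
  filter_upwards [(σ.isOpen_D.preimage continuous_snd).mem_nhds
    (x := ((0 : ℝ), (0 : ℝ), y)) hy] with p hp
  exact (σ.pullbackRep_flowOut_sec hp).symm

end Slice
end ContactCut

namespace ContactCut

variable {E : Type*} [NormedAddCommGroup E] [NormedSpace ℝ E]
  {N : Type*} [TopologicalSpace N] [ChartedSpace E N]
  {Y : Type*} [NormedAddCommGroup Y] [NormedSpace ℝ Y]
  {α : OneForm 𝓘(ℝ, E) N} {𝒰 : LocalCircleAction α}

/-- The topological data of a cut: the embedding `ι : M → N`, the boundary `b`, the quotient maps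
`q : M → X` and `p : b → B`, and the inclusion `j : B → X`. -/
structure CutData (𝒰 : LocalCircleAction α) (M X B : Type*) [TopologicalSpace M]
    [TopologicalSpace X] [TopologicalSpace B] where
  /-- the boundary -/
  b : Set M
  /-- the embedding -/
  ι : M → N
  /-- the quotient map -/
  q : M → X
  /-- the orbit map of the boundary -/
  p : b → B
  /-- the inclusion of the orbit space of the boundary -/
  j : B → X
  isEmbedding_ι : IsEmbedding ι
  isOpen_image_compl : IsOpen (ι '' bᶜ)
  mem_b_iff : ∀ m, m ∈ b ↔ ι m ∈ 𝒰.dom ∧ 𝒰.moment (ι m) = 0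
  mem_range_iff : ∀ x ∈ 𝒰.dom, x ∈ range ι ↔ 0 ≤ 𝒰.moment x
  isQuotientMap_q : IsQuotientMap q
  isQuotientMap_p : IsQuotientMap p
  q_eq_iff : ∀ m m', q m = q m' ↔ m = m' ∨ (m ∈ b ∧ m' ∈ b ∧ ∃ c, ι m = 𝒰.act c (ι m'))
  p_eq_iff : ∀ m m' : b, p m = p m' ↔ ∃ c, ι m = 𝒰.act c (ι m')
  j_p : ∀ m : b, j (p m) = q m

namespace Slice

variable (σ : Slice 𝒰 Y)

/-- The inverse of `polar` on the set where the moment map is nonnegative. -/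
def complexCoord (x : N) : ℂ × Y :=
  ((Real.sqrt (σ.coord x).1 : ℂ) * (σ.angle x : ℂ), (σ.coord x).2)

theorem radial_complexCoord {x : N} (h : 0 ≤ (σ.coord x).1) :
    radial (σ.complexCoord x) = σ.coord x := by
  refine Prod.ext ?_ rfl
  simp only [radial, complexCoord, map_mul, Complex.normSq_ofReal, Circle.normSq_coe, mul_one]
  exact Real.mul_self_sqrt h

theorem polar_mem {p : ℂ × Y} (hp : radial p ∈ σ.D) : σ.polar p ∈ σ.W := σ.act_sec_mem _ _ hp

theorem coord_polar {p : ℂ × Y} (hp : radial p ∈ σ.D) : σ.coord (σ.polar p) = radial p :=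
  σ.coord_act_sec _ _ hp

theorem complexCoord_polar {p : ℂ × Y} (hp : radial p ∈ σ.D) :
    σ.complexCoord (σ.polar p) = p := by
  refine Prod.ext ?_ ?_
  · have h : σ.angle (σ.polar p) = toCircle p.1 := σ.angle_act_sec _ _ hp
    simp only [complexCoord]
    rw [σ.coord_polar hp, h]
    exact norm_mul_toCircle p.1
  · simp only [complexCoord]
    rw [σ.coord_polar hp]
    rfl

theorem polar_complexCoord {x : N} (hx : x ∈ σ.W) (h : 0 ≤ (σ.coord x).1) :
    ∃ c, σ.polar (σ.complexCoord x) = 𝒰.act c x ∧ ((σ.coord x).1 ≠ 0 → c = 1) := by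
  have hd := σ.coord_mem x hx
  refine ⟨toCircle (σ.complexCoord x).1 * (σ.angle x)⁻¹, ?_, fun hne => ?_⟩
  · rw [σ.act_eq _ hx, inv_mul_cancel_right, polar, σ.radial_complexCoord h]
  · have : toCircle (σ.complexCoord x).1 = σ.angle x :=
      toCircle_real_mul (Real.sqrt_pos.2 (h.lt_of_ne' hne)) _
    rw [this, mul_inv_cancel]

theorem continuousOn_complexCoord : ContinuousOn σ.complexCoord σ.W := by
  have h1 := σ.smooth_coord.continuousOn
  have h2 : ContinuousOn (fun x => (σ.angle x : ℂ)) σ.W :=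
    contMDiff_coe_circle.continuous.comp_continuousOn σ.smooth_angle.continuousOn
  refine ContinuousOn.prodMk (ContinuousOn.mul ?_ h2) (continuous_snd.comp_continuousOn h1)
  exact Complex.continuous_ofReal.comp_continuousOn
    (Real.continuous_sqrt.comp_continuousOn (continuous_fst.comp_continuousOn h1))

theorem complexCoord_act {x : N} (hx : x ∈ σ.W) (h : 𝒰.moment x = 0) (c : Circle) :
    σ.complexCoord (𝒰.act c x) = σ.complexCoord x := by
  rw [σ.moment_eq hx] at h
  simp [complexCoord, σ.coord_act c hx, h]

/-- The part of a slice where the angular coordinate is not `-1`. -/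
def cutDom : Set N := σ.W ∩ (fun x => (σ.angle x : ℂ)) ⁻¹' Complex.slitPlane

theorem isOpen_cutDom : IsOpen σ.cutDom :=
  (contMDiff_coe_circle.continuous.comp_continuousOn σ.smooth_angle.continuousOn).isOpen_inter_preimage
    σ.isOpen_W Complex.isOpen_slitPlane

theorem flowOut_mem_cutDom {p : ℝ × ℝ × Y} (h1 : p.1 ∈ Ioo (-Real.pi) Real.pi) (h2 : p.2 ∈ σ.D) :
    𝒰.flowOut σ.sec p ∈ σ.cutDom := by
  refine ⟨σ.act_sec_mem _ _ h2, ?_⟩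
  have : σ.angle (𝒰.flowOut σ.sec p) = Circle.exp p.1 := σ.angle_act_sec _ _ h2
  rw [mem_preimage, this]
  exact exp_mem_slitPlane h1

theorem arg_angle_mem {x : N} (hx : x ∈ σ.cutDom) :
    (σ.angle x : ℂ).arg ∈ Ioo (-Real.pi) Real.pi :=
  ⟨Complex.neg_pi_lt_arg _, lt_of_le_of_ne (Complex.arg_le_pi _)
    (Complex.mem_slitPlane_iff_arg.1 hx.2).1⟩

theorem flowOut_arg_angle {x : N} (hx : x ∈ σ.W) :
    𝒰.flowOut σ.sec ((σ.angle x : ℂ).arg, σ.coord x) = x := by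
  rw [LocalCircleAction.flowOut, Circle.exp_arg, σ.act_angle x hx]

/-- The slice chart `(arg angle, coord)` of the ambient manifold. -/
def ambientChart : OpenPartialHomeomorph N (ℝ × ℝ × Y) where
  toFun x := ((σ.angle x : ℂ).arg, σ.coord x)
  invFun := 𝒰.flowOut σ.sec
  source := σ.cutDom
  target := Ioo (-Real.pi) Real.pi ×ˢ σ.D
  map_source' _ hx := ⟨σ.arg_angle_mem hx, σ.coord_mem _ hx.1⟩
  map_target' _ hp := σ.flowOut_mem_cutDom hp.1 hp.2
  left_inv' _ hx := σ.flowOut_arg_angle hx.1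
  right_inv' _ hp := σ.flowOut_sec_leftInverse hp.1 hp.2
  open_source := σ.isOpen_cutDom
  open_target := isOpen_Ioo.prod σ.isOpen_D
  continuousOn_toFun _ hx := ((σ.contMDiffAt_arg_angle hx.1 hx.2).prodMk_space
    (σ.contMDiffAt_coord hx.1)).continuousAt.continuousWithinAt
  continuousOn_invFun _ hp := (σ.contMDiffAt_flowOut_sec hp.2).continuousAt.continuousWithinAt

end Slice

namespace CutData

variable {M X B : Type*} [TopologicalSpace M] [TopologicalSpace X] [TopologicalSpace B]
  (𝒞 : CutData 𝒰 M X B) (σ : Slice 𝒰 Y)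

theorem isOpen_compl_b : IsOpen 𝒞.bᶜ := by
  rw [← preimage_image_eq 𝒞.bᶜ 𝒞.isEmbedding_ι.injective]
  exact 𝒞.isOpen_image_compl.preimage 𝒞.isEmbedding_ι.continuous

theorem continuous_j : Continuous 𝒞.j := by
  rw [𝒞.isQuotientMap_p.continuous_iff]
  have : 𝒞.j ∘ 𝒞.p = fun m : 𝒞.b => 𝒞.q m := funext 𝒞.j_p
  rw [this]
  exact 𝒞.isQuotientMap_q.continuous.comp continuous_subtype_val

theorem mem_b_of_act {m m' : M} (hm : m ∈ 𝒞.b) {c : Circle} (h : 𝒞.ι m' = 𝒰.act c (𝒞.ι m)) :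
    m' ∈ 𝒞.b := by
  have h1 := (𝒞.mem_b_iff m).1 hm
  rw [𝒞.mem_b_iff, h, 𝒰.moment_act c h1.1]
  exact ⟨𝒰.act_mem _ _ h1.1, h1.2⟩

theorem q_eq_of_act {m m' : M} (hm : m ∈ 𝒞.b) {c : Circle} (h : 𝒞.ι m' = 𝒰.act c (𝒞.ι m)) :
    𝒞.q m' = 𝒞.q m :=
  (𝒞.q_eq_iff _ _).2 (Or.inr ⟨𝒞.mem_b_of_act hm h, hm, c, h⟩)

theorem moment_nonneg {m : M} (hm : 𝒞.ι m ∈ 𝒰.dom) : 0 ≤ 𝒰.moment (𝒞.ι m) :=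
  (𝒞.mem_range_iff _ hm).1 ⟨m, rfl⟩

theorem coord_nonneg {m : M} (hm : 𝒞.ι m ∈ σ.W) : 0 ≤ (σ.coord (𝒞.ι m)).1 := by
  rw [← σ.moment_eq hm]
  exact 𝒞.moment_nonneg (σ.W_subset hm)

theorem mem_b_iff_coord {m : M} (hm : 𝒞.ι m ∈ σ.W) : m ∈ 𝒞.b ↔ (σ.coord (𝒞.ι m)).1 = 0 := by
  rw [𝒞.mem_b_iff, σ.moment_eq hm, and_iff_right (σ.W_subset hm)]

theorem mem_range_of_coord {x : N} (hx : x ∈ σ.W) (h : 0 ≤ (σ.coord x).1) : x ∈ range 𝒞.ι := by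
  rw [𝒞.mem_range_iff _ (σ.W_subset hx), σ.moment_eq hx]
  exact h

/-- A representative in `N` of a point of the cut space. -/
def lift (x : X) : N := 𝒞.ι (Function.surjInv 𝒞.isQuotientMap_q.surjective x)

theorem lift_q_cases (m : M) :
    𝒞.lift (𝒞.q m) = 𝒞.ι m ∨ (m ∈ 𝒞.b ∧ ∃ c, 𝒞.lift (𝒞.q m) = 𝒰.act c (𝒞.ι m)) := by
  rcases (𝒞.q_eq_iff _ _).1 (Function.surjInv_eq 𝒞.isQuotientMap_q.surjective (𝒞.q m)) with
    h | ⟨-, h, c, hc⟩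
  · exact Or.inl (congrArg 𝒞.ι h)
  · exact Or.inr ⟨h, c, hc⟩

theorem lift_q {m : M} (hm : m ∉ 𝒞.b) : 𝒞.lift (𝒞.q m) = 𝒞.ι m := by
  rcases 𝒞.lift_q_cases m with h | ⟨h, -⟩
  · exact h
  · exact absurd h hm

theorem mem_preimage_image_iff {S : Set M} (hS : S ⊆ 𝒞.bᶜ) (m : M) : 𝒞.q m ∈ 𝒞.q '' S ↔ m ∈ S := by
  refine ⟨?_, fun h => ⟨m, h, rfl⟩⟩
  rintro ⟨m', hm', h⟩
  rcases (𝒞.q_eq_iff _ _).1 h with rfl | ⟨h, -⟩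
  · exact hm'
  · exact absurd h (hS hm')

theorem q_mem_image_W_iff (m : M) : 𝒞.q m ∈ 𝒞.q '' (𝒞.ι ⁻¹' σ.W) ↔ 𝒞.ι m ∈ σ.W := by
  refine ⟨?_, fun h => ⟨m, h, rfl⟩⟩
  rintro ⟨m', hm', h⟩
  rcases (𝒞.q_eq_iff _ _).1 h.symm with rfl | ⟨-, -, c, hc⟩
  · exact hm'
  · rw [hc]
    exact σ.act_mem c hm'

theorem p_mem_image_W_iff (m : 𝒞.b) : 𝒞.p m ∈ 𝒞.p '' {m | 𝒞.ι m ∈ σ.W} ↔ 𝒞.ι m ∈ σ.W := by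
  refine ⟨?_, fun h => ⟨m, h, rfl⟩⟩
  rintro ⟨m', hm', h⟩
  obtain ⟨c, hc⟩ := (𝒞.p_eq_iff _ _).1 h.symm
  rw [hc]
  exact σ.act_mem c hm'

theorem complexCoord_lift {m : M} (hm : 𝒞.ι m ∈ σ.W) :
    σ.complexCoord (𝒞.lift (𝒞.q m)) = σ.complexCoord (𝒞.ι m) := by
  rcases 𝒞.lift_q_cases m with h | ⟨h, c, hc⟩
  · rw [h]
  · rw [hc, σ.complexCoord_act hm ((𝒞.mem_b_iff m).1 h).2]

section Proj

variable [Nonempty M]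

/-- The projection to the cut space of the image of `ι`. -/
def proj (x : N) : X := 𝒞.q (Function.invFun 𝒞.ι x)

theorem proj_ι (m : M) : 𝒞.proj (𝒞.ι m) = 𝒞.q m := by
  rw [proj, Function.leftInverse_invFun 𝒞.isEmbedding_ι.injective m]

theorem continuousOn_invFun_ι : ContinuousOn (Function.invFun 𝒞.ι) (range 𝒞.ι) := by
  rw [𝒞.isEmbedding_ι.continuousOn_iff]
  exact continuousOn_id.congr fun x hx => Function.invFun_eq hx

theorem continuousOn_proj : ContinuousOn 𝒞.proj (range 𝒞.ι) :=
  𝒞.isQuotientMap_q.continuous.comp_continuousOn 𝒞.continuousOn_invFun_ι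

/-- The identification of the complement of `B` in the cut space with an open subset of `N`. -/
def interiorChart : OpenPartialHomeomorph X N where
  toFun := 𝒞.lift
  invFun := 𝒞.proj
  source := 𝒞.q '' 𝒞.bᶜ
  target := 𝒞.ι '' 𝒞.bᶜ
  map_source' := by
    rintro _ ⟨m, hm, rfl⟩
    exact ⟨m, hm, (𝒞.lift_q hm).symm⟩
  map_target' := by
    rintro _ ⟨m, hm, rfl⟩
    exact ⟨m, hm, (𝒞.proj_ι m).symm⟩
  left_inv' := by
    rintro _ ⟨m, hm, rfl⟩
    rw [𝒞.lift_q hm, 𝒞.proj_ι]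
  right_inv' := by
    rintro _ ⟨m, hm, rfl⟩
    rw [𝒞.proj_ι, 𝒞.lift_q hm]
  open_source := by
    rw [← 𝒞.isQuotientMap_q.isOpen_preimage]
    have : 𝒞.q ⁻¹' (𝒞.q '' 𝒞.bᶜ) = 𝒞.bᶜ := Set.ext fun m => 𝒞.mem_preimage_image_iff subset_rfl m
    rw [this]
    exact 𝒞.isOpen_compl_b
  open_target := 𝒞.isOpen_image_compl
  continuousOn_toFun := by
    have : 𝒞.q ⁻¹' (𝒞.q '' 𝒞.bᶜ) = 𝒞.bᶜ := Set.ext fun m => 𝒞.mem_preimage_image_iff subset_rfl m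
    rw [𝒞.isQuotientMap_q.continuousOn_isOpen_iff, this]
    · exact 𝒞.isEmbedding_ι.continuous.continuousOn.congr fun m hm => 𝒞.lift_q hm
    · rw [← 𝒞.isQuotientMap_q.isOpen_preimage, this]
      exact 𝒞.isOpen_compl_b
  continuousOn_invFun := 𝒞.continuousOn_proj.mono (image_subset_range _ _)

omit [Nonempty M] in
theorem polar_mem_range {p : ℂ × Y} (hp : radial p ∈ σ.D) : σ.polar p ∈ range 𝒞.ι := by
  refine 𝒞.mem_range_of_coord σ (σ.polar_mem hp) ?_
  rw [σ.coord_polar hp]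
  exact Complex.normSq_nonneg _

theorem continuousOn_proj_polar :
    ContinuousOn (fun p => 𝒞.proj (σ.polar p)) {p | radial p ∈ σ.D} := by
  have hDo : IsOpen {p : ℂ × Y | radial p ∈ σ.D} :=
    σ.isOpen_D.preimage contDiff_radial.continuous
  intro p₀ hp₀
  by_cases h0 : p₀.1 = 0
  · refine ContinuousAt.continuousWithinAt ?_
    have hr0 : radial p₀ = (0, p₀.2) := by simp [radial, h0]
    obtain ⟨m₀, hm₀⟩ := 𝒞.polar_mem_range σ hp₀
    have hm₀W : 𝒞.ι m₀ ∈ σ.W := by rw [hm₀]; exact σ.polar_mem hp₀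
    have hm₀b : m₀ ∈ 𝒞.b := by
      rw [𝒞.mem_b_iff_coord σ hm₀W, hm₀, σ.coord_polar hp₀, hr0]
    refine Filter.tendsto_def.2 fun O hO => ?_
    obtain ⟨O₁, hO₁s, hO₁o, hO₁⟩ := mem_nhds_iff.1 hO
    obtain ⟨O', hO'o, hO'⟩ := 𝒞.isEmbedding_ι.isInducing.isOpen_iff.1
      (hO₁o.preimage 𝒞.isQuotientMap_q.continuous)
    set S : Set (Circle × (ℝ × Y)) := (univ ×ˢ σ.D) ∩
      (fun p => 𝒰.act p.1 (σ.sec p.2)) ⁻¹' O' with hS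
    have hSo : IsOpen S := by
      refine ContinuousOn.isOpen_inter_preimage ?_ (isOpen_univ.prod σ.isOpen_D) hO'o
      refine 𝒰.continuousOn_act.comp (f := fun p : Circle × (ℝ × Y) => (p.1, σ.sec p.2))
        (continuousOn_fst.prodMk (σ.smooth_sec.continuousOn.comp (by fun_prop) fun p hp => hp.2))
        fun p hp => ⟨mem_univ _, σ.sec_mem_dom _ hp.2⟩
    have hCS : (univ : Set Circle) ×ˢ {radial p₀} ⊆ S := by
      rintro ⟨c, v⟩ ⟨-, hv⟩
      rw [mem_singleton_iff] at hv
      subst hv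
      refine ⟨⟨mem_univ _, hp₀⟩, ?_⟩
      have hx : 𝒰.act c (σ.sec (radial p₀)) = 𝒰.act (c * (toCircle p₀.1)⁻¹) (𝒞.ι m₀) := by
        rw [hm₀, Slice.polar, ← 𝒰.act_mul _ _ _ (σ.sec_mem_dom _ hp₀), inv_mul_cancel_right]
      have hr : 𝒰.act c (σ.sec (radial p₀)) ∈ range 𝒞.ι := by
        refine 𝒞.mem_range_of_coord σ (σ.act_sec_mem _ _ hp₀) ?_
        rw [σ.coord_act_sec _ _ hp₀]
        exact Complex.normSq_nonneg _
      obtain ⟨m, hm⟩ := hr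
      change 𝒰.act c (σ.sec (radial p₀)) ∈ O'
      rw [← hm]
      change m ∈ 𝒞.ι ⁻¹' O'
      rw [hO', mem_preimage, 𝒞.q_eq_of_act hm₀b (hm.trans hx), ← 𝒞.proj_ι, hm₀]
      exact hO₁
    obtain ⟨u, w, -, hwo, hu, hw, huw⟩ := generalized_tube_lemma isCompact_univ
      isCompact_singleton hSo hCS
    filter_upwards [(hwo.preimage contDiff_radial.continuous).mem_nhds (hw rfl)] with p hp
    have hpS : (toCircle p.1, radial p) ∈ S := huw ⟨hu (mem_univ _), hp⟩
    obtain ⟨m, hm⟩ := 𝒞.polar_mem_range σ hpS.1.2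
    have h3 : 𝒞.ι m ∈ O' := by rw [hm]; exact hpS.2
    rw [mem_preimage, ← hm, 𝒞.proj_ι]
    refine hO₁s ?_
    have : m ∈ 𝒞.ι ⁻¹' O' := h3
    rwa [hO'] at this
  · exact ContinuousWithinAt.comp (g := 𝒞.proj) (f := σ.polar) (𝒞.continuousOn_proj _ (𝒞.polar_mem_range σ hp₀))
      (σ.contMDiffAt_polar h0 hp₀).continuousAt.continuousWithinAt
      fun p hp => 𝒞.polar_mem_range σ hp

/-- The chart of the cut space around a point of `B` given by a slice. -/
def sliceChart : OpenPartialHomeomorph X (ℂ × Y) where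
  toFun x := σ.complexCoord (𝒞.lift x)
  invFun p := 𝒞.proj (σ.polar p)
  source := 𝒞.q '' (𝒞.ι ⁻¹' σ.W)
  target := {p | radial p ∈ σ.D}
  map_source' := by
    rintro _ ⟨m, hm, rfl⟩
    rw [mem_ofPred_eq, 𝒞.complexCoord_lift σ hm, σ.radial_complexCoord (𝒞.coord_nonneg σ hm)]
    exact σ.coord_mem _ hm
  map_target' p hp := by
    obtain ⟨m, hm⟩ := 𝒞.polar_mem_range σ hp
    have h := σ.polar_mem hp
    rw [← hm] at h ⊢
    exact ⟨m, h, (𝒞.proj_ι m).symm⟩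
  left_inv' := by
    rintro _ ⟨m, hm, rfl⟩
    have hc := 𝒞.coord_nonneg σ hm
    have h := 𝒞.complexCoord_lift σ hm
    have hrad : radial (σ.complexCoord (𝒞.ι m)) ∈ σ.D := by
      rw [σ.radial_complexCoord hc]; exact σ.coord_mem _ hm
    obtain ⟨c, hc1, hc2⟩ := σ.polar_complexCoord hm hc
    obtain ⟨m', hm'⟩ := 𝒞.polar_mem_range σ hrad
    rw [h, ← hm', 𝒞.proj_ι]
    by_cases hb : m ∈ 𝒞.b
    · exact 𝒞.q_eq_of_act hb (hm'.trans hc1)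
    · rw [𝒞.mem_b_iff_coord σ hm] at hb
      rw [hc2 hb, 𝒰.act_one _ (σ.W_subset hm)] at hc1
      rw [𝒞.isEmbedding_ι.injective (hm'.trans hc1)]
  right_inv' p hp := by
    obtain ⟨m, hm⟩ := 𝒞.polar_mem_range σ hp
    have h := σ.polar_mem hp
    have h2 := σ.complexCoord_polar hp
    rw [← hm] at h h2 ⊢
    rw [𝒞.proj_ι, 𝒞.complexCoord_lift σ h, h2]
  open_source := by
    rw [← 𝒞.isQuotientMap_q.isOpen_preimage]
    have : 𝒞.q ⁻¹' (𝒞.q '' (𝒞.ι ⁻¹' σ.W)) = 𝒞.ι ⁻¹' σ.W := Set.ext fun m => 𝒞.q_mem_image_W_iff σ m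
    rw [this]
    exact σ.isOpen_W.preimage 𝒞.isEmbedding_ι.continuous
  open_target := σ.isOpen_D.preimage contDiff_radial.continuous
  continuousOn_toFun := by
    have : 𝒞.q ⁻¹' (𝒞.q '' (𝒞.ι ⁻¹' σ.W)) = 𝒞.ι ⁻¹' σ.W := Set.ext fun m => 𝒞.q_mem_image_W_iff σ m
    rw [𝒞.isQuotientMap_q.continuousOn_isOpen_iff, this]
    · exact (σ.continuousOn_complexCoord.comp 𝒞.isEmbedding_ι.continuous.continuousOn
        fun m hm => hm).congr fun m hm => 𝒞.complexCoord_lift σ hm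
    · rw [← 𝒞.isQuotientMap_q.isOpen_preimage, this]
      exact σ.isOpen_W.preimage 𝒞.isEmbedding_ι.continuous
  continuousOn_invFun := 𝒞.continuousOn_proj_polar σ

end Proj

/-- The restriction of `ι` to the boundary. -/
def ιb (m : 𝒞.b) : N := 𝒞.ι m

theorem isEmbedding_ιb : IsEmbedding 𝒞.ιb := 𝒞.isEmbedding_ι.comp IsEmbedding.subtypeVal

theorem mem_range_ιb {x : N} (hx : x ∈ σ.W) (h : (σ.coord x).1 = 0) : x ∈ range 𝒞.ιb := by
  obtain ⟨m, rfl⟩ := 𝒞.mem_range_of_coord σ hx h.ge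
  exact ⟨⟨m, (𝒞.mem_b_iff_coord σ hx).2 h⟩, rfl⟩

theorem coord_ιb {m : 𝒞.b} (hm : 𝒞.ιb m ∈ σ.W) : σ.coord (𝒞.ιb m) = (0, (σ.coord (𝒞.ιb m)).2) :=
  Prod.ext ((𝒞.mem_b_iff_coord σ hm).1 m.2) rfl

/-- A representative in `N` of a point of `B`. -/
def liftB (x : B) : N := 𝒞.ιb (Function.surjInv 𝒞.isQuotientMap_p.surjective x)

theorem liftB_p (m : 𝒞.b) : ∃ c, 𝒞.liftB (𝒞.p m) = 𝒰.act c (𝒞.ιb m) :=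
  (𝒞.p_eq_iff _ _).1 (Function.surjInv_eq 𝒞.isQuotientMap_p.surjective (𝒞.p m))

theorem coord_liftB {m : 𝒞.b} (hm : 𝒞.ιb m ∈ σ.W) :
    σ.coord (𝒞.liftB (𝒞.p m)) = σ.coord (𝒞.ιb m) := by
  obtain ⟨c, hc⟩ := 𝒞.liftB_p m
  rw [hc, σ.coord_act c hm]

section Boundary

variable [Nonempty 𝒞.b]

/-- The inverse of `ιb`. -/
def invb (x : N) : 𝒞.b := Function.invFun 𝒞.ιb x

theorem invb_ιb (m : 𝒞.b) : 𝒞.invb (𝒞.ιb m) = m :=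
  Function.leftInverse_invFun 𝒞.isEmbedding_ιb.injective m

theorem ιb_invb {x : N} (hx : x ∈ range 𝒞.ιb) : 𝒞.ιb (𝒞.invb x) = x := Function.invFun_eq hx

theorem continuousOn_invb : ContinuousOn 𝒞.invb (range 𝒞.ιb) := by
  rw [𝒞.isEmbedding_ιb.continuousOn_iff]
  exact continuousOn_id.congr fun x hx => 𝒞.ιb_invb hx

omit [Nonempty 𝒞.b] in
theorem flowOut_mem_range {t : ℝ} {y : Y} (hy : ((0 : ℝ), y) ∈ σ.D) :
    𝒰.flowOut σ.sec (t, (0, y)) ∈ range 𝒞.ιb :=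
  𝒞.mem_range_ιb σ (σ.act_sec_mem _ _ hy) (by
    rw [LocalCircleAction.flowOut, σ.coord_act_sec _ _ hy])

/-- The chart of the boundary given by a slice. -/
def boundaryChart : OpenPartialHomeomorph 𝒞.b (ℝ × Y) where
  toFun m := ((σ.angle (𝒞.ιb m) : ℂ).arg, (σ.coord (𝒞.ιb m)).2)
  invFun v := 𝒞.invb (𝒰.flowOut σ.sec (v.1, (0, v.2)))
  source := 𝒞.ιb ⁻¹' σ.cutDom
  target := Ioo (-Real.pi) Real.pi ×ˢ {y | ((0 : ℝ), y) ∈ σ.D}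
  map_source' m hm := by
    refine ⟨σ.arg_angle_mem hm, ?_⟩
    have := σ.coord_mem _ hm.1
    rwa [𝒞.coord_ιb σ hm.1] at this
  map_target' v hv := by
    rw [mem_preimage, 𝒞.ιb_invb (𝒞.flowOut_mem_range σ hv.2)]
    exact σ.flowOut_mem_cutDom hv.1 hv.2
  left_inv' m hm := by
    rw [← 𝒞.coord_ιb σ hm.1, σ.flowOut_arg_angle hm.1, 𝒞.invb_ιb]
  right_inv' v hv := by
    rw [𝒞.ιb_invb (𝒞.flowOut_mem_range σ hv.2)]
    have h := σ.flowOut_sec_leftInverse (p := (v.1, (0, v.2))) hv.1 hv.2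
    rw [Prod.mk.injEq] at h
    rw [h.1, h.2]
  open_source := σ.isOpen_cutDom.preimage 𝒞.isEmbedding_ιb.continuous
  open_target := isOpen_Ioo.prod (σ.isOpen_D.preimage (by fun_prop))
  continuousOn_toFun := by
    have h := σ.ambientChart.continuousOn_toFun.comp 𝒞.isEmbedding_ιb.continuous.continuousOn
      (s := 𝒞.ιb ⁻¹' σ.cutDom) fun m hm => hm
    exact (continuous_fst.comp_continuousOn h).prodMk
      ((continuous_snd.comp continuous_snd).comp_continuousOn h)
  continuousOn_invFun := by
    refine 𝒞.continuousOn_invb.comp ?_ fun v hv => 𝒞.flowOut_mem_range σ hv.2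
    exact σ.ambientChart.continuousOn_invFun.comp
      (f := fun v : ℝ × Y => (v.1, ((0 : ℝ), v.2))) (by fun_prop) fun v hv => ⟨hv.1, hv.2⟩

/-- The chart of `B` given by a slice. -/
def orbitChart : OpenPartialHomeomorph B Y where
  toFun x := (σ.coord (𝒞.liftB x)).2
  invFun y := 𝒞.p (𝒞.invb (𝒰.flowOut σ.sec (0, (0, y))))
  source := 𝒞.p '' (𝒞.ιb ⁻¹' σ.W)
  target := {y | ((0 : ℝ), y) ∈ σ.D}
  map_source' := by
    rintro _ ⟨m, hm, rfl⟩
    have := σ.coord_mem _ hm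
    rw [𝒞.coord_ιb σ hm] at this
    rwa [mem_ofPred_eq, 𝒞.coord_liftB σ hm]
  map_target' y hy := by
    refine ⟨_, ?_, rfl⟩
    rw [mem_preimage, 𝒞.ιb_invb (𝒞.flowOut_mem_range σ hy)]
    exact σ.act_sec_mem _ _ hy
  left_inv' := by
    rintro _ ⟨m, hm, rfl⟩
    rw [𝒞.coord_liftB σ hm, ← 𝒞.coord_ιb σ hm, 𝒞.p_eq_iff]
    have hy := σ.coord_mem _ hm
    have h := 𝒞.flowOut_mem_range σ (t := 0) (y := (σ.coord (𝒞.ιb m)).2)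
      (by rwa [← 𝒞.coord_ιb σ hm])
    rw [← 𝒞.coord_ιb σ hm] at h
    refine ⟨(σ.angle (𝒞.ιb m))⁻¹, (𝒞.ιb_invb h).trans ?_⟩
    refine Eq.trans ?_ (σ.act_eq _ hm).symm
    rw [inv_mul_cancel, LocalCircleAction.flowOut, Circle.exp_zero]
  right_inv' y hy := by
    have h := 𝒞.ιb_invb (𝒞.flowOut_mem_range σ (t := 0) hy)
    have hW : 𝒰.flowOut σ.sec (0, (0, y)) ∈ σ.W := σ.act_sec_mem _ _ hy
    rw [← h] at hW
    rw [𝒞.coord_liftB σ hW, h, LocalCircleAction.flowOut, σ.coord_act_sec _ _ hy]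
  open_source := by
    rw [← 𝒞.isQuotientMap_p.isOpen_preimage]
    have : 𝒞.p ⁻¹' (𝒞.p '' (𝒞.ιb ⁻¹' σ.W)) = 𝒞.ιb ⁻¹' σ.W :=
      Set.ext fun m => 𝒞.p_mem_image_W_iff σ m
    rw [this]
    exact σ.isOpen_W.preimage 𝒞.isEmbedding_ιb.continuous
  open_target := σ.isOpen_D.preimage (by fun_prop)
  continuousOn_toFun := by
    have : 𝒞.p ⁻¹' (𝒞.p '' (𝒞.ιb ⁻¹' σ.W)) = 𝒞.ιb ⁻¹' σ.W :=
      Set.ext fun m => 𝒞.p_mem_image_W_iff σ m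
    rw [𝒞.isQuotientMap_p.continuousOn_isOpen_iff, this]
    · refine (continuous_snd.comp_continuousOn (σ.smooth_coord.continuousOn.comp
        𝒞.isEmbedding_ιb.continuous.continuousOn fun m hm => hm)).congr fun m hm => ?_
      exact congrArg Prod.snd (𝒞.coord_liftB σ hm)
    · rw [← 𝒞.isQuotientMap_p.isOpen_preimage, this]
      exact σ.isOpen_W.preimage 𝒞.isEmbedding_ιb.continuous
  continuousOn_invFun := by
    refine 𝒞.isQuotientMap_p.continuous.comp_continuousOn
      (𝒞.continuousOn_invb.comp ?_ fun y hy => 𝒞.flowOut_mem_range σ hy)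
    intro y hy
    exact ContinuousAt.continuousWithinAt (ContinuousAt.comp
      (f := fun y : Y => ((0 : ℝ), ((0 : ℝ), y)))
      (σ.contMDiffAt_flowOut_sec (p := (0, (0, y))) hy).continuousAt (by fun_prop))

end Boundary

end CutData
end ContactCut

namespace ContactCut

set_option linter.unusedSectionVars false

variable {E : Type*} [NormedAddCommGroup E] [NormedSpace ℝ E]
  {N : Type*} [TopologicalSpace N] [ChartedSpace E N]
  {Y : Type*} [NormedAddCommGroup Y] [NormedSpace ℝ Y]
  {α : OneForm 𝓘(ℝ, E) N} {𝒰 : LocalCircleAction α}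

namespace Slice

variable (σ : Slice 𝒰 Y)

/-- An identification of `ℂ × Y` with the model space. -/
def cutEquiv [FiniteDimensional ℝ E] [FiniteDimensional ℝ Y] : (ℂ × Y) ≃L[ℝ] E :=
  ContinuousLinearEquiv.ofFinrankEq (by
    rw [Module.finrank_prod, Complex.finrank_real_complex, σ.finrank_eq, add_comm])

theorem contMDiffAt_complexCoord {x : N} (hx : x ∈ σ.W) (h : 0 < (σ.coord x).1) :
    ContMDiffAt 𝓘(ℝ, E) 𝓘(ℝ, ℂ × Y) ∞ σ.complexCoord x := by
  have h1 := σ.contMDiffAt_coord hx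
  have h2 : ContMDiffAt 𝓘(ℝ, E) 𝓘(ℝ, ℂ) ∞ (fun x => (σ.angle x : ℂ)) x :=
    contMDiff_coe_circle.contMDiffAt.comp x (σ.smooth_angle.contMDiffAt (σ.isOpen_W.mem_nhds hx))
  have h3 : ContMDiffAt 𝓘(ℝ, E) 𝓘(ℝ, ℂ × (ℝ × Y)) ∞ (fun x => ((σ.angle x : ℂ), σ.coord x)) x :=
    h2.prodMk_space h1
  have h4 : ContDiffAt ℝ ∞ (fun p : ℂ × (ℝ × Y) => ((Real.sqrt p.2.1 : ℂ) * p.1, p.2.2))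
      ((σ.angle x : ℂ), σ.coord x) := by
    refine ContDiffAt.prodMk (ContDiffAt.mul ?_ contDiffAt_fst)
      (contDiff_snd.comp contDiff_snd).contDiffAt
    have h5 : ContDiffAt ℝ ∞ (fun p : ℂ × (ℝ × Y) => Real.sqrt p.2.1)
        ((σ.angle x : ℂ), σ.coord x) :=
      ContDiffAt.sqrt (contDiff_fst.comp contDiff_snd).contDiffAt h.ne'
    exact Complex.ofRealCLM.contDiff.contDiffAt.comp _ h5
  exact ContMDiffAt.comp (g := fun p : ℂ × (ℝ × Y) => ((Real.sqrt p.2.1 : ℂ) * p.1, p.2.2)) x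
    h4.contMDiffAt h3

end Slice

namespace CutData

variable {M X B : Type*} [TopologicalSpace M] [TopologicalSpace X] [TopologicalSpace B]
  (𝒞 : CutData 𝒰 M X B) (σ : Slice 𝒰 Y)

/-- The complement of `B` in the cut space. -/
def regular : Set X := 𝒞.q '' 𝒞.bᶜ

theorem q_mem_regular (m : M) : 𝒞.q m ∈ 𝒞.regular ↔ m ∉ 𝒞.b :=
  𝒞.mem_preimage_image_iff subset_rfl m

theorem isOpen_regular : IsOpen 𝒞.regular := by
  rw [← 𝒞.isQuotientMap_q.isOpen_preimage]
  have : 𝒞.q ⁻¹' 𝒞.regular = 𝒞.bᶜ := Set.ext 𝒞.q_mem_regular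
  rw [this]
  exact 𝒞.isOpen_compl_b

section Nonempty

variable [Nonempty M]

theorem proj_lift (x : X) : 𝒞.proj (𝒞.lift x) = x := by
  exact (𝒞.proj_ι _).trans (Function.surjInv_eq 𝒞.isQuotientMap_q.surjective x)

theorem proj_polar_mem_regular {p : ℂ × Y} (hp : radial p ∈ σ.D) :
    𝒞.proj (σ.polar p) ∈ 𝒞.regular ↔ p.1 ≠ 0 := by
  obtain ⟨m, hm⟩ := 𝒞.polar_mem_range σ hp
  have hW := σ.polar_mem hp
  have hc := σ.coord_polar hp
  rw [← hm] at hW hc ⊢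
  rw [𝒞.proj_ι, 𝒞.q_mem_regular, 𝒞.mem_b_iff_coord σ hW, hc]
  simp [radial]

theorem lift_proj_polar {p : ℂ × Y} (hp : radial p ∈ σ.D) (h0 : p.1 ≠ 0) :
    𝒞.lift (𝒞.proj (σ.polar p)) = σ.polar p := by
  have h1 := (𝒞.proj_polar_mem_regular σ hp).2 h0
  obtain ⟨m, hm⟩ := 𝒞.polar_mem_range σ hp
  rw [← hm, 𝒞.proj_ι, 𝒞.q_mem_regular] at h1
  rw [← hm, 𝒞.proj_ι, 𝒞.lift_q h1]

theorem lift_proj {x : N} (hx : x ∈ 𝒞.ι '' 𝒞.bᶜ) : 𝒞.lift (𝒞.proj x) = x :=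
  𝒞.interiorChart.right_inv hx

end Nonempty

variable (Y) in
/-- The index set of the charts of the cut space: an interior chart at each point of `M`, and
slice charts. The point of `M` is only there to make `M` nonempty. -/
abbrev CutIndex (_ : CutData 𝒰 M X B) : Type _ := M ⊕ (Slice 𝒰 Y × M)

theorem _root_.ContactCut.nonempty_of_sum_prod {M S : Type*} (i : M ⊕ (S × M)) : Nonempty M :=
  ⟨i.elim id Prod.snd⟩

variable [FiniteDimensional ℝ E] [FiniteDimensional ℝ Y]

/-- The charts of the cut space. -/
def cutChart (i : 𝒞.CutIndex Y) : OpenPartialHomeomorph X E :=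
  haveI : Nonempty M := nonempty_of_sum_prod i
  i.elim (fun m => 𝒞.interiorChart.trans (chartAt E (𝒞.ι m)))
    fun s => (𝒞.sliceChart s.1).transHomeomorph s.1.cutEquiv.toHomeomorph

section Nonempty

variable [Nonempty M]

theorem cutChart_inl_symm (m : M) (y : E) :
    (𝒞.cutChart (Sum.inl m : 𝒞.CutIndex Y)).symm y = 𝒞.proj ((chartAt E (𝒞.ι m)).symm y) := rfl

theorem cutChart_inl (m : M) (x : X) :
    𝒞.cutChart (Sum.inl m : 𝒞.CutIndex Y) x = chartAt E (𝒞.ι m) (𝒞.lift x) := rfl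

theorem cutChart_inr_symm (s : Slice 𝒰 Y × M) (y : E) :
    (𝒞.cutChart (Sum.inr s)).symm y = 𝒞.proj (s.1.polar (s.1.cutEquiv.symm y)) := rfl

theorem cutChart_inr (s : Slice 𝒰 Y × M) (x : X) :
    𝒞.cutChart (Sum.inr s) x = s.1.cutEquiv (s.1.complexCoord (𝒞.lift x)) := rfl

theorem mem_cutChart_inl_target {m : M} {y : E} :
    y ∈ (𝒞.cutChart (Sum.inl m : 𝒞.CutIndex Y)).target ↔
      y ∈ (chartAt E (𝒞.ι m)).target ∧ (chartAt E (𝒞.ι m)).symm y ∈ 𝒞.ι '' 𝒞.bᶜ := by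
  change y ∈ (𝒞.interiorChart.trans (chartAt E (𝒞.ι m))).target ↔ _
  rw [OpenPartialHomeomorph.trans_target]
  rfl

theorem mem_cutChart_inl_source {m : M} {x : X} :
    x ∈ (𝒞.cutChart (Sum.inl m : 𝒞.CutIndex Y)).source ↔
      x ∈ 𝒞.regular ∧ 𝒞.lift x ∈ (chartAt E (𝒞.ι m)).source := by
  change x ∈ (𝒞.interiorChart.trans (chartAt E (𝒞.ι m))).source ↔ _
  rw [OpenPartialHomeomorph.trans_source]
  rfl

theorem mem_cutChart_inr_target {s : Slice 𝒰 Y × M} {y : E} :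
    y ∈ (𝒞.cutChart (Sum.inr s)).target ↔ radial (s.1.cutEquiv.symm y) ∈ s.1.D := Iff.rfl

theorem q_mem_cutChart_inr_source {s : Slice 𝒰 Y × M} {m : M} :
    𝒞.q m ∈ (𝒞.cutChart (Sum.inr s)).source ↔ 𝒞.ι m ∈ s.1.W := 𝒞.q_mem_image_W_iff s.1 m

variable [IsManifold 𝓘(ℝ, E) ∞ N]

theorem contMDiffAt_lift_cutChart_symm (i : 𝒞.CutIndex Y) {y : E}
    (hy : y ∈ (𝒞.cutChart i).target) (hr : (𝒞.cutChart i).symm y ∈ 𝒞.regular) :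
    ContMDiffAt 𝓘(ℝ, E) 𝓘(ℝ, E) ∞ (fun z => 𝒞.lift ((𝒞.cutChart i).symm z)) y := by
  rcases i with m | s
  · rw [𝒞.mem_cutChart_inl_target] at hy
    refine ContMDiffAt.congr_of_eventuallyEq ((contMDiffOn_chart_symm (I := 𝓘(ℝ, E))
      (x := 𝒞.ι m)).contMDiffAt ((chartAt E (𝒞.ι m)).open_target.mem_nhds hy.1)) ?_
    filter_upwards [(𝒞.cutChart (Sum.inl m : 𝒞.CutIndex Y)).open_target.mem_nhds
      (𝒞.mem_cutChart_inl_target.2 hy)] with z hz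
    rw [𝒞.mem_cutChart_inl_target] at hz
    rw [𝒞.cutChart_inl_symm, 𝒞.lift_proj hz.2]
  · rw [𝒞.mem_cutChart_inr_target] at hy
    rw [𝒞.cutChart_inr_symm, 𝒞.proj_polar_mem_regular s.1 hy] at hr
    have h1 : ContMDiffAt 𝓘(ℝ, E) 𝓘(ℝ, E) ∞ (fun z => s.1.polar (s.1.cutEquiv.symm z)) y :=
      ContMDiffAt.comp y (s.1.contMDiffAt_polar hr hy)
        s.1.cutEquiv.symm.contDiff.contMDiff.contMDiffAt
    refine h1.congr_of_eventuallyEq ?_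
    filter_upwards [(𝒞.cutChart (Sum.inr s)).open_target.mem_nhds hy,
      (isOpen_ne.preimage (continuous_fst.comp s.1.cutEquiv.symm.continuous)).mem_nhds hr]
      with z hz hz'
    exact 𝒞.lift_proj_polar s.1 hz hz'

theorem contMDiffAt_cutChart_proj (i : 𝒞.CutIndex Y) {x : N} (hx : x ∈ 𝒞.ι '' 𝒞.bᶜ)
    (hi : 𝒞.proj x ∈ (𝒞.cutChart i).source) :
    ContMDiffAt 𝓘(ℝ, E) 𝓘(ℝ, E) ∞ (fun z => 𝒞.cutChart i (𝒞.proj z)) x := by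
  rcases i with m | s
  · rw [𝒞.mem_cutChart_inl_source, 𝒞.lift_proj hx] at hi
    refine ContMDiffAt.congr_of_eventuallyEq ((contMDiffOn_chart (I := 𝓘(ℝ, E))
      (x := 𝒞.ι m)).contMDiffAt ((chartAt E (𝒞.ι m)).open_source.mem_nhds hi.2)) ?_
    filter_upwards [𝒞.isOpen_image_compl.mem_nhds hx] with z hz
    rw [𝒞.cutChart_inl, 𝒞.lift_proj hz]
  · obtain ⟨m, hm, rfl⟩ := hx
    rw [𝒞.proj_ι, 𝒞.q_mem_cutChart_inr_source] at hi
    have h0 : 0 < (s.1.coord (𝒞.ι m)).1 :=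
      (𝒞.coord_nonneg s.1 hi).lt_of_ne' fun h => hm ((𝒞.mem_b_iff_coord s.1 hi).2 h)
    refine ContMDiffAt.congr_of_eventuallyEq (ContMDiffAt.comp (𝒞.ι m)
      s.1.cutEquiv.contDiff.contMDiff.contMDiffAt (s.1.contMDiffAt_complexCoord hi h0)) ?_
    filter_upwards [𝒞.isOpen_image_compl.mem_nhds ⟨m, hm, rfl⟩] with z hz
    rw [𝒞.cutChart_inr, 𝒞.lift_proj hz, Function.comp_apply]

end Nonempty

variable [IsManifold 𝓘(ℝ, E) ∞ N]

theorem contDiffAt_cutChart_trans_slice (s s' : Slice 𝒰 Y × M) {y : E}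
    (hy : y ∈ (𝒞.cutChart (Sum.inr s)).target)
    (hj : (𝒞.cutChart (Sum.inr s)).symm y ∈ (𝒞.cutChart (Sum.inr s')).source) :
    ContDiffAt ℝ ∞ (fun z => 𝒞.cutChart (Sum.inr s') ((𝒞.cutChart (Sum.inr s)).symm z)) y := by
  have : Nonempty M := ⟨s.2⟩
  set σ := s.1
  set σ' := s'.1
  set T : ℂ × Y → ℂ × Y := fun p =>
    (p.1 * (σ'.angle (σ.sec (radial p)) : ℂ), (σ'.coord (σ.sec (radial p))).2) with hT
  have key : ∀ p : ℂ × Y, radial p ∈ σ.D → 𝒞.proj (σ.polar p) ∈ (𝒞.cutChart (Sum.inr s')).source →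
      σ.sec (radial p) ∈ σ'.W ∧ σ'.complexCoord (𝒞.lift (𝒞.proj (σ.polar p))) = T p := by
    intro p hp hps
    obtain ⟨m, hm⟩ := 𝒞.polar_mem_range σ hp
    have hc := σ.moment_eq (σ.polar_mem hp)
    rw [σ.coord_polar hp] at hc
    have h1 : σ.polar p ∈ σ'.W := by
      rw [← hm]
      rwa [← hm, 𝒞.proj_ι, 𝒞.q_mem_cutChart_inr_source] at hps
    have h2 : 𝒰.act (toCircle p.1)⁻¹ (σ.polar p) = σ.sec (radial p) :=
      𝒰.act_inv_act _ (σ.sec_mem_dom _ hp)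
    have h3 : σ.sec (radial p) ∈ σ'.W := h2 ▸ σ'.act_mem _ h1
    refine ⟨h3, ?_⟩
    have h4 : σ'.complexCoord (𝒞.lift (𝒞.proj (σ.polar p))) = σ'.complexCoord (σ.polar p) := by
      rw [← hm, 𝒞.proj_ι, 𝒞.complexCoord_lift σ']
      rwa [hm]
    have h5 : (σ'.coord (σ.polar p)).1 = Complex.normSq p.1 := by
      rw [← σ'.moment_eq h1, hc]
      rfl
    have h6 : σ'.angle (σ.polar p) = toCircle p.1 * σ'.angle (σ.sec (radial p)) :=
      σ'.angle_act _ h3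
    rw [h4]
    refine Prod.ext ?_ (congrArg Prod.snd (σ'.coord_act (toCircle p.1) h3) :)
    simp only [Slice.complexCoord, hT]
    rw [h5, h6, Circle.coe_mul, ← mul_assoc]
    exact congrArg (· * (σ'.angle (σ.sec (radial p)) : ℂ)) (norm_mul_toCircle p.1)
  have hp₀ : radial (σ.cutEquiv.symm y) ∈ σ.D := hy
  have hsec := (key _ hp₀ hj).1
  have hTs : ContDiffAt ℝ ∞ T (σ.cutEquiv.symm y) := by
    have h1 : ContMDiffAt 𝓘(ℝ, ℂ × Y) 𝓘(ℝ, E) ∞ (fun p => σ.sec (radial p))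
        (σ.cutEquiv.symm y) :=
      ContMDiffAt.comp _ (σ.smooth_sec.contMDiffAt (σ.isOpen_D.mem_nhds hp₀))
        contDiff_radial.contMDiff.contMDiffAt
    have h2 : ContMDiffAt 𝓘(ℝ, ℂ × Y) 𝓘(ℝ, ℂ) ∞ (fun p => (σ'.angle (σ.sec (radial p)) : ℂ))
        (σ.cutEquiv.symm y) :=
      contMDiff_coe_circle.contMDiffAt.comp _ (ContMDiffAt.comp _
        (σ'.smooth_angle.contMDiffAt (σ'.isOpen_W.mem_nhds hsec)) h1)
    have h3 : ContMDiffAt 𝓘(ℝ, ℂ × Y) 𝓘(ℝ, ℝ × Y) ∞ (fun p => σ'.coord (σ.sec (radial p)))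
        (σ.cutEquiv.symm y) := ContMDiffAt.comp _ (σ'.contMDiffAt_coord hsec) h1
    exact (contDiffAt_fst.mul h2.contDiffAt).prodMk (contDiff_snd.contDiffAt.comp _ h3.contDiffAt)
  refine ContDiffAt.congr_of_eventuallyEq (σ'.cutEquiv.contDiff.contDiffAt.comp y
    (hTs.comp y σ.cutEquiv.symm.contDiff.contDiffAt)) ?_
  have hev := (𝒞.cutChart (Sum.inr s)).continuousAt_symm hy |>.preimage_mem_nhds
    ((𝒞.cutChart (Sum.inr s')).open_source.mem_nhds hj)
  filter_upwards [(𝒞.cutChart (Sum.inr s)).open_target.mem_nhds hy, hev] with z hz hz'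
  exact congrArg σ'.cutEquiv (key _ hz hz').2

theorem contDiffAt_cutChart_trans (i j : 𝒞.CutIndex Y) {y : E} (hy : y ∈ (𝒞.cutChart i).target)
    (hj : (𝒞.cutChart i).symm y ∈ (𝒞.cutChart j).source) :
    ContDiffAt ℝ ∞ (fun z => 𝒞.cutChart j ((𝒞.cutChart i).symm z)) y := by
  have : Nonempty M := nonempty_of_sum_prod i
  by_cases hr : (𝒞.cutChart i).symm y ∈ 𝒞.regular
  · have h1 := 𝒞.contMDiffAt_lift_cutChart_symm i hy hr
    have h2 : ContMDiffAt 𝓘(ℝ, E) 𝓘(ℝ, E) ∞ (fun z => 𝒞.cutChart j (𝒞.proj z))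
        (𝒞.lift ((𝒞.cutChart i).symm y)) := by
      refine 𝒞.contMDiffAt_cutChart_proj j (𝒞.interiorChart.map_source hr) ?_
      rwa [𝒞.proj_lift]
    have h3 := (ContMDiffAt.comp y h2 h1).contDiffAt
    refine h3.congr_of_eventuallyEq (Filter.Eventually.of_forall fun z => ?_)
    rw [Function.comp_apply, 𝒞.proj_lift]
  · rcases i with m | s
    · have h := (𝒞.cutChart (Sum.inl m : 𝒞.CutIndex Y)).map_target hy
      rw [𝒞.mem_cutChart_inl_source] at h
      exact absurd h.1 hr
    · rcases j with m | s'
      · rw [𝒞.mem_cutChart_inl_source] at hj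
        exact absurd hj.1 hr
      · exact 𝒞.contDiffAt_cutChart_trans_slice s s' hy hj

theorem exists_mem_cutChart_source (hs : ∀ m ∈ 𝒞.b, ∃ σ : Slice 𝒰 Y, 𝒞.ι m ∈ σ.W) (x : X) :
    ∃ i : 𝒞.CutIndex Y, x ∈ (𝒞.cutChart i).source := by
  obtain ⟨m, rfl⟩ := 𝒞.isQuotientMap_q.surjective x
  have : Nonempty M := ⟨m⟩
  by_cases hm : m ∈ 𝒞.b
  · obtain ⟨σ, hσ⟩ := hs m hm
    exact ⟨Sum.inr (σ, m), 𝒞.q_mem_cutChart_inr_source.2 hσ⟩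
  · refine ⟨Sum.inl m, 𝒞.mem_cutChart_inl_source.2 ⟨(𝒞.q_mem_regular m).2 hm, ?_⟩⟩
    rw [𝒞.lift_q hm]
    exact mem_chart_source E _

/-- The smooth atlas of the cut space. -/
def cutAtlas (hs : ∀ m ∈ 𝒞.b, ∃ σ : Slice 𝒰 Y, 𝒞.ι m ∈ σ.W) : ChartFamily E X where
  Index := 𝒞.CutIndex Y
  chart := 𝒞.cutChart
  pick x := (𝒞.exists_mem_cutChart_source hs x).choose
  mem_pick x := (𝒞.exists_mem_cutChart_source hs x).choose_spec
  smooth i j _ hy hj := 𝒞.contDiffAt_cutChart_trans i j hy hj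

end CutData
end ContactCut

namespace ContactCut

set_option linter.unusedSectionVars false

section Forms

variable {E : Type*} [NormedAddCommGroup E] [NormedSpace ℝ E]
  {N : Type*} [TopologicalSpace N] [ChartedSpace E N]
  {E' : Type*} [NormedAddCommGroup E'] [NormedSpace ℝ E']
  {N' : Type*} [TopologicalSpace N'] [ChartedSpace E' N']
  {F : Type*} [NormedAddCommGroup F] [NormedSpace ℝ F]

theorem pullbackRep_pullback (α : OneForm 𝓘(ℝ, E) N) {f : N' → N} {g : F → N'} {y : F}
    (hf : MDifferentiableAt 𝓘(ℝ, E') 𝓘(ℝ, E) f (g y))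
    (hg : MDifferentiableAt 𝓘(ℝ, F) 𝓘(ℝ, E') g y) :
    pullbackRep g (pullback 𝓘(ℝ, E') 𝓘(ℝ, E) f α) y = pullbackRep (fun y => f (g y)) α y := by
  refine ContinuousLinearMap.ext fun v => ?_
  have h := mfderiv_comp (I := 𝓘(ℝ, F)) y hf hg
  exact (congrArg (α (f (g y))) (DFunLike.congr_fun h v)).symm

theorem apply_eq_of_pullbackRep_eq {β γ : OneForm 𝓘(ℝ, E) N} {g : F → N} {y : F}
    (hg : Function.Surjective (modelDeriv E g y)) (h : pullbackRep g β y = pullbackRep g γ y) :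
    β (g y) = γ (g y) := by
  refine ContinuousLinearMap.ext fun w => ?_
  obtain ⟨v, rfl⟩ := hg w
  exact DFunLike.congr_fun h v

theorem ChartFamily.oneForm_eq {X : Type*} [TopologicalSpace X] (𝒜 : ChartFamily E X)
    [FiniteDimensional ℝ E] {β γ : letI := 𝒜.chartedSpace; OneForm 𝓘(ℝ, E) X} {x : X} {i : 𝒜.Index}
    (hi : x ∈ (𝒜.chart i).source) (h : letI := 𝒜.chartedSpace
      pullbackRep (𝒜.chart i).symm β (𝒜.chart i x) = pullbackRep (𝒜.chart i).symm γ (𝒜.chart i x)) :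
    β x = γ x := by
  let _ := 𝒜.chartedSpace
  have := 𝒜.isManifold
  have hy : 𝒜.chart i x ∈ (𝒜.chart i).target := (𝒜.chart i).map_source hi
  have hx : (𝒜.chart i).symm (𝒜.chart i x) = x := (𝒜.chart i).left_inv hi
  have hb := bijective_modelDeriv_of_leftInverse (E := E) rfl
    ((𝒜.contMDiffOn_chart_symm i).contMDiffAt ((𝒜.chart i).open_target.mem_nhds hy))
    (r := 𝒜.chart i) ((𝒜.contMDiffOn_chart i).contMDiffAt
      ((𝒜.chart i).open_source.mem_nhds (by rwa [hx])))
    (by filter_upwards [(𝒜.chart i).open_target.mem_nhds hy] with z hz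
        exact (𝒜.chart i).right_inv hz)
  have := apply_eq_of_pullbackRep_eq hb.2 h
  rwa [hx] at this

end Forms

namespace CutData

variable {E : Type*} [NormedAddCommGroup E] [NormedSpace ℝ E] [FiniteDimensional ℝ E]
  {N : Type*} [TopologicalSpace N] [ChartedSpace E N] [IsManifold 𝓘(ℝ, E) ∞ N]
  {Y : Type*} [NormedAddCommGroup Y] [NormedSpace ℝ Y] [FiniteDimensional ℝ Y]
  {α : OneForm 𝓘(ℝ, E) N} {𝒰 : LocalCircleAction α}
  {M X B : Type*} [TopologicalSpace M] [TopologicalSpace X] [TopologicalSpace B]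
  (𝒞 : CutData 𝒰 M X B) (hs : ∀ m ∈ 𝒞.b, ∃ σ : Slice 𝒰 Y, 𝒞.ι m ∈ σ.W)

/-- The local representatives of the contact form of the cut space. -/
def cutRep (i : 𝒞.CutIndex Y) : E → E →L[ℝ] ℝ :=
  i.elim (fun m => pullbackRep (chartAt E (𝒞.ι m)).symm α)
    fun s y => (cutForm (pullbackRep s.1.sec α) (s.1.cutEquiv.symm y)).comp
      (s.1.cutEquiv.symm : E →L[ℝ] ℂ × Y)

theorem cutRep_inr (s : Slice 𝒰 Y × M) (y : E) :
    𝒞.cutRep (Sum.inr s) y = (cutForm (pullbackRep s.1.sec α) (s.1.cutEquiv.symm y)).comp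
      (s.1.cutEquiv.symm : E →L[ℝ] ℂ × Y) := rfl

theorem cutRep_eq_of_mem_regular (i : 𝒞.CutIndex Y) {y : E} (hy : y ∈ (𝒞.cutChart i).target)
    (hr : (𝒞.cutChart i).symm y ∈ 𝒞.regular) :
    𝒞.cutRep i y = pullbackRep (fun z => 𝒞.lift ((𝒞.cutChart i).symm z)) α y := by
  have : Nonempty M := nonempty_of_sum_prod i
  rcases i with m | s
  · refine pullbackRep_congr α ?_
    filter_upwards [(𝒞.cutChart (Sum.inl m : 𝒞.CutIndex Y)).open_target.mem_nhds hy] with z hz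
    rw [𝒞.mem_cutChart_inl_target] at hz
    rw [𝒞.cutChart_inl_symm, 𝒞.lift_proj hz.2]
  · rw [𝒞.mem_cutChart_inr_target] at hy
    rw [𝒞.cutChart_inr_symm, 𝒞.proj_polar_mem_regular s.1 hy] at hr
    have hev : (fun z => 𝒞.lift ((𝒞.cutChart (Sum.inr s)).symm z))
        =ᶠ[𝓝 y] fun z => s.1.polar (s.1.cutEquiv.symm z) := by
      filter_upwards [(𝒞.cutChart (Sum.inr s)).open_target.mem_nhds hy,
        (isOpen_ne.preimage (continuous_fst.comp s.1.cutEquiv.symm.continuous)).mem_nhds hr]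
        with z hz hz'
      exact 𝒞.lift_proj_polar s.1 hz hz'
    rw [pullbackRep_congr α hev, pullbackRep_comp α
      ((s.1.contMDiffAt_polar hr hy).mdifferentiableAt (by simp))
      s.1.cutEquiv.symm.differentiableAt, s.1.pullbackRep_polar hr hy, cutRep_inr,
      s.1.cutEquiv.symm.fderiv]

theorem contDiffAt_cutRep (hα : IsSmoothForm 𝓘(ℝ, E) α) (i : 𝒞.CutIndex Y) {y : E}
    (hy : y ∈ (𝒞.cutChart i).target) : ContDiffAt ℝ ∞ (𝒞.cutRep i) y := by
  have : Nonempty M := nonempty_of_sum_prod i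
  rcases i with m | s
  · rw [𝒞.mem_cutChart_inl_target] at hy
    exact hα.contDiffAt_pullbackRep ((contMDiffOn_chart_symm (I := 𝓘(ℝ, E))
      (x := 𝒞.ι m)).contMDiffAt ((chartAt E (𝒞.ι m)).open_target.mem_nhds hy.1))
  · rw [𝒞.mem_cutChart_inr_target] at hy
    have h1 := (contDiffAt_cutForm (s.1.contDiffAt_pullbackRep_sec hα hy)).comp y
      s.1.cutEquiv.symm.contDiff.contDiffAt
    exact h1.clm_comp contDiffAt_const

theorem contactAt_cutRep (hα : IsContactForm 𝓘(ℝ, E) α) (i : 𝒞.CutIndex Y) {y : E}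
    (hy : y ∈ (𝒞.cutChart i).target) : ContactAt (𝒞.cutRep i) y := by
  have : Nonempty M := nonempty_of_sum_prod i
  by_cases hr : (𝒞.cutChart i).symm y ∈ 𝒞.regular
  · have h1 := 𝒞.contMDiffAt_lift_cutChart_symm i hy hr
    have h2 : ContMDiffAt 𝓘(ℝ, E) 𝓘(ℝ, E) ∞ (fun z => 𝒞.cutChart i (𝒞.proj z))
        (𝒞.lift ((𝒞.cutChart i).symm y)) := by
      refine 𝒞.contMDiffAt_cutChart_proj i (𝒞.interiorChart.map_source hr) ?_
      rw [𝒞.proj_lift]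
      exact (𝒞.cutChart i).map_target hy
    refine (hα.contactAt_pullbackRep h1 (bijective_modelDeriv_of_leftInverse (E := E) rfl h1 h2
      ?_)).congr ?_
    · filter_upwards [(𝒞.cutChart i).open_target.mem_nhds hy] with z hz
      rw [𝒞.proj_lift, (𝒞.cutChart i).right_inv hz]
    · filter_upwards [(𝒞.cutChart i).open_target.mem_nhds hy,
        ((𝒞.cutChart i).continuousAt_symm hy).preimage_mem_nhds (𝒞.isOpen_regular.mem_nhds hr)]
        with z hz hz'
      exact 𝒞.cutRep_eq_of_mem_regular i hz hz'
  · rcases i with m | s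
    · have h := (𝒞.cutChart (Sum.inl m : 𝒞.CutIndex Y)).map_target hy
      rw [𝒞.mem_cutChart_inl_source] at h
      exact absurd h.1 hr
    · rw [𝒞.mem_cutChart_inr_target] at hy
      rw [𝒞.cutChart_inr_symm, 𝒞.proj_polar_mem_regular s.1 hy, not_not] at hr
      set p := s.1.cutEquiv.symm y with hp
      have hp0 : p = (0, p.2) := Prod.ext hr rfl
      have hD : ((0 : ℝ), p.2) ∈ s.1.D := by
        rw [hp0] at hy
        simpa [radial] using hy
      have hsm := s.1.contDiffAt_pullbackRep_sec hα.smooth hD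
      have h1 : ContactAt (cutForm (pullbackRep s.1.sec α)) p := by
        rw [hp0]
        exact ContactAt.cutForm (hsm.differentiableAt (by simp)) (s.1.contactAt_reducedForm hα hD)
      have h2 : DifferentiableAt ℝ (cutForm (pullbackRep s.1.sec α)) p :=
        (contDiffAt_cutForm (s.1.contDiffAt_pullbackRep_sec hα.smooth hy)).differentiableAt
          (by simp)
      have h3 := h1.pullback h2 (g := s.1.cutEquiv.symm) s.1.cutEquiv.symm.contDiff.contDiffAt (by
        rw [s.1.cutEquiv.symm.fderiv]
        exact s.1.cutEquiv.symm.bijective)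
      refine h3.congr (Filter.Eventually.of_forall fun z => ?_)
      exact congrArg (cutForm (pullbackRep s.1.sec α) (s.1.cutEquiv.symm z)).comp
        s.1.cutEquiv.symm.fderiv.symm

theorem cutRep_trans_of_mem_regular (i j : 𝒞.CutIndex Y) {y : E}
    (hy : y ∈ (𝒞.cutChart i).target) (hj : (𝒞.cutChart i).symm y ∈ (𝒞.cutChart j).source)
    (hr : (𝒞.cutChart i).symm y ∈ 𝒞.regular) :
    𝒞.cutRep i y = (𝒞.cutRep j (𝒞.cutChart j ((𝒞.cutChart i).symm y))).comp
      (fderiv ℝ (fun z => 𝒞.cutChart j ((𝒞.cutChart i).symm z)) y) := by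
  have : Nonempty M := nonempty_of_sum_prod i
  have hy' : 𝒞.cutChart j ((𝒞.cutChart i).symm y) ∈ (𝒞.cutChart j).target :=
    (𝒞.cutChart j).map_source hj
  have hr' : (𝒞.cutChart j).symm (𝒞.cutChart j ((𝒞.cutChart i).symm y)) ∈ 𝒞.regular := by
    rwa [(𝒞.cutChart j).left_inv hj]
  rw [𝒞.cutRep_eq_of_mem_regular i hy hr, 𝒞.cutRep_eq_of_mem_regular j hy' hr',
    ← pullbackRep_comp α (f := fun z => 𝒞.lift ((𝒞.cutChart j).symm z))
      (g := fun z => 𝒞.cutChart j ((𝒞.cutChart i).symm z)) ((𝒞.contMDiffAt_lift_cutChart_symm j hy' hr').mdifferentiableAt (by simp))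
      ((𝒞.contDiffAt_cutChart_trans i j hy hj).differentiableAt (by simp))]
  refine pullbackRep_congr α ?_
  filter_upwards [((𝒞.cutChart i).continuousAt_symm hy).preimage_mem_nhds
    ((𝒞.cutChart j).open_source.mem_nhds hj)] with z hz
  rw [(𝒞.cutChart j).left_inv hz]

theorem cutRep_trans (hα : IsSmoothForm 𝓘(ℝ, E) α) (i j : 𝒞.CutIndex Y) {y : E}
    (hy : y ∈ (𝒞.cutChart i).target) (hj : (𝒞.cutChart i).symm y ∈ (𝒞.cutChart j).source) :
    𝒞.cutRep i y = (𝒞.cutRep j (𝒞.cutChart j ((𝒞.cutChart i).symm y))).comp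
      (fderiv ℝ (fun z => 𝒞.cutChart j ((𝒞.cutChart i).symm z)) y) := by
  have : Nonempty M := nonempty_of_sum_prod i
  by_cases hr : (𝒞.cutChart i).symm y ∈ 𝒞.regular
  · exact 𝒞.cutRep_trans_of_mem_regular i j hy hj hr
  rcases i with m | s
  · have h := (𝒞.cutChart (Sum.inl m : 𝒞.CutIndex Y)).map_target hy
    rw [𝒞.mem_cutChart_inl_source] at h
    exact absurd h.1 hr
  set T := fun z => 𝒞.cutChart j ((𝒞.cutChart (Sum.inr s)).symm z) with hT
  have hTs : ContDiffAt ℝ ∞ T y := 𝒞.contDiffAt_cutChart_trans (Sum.inr s) j hy hj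
  have hc1 : ContinuousAt (𝒞.cutRep (Sum.inr s)) y := (𝒞.contDiffAt_cutRep hα _ hy).continuousAt
  have hc2 : ContinuousAt (fun z => (𝒞.cutRep j (T z)).comp (fderiv ℝ T z)) y := by
    have h1 : ContDiffAt ℝ ∞ (𝒞.cutRep j) (T y) :=
      𝒞.contDiffAt_cutRep hα j ((𝒞.cutChart j).map_source hj)
    exact ((h1.comp y hTs).clm_comp (hTs.fderiv_right (m := ∞) (by norm_cast))).continuousAt
  set S : Set E := {z | (s.1.cutEquiv.symm z).1 ≠ 0} with hS
  have hSd : Dense S := by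
    have h1 : Dense ({0}ᶜ ×ˢ univ : Set (ℂ × Y)) := (dense_compl_singleton 0).prod dense_univ
    have h2 : S = s.1.cutEquiv.symm ⁻¹' ({0}ᶜ ×ˢ univ : Set (ℂ × Y)) := by
      ext z
      simp [hS]
    rw [h2]
    exact h1.preimage s.1.cutEquiv.symm.toHomeomorph.isOpenMap
  have hne : Filter.NeBot (nhdsWithin y S) := mem_closure_iff_nhdsWithin_neBot.1 (hSd y)
  refine tendsto_nhds_unique_of_eventuallyEq (l := nhdsWithin y S) (hc1.tendsto.mono_left nhdsWithin_le_nhds)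
    (hc2.tendsto.mono_left nhdsWithin_le_nhds) ?_
  filter_upwards [self_mem_nhdsWithin,
    mem_nhdsWithin_of_mem_nhds ((𝒞.cutChart (Sum.inr s)).open_target.mem_nhds hy),
    mem_nhdsWithin_of_mem_nhds (((𝒞.cutChart (Sum.inr s)).continuousAt_symm hy).preimage_mem_nhds
    ((𝒞.cutChart j).open_source.mem_nhds hj))] with z hz1 hz2 hz3
  refine 𝒞.cutRep_trans_of_mem_regular _ j hz2 hz3 ?_
  exact (𝒞.proj_polar_mem_regular s.1 hz2).2 hz1

/-- The contact form of the cut space. -/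
def cutOneForm : letI := (𝒞.cutAtlas hs).chartedSpace; OneForm 𝓘(ℝ, E) X :=
  (𝒞.cutAtlas hs).glue 𝒞.cutRep

theorem pullbackRep_cutOneForm (hα : IsSmoothForm 𝓘(ℝ, E) α) (i : 𝒞.CutIndex Y) {y : E}
    (hy : y ∈ (𝒞.cutChart i).target) : letI := (𝒞.cutAtlas hs).chartedSpace
    pullbackRep (𝒞.cutChart i).symm (𝒞.cutOneForm hs) y = 𝒞.cutRep i y :=
  (𝒞.cutAtlas hs).pullbackRep_glue (fun i j _ hy hj => 𝒞.cutRep_trans hα i j hy hj) i hy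

theorem isContactForm_cutOneForm (hα : IsContactForm 𝓘(ℝ, E) α) :
    letI := (𝒞.cutAtlas hs).chartedSpace
    haveI := (𝒞.cutAtlas hs).isManifold
    IsContactForm 𝓘(ℝ, E) (𝒞.cutOneForm hs) :=
  (𝒞.cutAtlas hs).isContactForm (fun i _ hy => 𝒞.pullbackRep_cutOneForm hs hα.smooth i hy)
    fun i _ hy => ⟨𝒞.contDiffAt_cutRep hα.smooth i hy, 𝒞.contactAt_cutRep hα i hy⟩

theorem contMDiffOn_lift : letI := (𝒞.cutAtlas hs).chartedSpace
    ContMDiffOn 𝓘(ℝ, E) 𝓘(ℝ, E) ∞ 𝒞.lift 𝒞.regular := by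
  let _ := (𝒞.cutAtlas hs).chartedSpace
  have := (𝒞.cutAtlas hs).isManifold
  intro x hx
  obtain ⟨i, hi⟩ := 𝒞.exists_mem_cutChart_source hs x
  have : Nonempty M := nonempty_of_sum_prod i
  have h1 : ContMDiffAt 𝓘(ℝ, E) 𝓘(ℝ, E) ∞ (𝒞.cutChart i) x :=
    ((𝒞.cutAtlas hs).contMDiffOn_chart i).contMDiffAt ((𝒞.cutChart i).open_source.mem_nhds hi)
  have h2 := 𝒞.contMDiffAt_lift_cutChart_symm i ((𝒞.cutChart i).map_source hi)
    (by rwa [(𝒞.cutChart i).left_inv hi])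
  refine ContMDiffAt.contMDiffWithinAt ((ContMDiffAt.comp x h2 h1).congr_of_eventuallyEq ?_)
  filter_upwards [(𝒞.cutChart i).open_source.mem_nhds hi] with z hz
  rw [Function.comp_apply, (𝒞.cutChart i).left_inv hz]

theorem contMDiffOn_proj [Nonempty M] : letI := (𝒞.cutAtlas hs).chartedSpace
    ContMDiffOn 𝓘(ℝ, E) 𝓘(ℝ, E) ∞ 𝒞.proj (𝒞.ι '' 𝒞.bᶜ) := by
  let _ := (𝒞.cutAtlas hs).chartedSpace
  have := (𝒞.cutAtlas hs).isManifold
  intro x hx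
  obtain ⟨i, hi⟩ := 𝒞.exists_mem_cutChart_source hs (𝒞.proj x)
  have h1 : ContMDiffAt 𝓘(ℝ, E) 𝓘(ℝ, E) ∞ (𝒞.cutChart i).symm (𝒞.cutChart i (𝒞.proj x)) :=
    ((𝒞.cutAtlas hs).contMDiffOn_chart_symm i).contMDiffAt
      ((𝒞.cutChart i).open_target.mem_nhds ((𝒞.cutChart i).map_source hi))
  have h2 := 𝒞.contMDiffAt_cutChart_proj i hx hi
  refine ContMDiffAt.contMDiffWithinAt ((ContMDiffAt.comp x h1 h2).congr_of_eventuallyEq ?_)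
  have hc : ContinuousAt 𝒞.proj x := 𝒞.interiorChart.continuousAt_symm hx
  filter_upwards [hc.preimage_mem_nhds ((𝒞.cutChart i).open_source.mem_nhds hi)] with z hz
  rw [Function.comp_apply, (𝒞.cutChart i).left_inv hz]

theorem cutOneForm_eq_pullback (hα : IsSmoothForm 𝓘(ℝ, E) α) {x : X} (hx : x ∈ 𝒞.regular) :
    letI := (𝒞.cutAtlas hs).chartedSpace
    𝒞.cutOneForm hs x = pullback 𝓘(ℝ, E) 𝓘(ℝ, E) 𝒞.lift α x := by
  let _ := (𝒞.cutAtlas hs).chartedSpace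
  have := (𝒞.cutAtlas hs).isManifold
  obtain ⟨i, hi⟩ := 𝒞.exists_mem_cutChart_source hs x
  have hy := (𝒞.cutChart i).map_source hi
  have hx' : (𝒞.cutChart i).symm (𝒞.cutChart i x) = x := (𝒞.cutChart i).left_inv hi
  refine (𝒞.cutAtlas hs).oneForm_eq (i := i) hi ?_
  have h1 : ContMDiffAt 𝓘(ℝ, E) 𝓘(ℝ, E) ∞ (𝒞.cutChart i).symm (𝒞.cutChart i x) :=
    ((𝒞.cutAtlas hs).contMDiffOn_chart_symm i).contMDiffAt
      ((𝒞.cutChart i).open_target.mem_nhds hy)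
  refine ((𝒞.pullbackRep_cutOneForm hs hα i hy).trans (𝒞.cutRep_eq_of_mem_regular i hy
    (by rwa [hx']))).trans (pullbackRep_pullback α ?_ ?_).symm
  · refine ContMDiffAt.mdifferentiableAt (n := ∞) ?_ (by simp)
    refine (𝒞.contMDiffOn_lift hs).contMDiffAt (𝒞.isOpen_regular.mem_nhds ?_)
    exact hx'.symm ▸ hx
  · exact h1.mdifferentiableAt (by simp)

end CutData
end ContactCut

namespace ContactCut

set_option linter.unusedSectionVars false

variable {E : Type*} [NormedAddCommGroup E] [NormedSpace ℝ E] [FiniteDimensional ℝ E]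
  {N : Type*} [TopologicalSpace N] [ChartedSpace E N] [IsManifold 𝓘(ℝ, E) ∞ N]
  {Y : Type*} [NormedAddCommGroup Y] [NormedSpace ℝ Y] [FiniteDimensional ℝ Y]
  {E₁ : Type*} [NormedAddCommGroup E₁] [NormedSpace ℝ E₁] [FiniteDimensional ℝ E₁]
  {α : OneForm 𝓘(ℝ, E) N} {𝒰 : LocalCircleAction α}

namespace Slice

variable (σ : Slice 𝒰 Y)

/-- An identification of `ℝ × Y` with the model space of the boundary. -/
def boundaryEquiv (hE₁ : Module.finrank ℝ E = Module.finrank ℝ E₁ + 1) : (ℝ × Y) ≃L[ℝ] E₁ :=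
  ContinuousLinearEquiv.ofFinrankEq (by
    have := σ.finrank_eq
    rw [Module.finrank_prod, Module.finrank_self]
    omega)

/-- An identification of `ℝ × ℝ × Y` with the model space. -/
def ambientEquiv : (ℝ × ℝ × Y) ≃L[ℝ] E :=
  ContinuousLinearEquiv.ofFinrankEq (by
    have := σ.finrank_eq
    rw [Module.finrank_prod, Module.finrank_prod, Module.finrank_self]
    omega)

theorem ambientChart_mem_maximalAtlas :
    σ.ambientChart.transHomeomorph σ.ambientEquiv.toHomeomorph
      ∈ IsManifold.maximalAtlas 𝓘(ℝ, E) ∞ N := by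
  refine OpenPartialHomeomorph.mem_maximalAtlas_of_contMDiffOn _ (fun x hx => ?_) fun y hy => ?_
  · have hx' : x ∈ σ.cutDom := hx
    exact (ContMDiffAt.comp x σ.ambientEquiv.contDiff.contMDiff.contMDiffAt
      ((σ.contMDiffAt_arg_angle hx'.1 hx'.2).prodMk_space
        (σ.contMDiffAt_coord hx'.1))).contMDiffWithinAt
  · have hy' : (σ.ambientEquiv.symm y).2 ∈ σ.D := hy.2
    exact (ContMDiffAt.comp y (σ.contMDiffAt_flowOut_sec hy')
      σ.ambientEquiv.symm.contDiff.contMDiff.contMDiffAt).contMDiffWithinAt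

end Slice

namespace CutData

variable {M X B : Type*} [TopologicalSpace M] [TopologicalSpace X] [TopologicalSpace B]
  (𝒞 : CutData 𝒰 M X B) (σ : Slice 𝒰 Y)

section Charts

variable [Nonempty 𝒞.b]

theorem ιb_boundaryChart_symm {v : ℝ × Y} (hv : ((0 : ℝ), v.2) ∈ σ.D) :
    𝒞.ιb ((𝒞.boundaryChart σ).symm v) = 𝒰.flowOut σ.sec (v.1, (0, v.2)) :=
  𝒞.ιb_invb (𝒞.flowOut_mem_range σ hv)

theorem boundaryChart_apply (m : 𝒞.b) :
    𝒞.boundaryChart σ m = ((σ.angle (𝒞.ιb m) : ℂ).arg, (σ.coord (𝒞.ιb m)).2) := rfl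

theorem ιb_orbitChart_symm {y : Y} (hy : ((0 : ℝ), y) ∈ σ.D) :
    ∃ m, (𝒞.orbitChart σ).symm y = 𝒞.p m ∧ 𝒞.ιb m = 𝒰.flowOut σ.sec (0, (0, y)) :=
  ⟨_, rfl, 𝒞.ιb_invb (𝒞.flowOut_mem_range σ hy)⟩

theorem orbitChart_p {m : 𝒞.b} (hm : 𝒞.ιb m ∈ σ.W) :
    𝒞.orbitChart σ (𝒞.p m) = (σ.coord (𝒞.ιb m)).2 :=
  congrArg Prod.snd (𝒞.coord_liftB σ hm)

theorem p_mem_orbitChart_source (m : 𝒞.b) : 𝒞.p m ∈ (𝒞.orbitChart σ).source ↔ 𝒞.ιb m ∈ σ.W :=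
  𝒞.p_mem_image_W_iff σ m

theorem p_boundaryChart_symm {v : ℝ × Y} (hv : ((0 : ℝ), v.2) ∈ σ.D) :
    𝒞.p ((𝒞.boundaryChart σ).symm v) = (𝒞.orbitChart σ).symm v.2 := by
  obtain ⟨m, hm, hm'⟩ := 𝒞.ιb_orbitChart_symm σ hv
  have h := 𝒞.ιb_boundaryChart_symm σ hv
  rw [hm, 𝒞.p_eq_iff]
  refine ⟨Circle.exp v.1, h.trans ?_⟩
  change _ = 𝒰.act (Circle.exp v.1) (𝒞.ιb m)
  rw [hm', 𝒰.flowOut_zero (σ.sec_mem_dom _ hv)]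
  rfl

theorem j_orbitChart_symm [Nonempty M] {y : Y} (hy : ((0 : ℝ), y) ∈ σ.D) :
    𝒞.j ((𝒞.orbitChart σ).symm y) = (𝒞.sliceChart σ).symm (0, y) := by
  obtain ⟨m, hm, hm'⟩ := 𝒞.ιb_orbitChart_symm σ hy
  rw [hm, 𝒞.j_p, ← 𝒞.proj_ι]
  change 𝒞.proj (𝒞.ιb m) = 𝒞.proj (σ.polar (0, y))
  rw [hm']
  simp [LocalCircleAction.flowOut, Slice.polar, toCircle, radial]

end Charts

/-- The charts of the boundary. -/
def boundaryModelChart (hE₁ : Module.finrank ℝ E = Module.finrank ℝ E₁ + 1)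
    (i : Slice 𝒰 Y × 𝒞.b) : OpenPartialHomeomorph 𝒞.b E₁ :=
  haveI : Nonempty 𝒞.b := ⟨i.2⟩
  (𝒞.boundaryChart i.1).transHomeomorph (i.1.boundaryEquiv hE₁).toHomeomorph

/-- The smooth atlas of the boundary. -/
def boundaryAtlas (hE₁ : Module.finrank ℝ E = Module.finrank ℝ E₁ + 1)
    (hb : ∀ m : 𝒞.b, ∃ σ : Slice 𝒰 Y, 𝒞.ιb m ∈ σ.cutDom) : ChartFamily E₁ 𝒞.b where
  Index := Slice 𝒰 Y × 𝒞.b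
  chart := 𝒞.boundaryModelChart hE₁
  pick m := ((hb m).choose, m)
  mem_pick m := (hb m).choose_spec
  smooth := by
    rintro ⟨σ, m⟩ ⟨σ', m'⟩ y hy hj
    have : Nonempty 𝒞.b := ⟨m⟩
    set v := (σ.boundaryEquiv hE₁).symm y with hv
    have hv' : v.1 ∈ Ioo (-Real.pi) Real.pi ∧ ((0 : ℝ), v.2) ∈ σ.D := hy
    have hj' : 𝒞.ιb ((𝒞.boundaryChart σ).symm v) ∈ σ'.cutDom := hj
    rw [𝒞.ιb_boundaryChart_symm σ hv'.2] at hj'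
    have h1 : ContMDiffAt 𝓘(ℝ, ℝ × Y) 𝓘(ℝ, E) ∞
        (fun v : ℝ × Y => 𝒰.flowOut σ.sec (v.1, (0, v.2))) v :=
      ContMDiffAt.comp v (σ.contMDiffAt_flowOut_sec (p := (v.1, (0, v.2))) hv'.2)
        (contDiff_fst.prodMk (contDiff_const.prodMk contDiff_snd)).contMDiff.contMDiffAt
    have h2 : ContMDiffAt 𝓘(ℝ, ℝ × Y) 𝓘(ℝ, ℝ) ∞
        (fun v : ℝ × Y => (σ'.angle (𝒰.flowOut σ.sec (v.1, (0, v.2))) : ℂ).arg) v :=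
      (σ'.contMDiffAt_arg_angle hj'.1 hj'.2).comp v h1
    have h3 := ContMDiffAt.comp v (σ'.contMDiffAt_coord hj'.1) h1
    have h4 := h2.contDiffAt.prodMk (contDiff_snd.contDiffAt.comp v h3.contDiffAt)
    refine ContDiffAt.congr_of_eventuallyEq ((σ'.boundaryEquiv hE₁).contDiff.contDiffAt.comp y
      (h4.comp y (σ.boundaryEquiv hE₁).symm.contDiff.contDiffAt)) ?_
    filter_upwards [(𝒞.boundaryModelChart hE₁ (σ, m)).open_target.mem_nhds hy] with z hz
    have hz' := 𝒞.ιb_boundaryChart_symm σ (v := (σ.boundaryEquiv hE₁).symm z) hz.2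
    change σ'.boundaryEquiv hE₁ (𝒞.boundaryChart σ' ((𝒞.boundaryChart σ).symm
      ((σ.boundaryEquiv hE₁).symm z))) = _
    rw [𝒞.boundaryChart_apply, hz']
    rfl

/-- The charts of the orbit space of the boundary. -/
def orbitModelChart (i : Slice 𝒰 Y × 𝒞.b) : OpenPartialHomeomorph B Y :=
  haveI : Nonempty 𝒞.b := ⟨i.2⟩
  𝒞.orbitChart i.1

/-- The smooth atlas of the orbit space of the boundary. -/
def orbitAtlas (hs : ∀ m ∈ 𝒞.b, ∃ σ : Slice 𝒰 Y, 𝒞.ι m ∈ σ.W) : ChartFamily Y B where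
  Index := Slice 𝒰 Y × 𝒞.b
  chart := 𝒞.orbitModelChart
  pick x :=
    let m := Function.surjInv 𝒞.isQuotientMap_p.surjective x
    ((hs m m.2).choose, m)
  mem_pick x := by
    set m := Function.surjInv 𝒞.isQuotientMap_p.surjective x with hm
    have : Nonempty 𝒞.b := ⟨m⟩
    have h := (𝒞.p_mem_orbitChart_source (hs m m.2).choose m).2 (hs m m.2).choose_spec
    rw [hm, Function.surjInv_eq 𝒞.isQuotientMap_p.surjective x, ← hm] at h
    exact h
  smooth := by
    rintro ⟨σ, m⟩ ⟨σ', m'⟩ y hy hj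
    have : Nonempty 𝒞.b := ⟨m⟩
    have hy' : ((0 : ℝ), y) ∈ σ.D := hy
    have hj' : (𝒞.orbitChart σ).symm y ∈ (𝒞.orbitChart σ').source := hj
    have key : ∀ z, ((0 : ℝ), z) ∈ σ.D → (𝒞.orbitChart σ).symm z ∈ (𝒞.orbitChart σ').source →
        𝒰.flowOut σ.sec (0, (0, z)) ∈ σ'.W ∧ 𝒞.orbitChart σ' ((𝒞.orbitChart σ).symm z)
          = (σ'.coord (𝒰.flowOut σ.sec (0, (0, z)))).2 := by
      intro z hz hz'
      obtain ⟨n, hn, hn'⟩ := 𝒞.ιb_orbitChart_symm σ hz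
      rw [hn, 𝒞.p_mem_orbitChart_source] at hz'
      rw [hn, 𝒞.orbitChart_p σ' hz']
      exact ⟨hn' ▸ hz', by rw [hn']⟩
    have h1 : ContMDiffAt 𝓘(ℝ, Y) 𝓘(ℝ, E) ∞
        (fun z : Y => 𝒰.flowOut σ.sec (0, (0, z))) y :=
      ContMDiffAt.comp y (σ.contMDiffAt_flowOut_sec (p := (0, (0, y))) hy')
        (contDiff_const.prodMk (contDiff_const.prodMk contDiff_id)).contMDiff.contMDiffAt
    have h3 := ContMDiffAt.comp y (σ'.contMDiffAt_coord (key y hy' hj').1) h1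
    refine (contDiff_snd.contDiffAt.comp y h3.contDiffAt).congr_of_eventuallyEq ?_
    filter_upwards [(𝒞.orbitChart σ).open_target.mem_nhds hy,
      ((𝒞.orbitChart σ).continuousAt_symm hy).preimage_mem_nhds
        ((𝒞.orbitChart σ').open_source.mem_nhds hj')] with z hz hz'
    exact (key z hz hz').2

variable (hE₁ : Module.finrank ℝ E = Module.finrank ℝ E₁ + 1)
  (hb : ∀ m : 𝒞.b, ∃ σ : Slice 𝒰 Y, 𝒞.ιb m ∈ σ.cutDom)
  (hs : ∀ m ∈ 𝒞.b, ∃ σ : Slice 𝒰 Y, 𝒞.ι m ∈ σ.W)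

theorem isImmersionOfComplement_ιb : letI := (𝒞.boundaryAtlas hE₁ hb).chartedSpace
    IsImmersionOfComplement ℝ 𝓘(ℝ, E₁) 𝓘(ℝ, E) ∞ 𝒞.ιb := by
  let _ := (𝒞.boundaryAtlas hE₁ hb).chartedSpace
  have := (𝒞.boundaryAtlas hE₁ hb).isManifold
  intro m
  have : Nonempty 𝒞.b := ⟨m⟩
  obtain ⟨σ, hσ⟩ := hb m
  let T : (E₁ × ℝ) ≃L[ℝ] E :=
    ((((σ.boundaryEquiv hE₁).symm.prodCongr (ContinuousLinearEquiv.refl ℝ ℝ)).trans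
      (ContinuousLinearEquiv.prodAssoc ℝ ℝ Y ℝ)).trans
      ((ContinuousLinearEquiv.refl ℝ ℝ).prodCongr (ContinuousLinearEquiv.prodComm ℝ Y ℝ))).trans
      σ.ambientEquiv
  refine IsImmersionAtOfComplement.mk_of_continuousAt 𝒞.isEmbedding_ιb.continuous.continuousAt T
    (𝒞.boundaryModelChart hE₁ (σ, m)) (σ.ambientChart.transHomeomorph σ.ambientEquiv.toHomeomorph)
    hσ hσ ((𝒞.boundaryAtlas hE₁ hb).chart_mem_maximalAtlas (σ, m)) σ.ambientChart_mem_maximalAtlas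
    ?_
  intro y hy
  have hy' : y ∈ (𝒞.boundaryModelChart hE₁ (σ, m)).target := by simpa using hy
  have h1 : (𝒞.ιb ((𝒞.boundaryChart σ).symm ((σ.boundaryEquiv hE₁).symm y))) = _ :=
    𝒞.ιb_boundaryChart_symm σ hy'.2
  change σ.ambientEquiv (σ.ambientChart (𝒞.ιb ((𝒞.boundaryChart σ).symm
    ((σ.boundaryEquiv hE₁).symm y)))) = σ.ambientEquiv _
  rw [h1]
  exact congrArg σ.ambientEquiv (σ.ambientChart.right_inv (x := (_, (0, _))) ⟨hy'.1, hy'.2⟩)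

theorem isSubmersionOfComplement_p : letI := (𝒞.boundaryAtlas hE₁ hb).chartedSpace
    letI := (𝒞.orbitAtlas hs).chartedSpace
    IsSubmersionOfComplement ℝ 𝓘(ℝ, E₁) 𝓘(ℝ, Y) ∞ 𝒞.p := by
  let _ := (𝒞.boundaryAtlas hE₁ hb).chartedSpace
  have := (𝒞.boundaryAtlas hE₁ hb).isManifold
  let _ := (𝒞.orbitAtlas hs).chartedSpace
  have := (𝒞.orbitAtlas hs).isManifold
  intro m
  have : Nonempty 𝒞.b := ⟨m⟩
  obtain ⟨σ, hσ⟩ := hb m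
  refine IsSubmersionAtOfComplement.mk_of_continuousAt 𝒞.isQuotientMap_p.continuous.continuousAt
    ((σ.boundaryEquiv hE₁).symm.trans (ContinuousLinearEquiv.prodComm ℝ ℝ Y))
    (𝒞.boundaryModelChart hE₁ (σ, m)) (𝒞.orbitChart σ)
    hσ ((𝒞.p_mem_orbitChart_source σ m).2 hσ.1)
    ((𝒞.boundaryAtlas hE₁ hb).chart_mem_maximalAtlas (σ, m))
    ((𝒞.orbitAtlas hs).chart_mem_maximalAtlas (σ, m)) ?_
  intro y hy
  have hy' : y ∈ (𝒞.boundaryModelChart hE₁ (σ, m)).target := by simpa using hy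
  change 𝒞.orbitChart σ (𝒞.p ((𝒞.boundaryChart σ).symm ((σ.boundaryEquiv hE₁).symm y)))
    = ((σ.boundaryEquiv hE₁).symm y).2
  have hD : ((0 : ℝ), ((σ.boundaryEquiv hE₁).symm y).2) ∈ σ.D := hy'.2
  rw [𝒞.p_boundaryChart_symm σ hD, (𝒞.orbitChart σ).right_inv hD]

theorem isImmersionOfComplement_j : letI := (𝒞.cutAtlas hs).chartedSpace
    letI := (𝒞.orbitAtlas hs).chartedSpace
    IsImmersionOfComplement ℂ 𝓘(ℝ, Y) 𝓘(ℝ, E) ∞ 𝒞.j := by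
  let _ := (𝒞.cutAtlas hs).chartedSpace
  have := (𝒞.cutAtlas hs).isManifold
  let _ := (𝒞.orbitAtlas hs).chartedSpace
  have := (𝒞.orbitAtlas hs).isManifold
  intro x
  obtain ⟨m, rfl⟩ := 𝒞.isQuotientMap_p.surjective x
  have : Nonempty 𝒞.b := ⟨m⟩
  have : Nonempty M := ⟨m⟩
  obtain ⟨σ, hσ⟩ := hs m m.2
  refine IsImmersionAtOfComplement.mk_of_continuousAt 𝒞.continuous_j.continuousAt
    ((ContinuousLinearEquiv.prodComm ℝ Y ℂ).trans σ.cutEquiv) (𝒞.orbitChart σ)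
    (𝒞.cutChart (Sum.inr (σ, (m : M)))) ((𝒞.p_mem_orbitChart_source σ m).2 hσ) ?_
    ((𝒞.orbitAtlas hs).chart_mem_maximalAtlas (σ, m))
    ((𝒞.cutAtlas hs).chart_mem_maximalAtlas (Sum.inr (σ, (m : M)))) ?_
  · rw [𝒞.j_p, 𝒞.q_mem_cutChart_inr_source]
    exact hσ
  · intro y hy
    have hy' : y ∈ (𝒞.orbitChart σ).target := by simpa using hy
    change σ.cutEquiv (𝒞.sliceChart σ (𝒞.j ((𝒞.orbitChart σ).symm y))) = σ.cutEquiv (0, y)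
    have hy0 : ((0 : ℝ), y) ∈ σ.D := hy'
    have hD : radial ((0 : ℂ), y) ∈ σ.D := by simpa [radial] using hy0
    rw [𝒞.j_orbitChart_symm σ hy', (𝒞.sliceChart σ).right_inv hD]

theorem cutRep_comp_inr (s : Slice 𝒰 Y × M) (y : Y) :
    (𝒞.cutRep (Sum.inr s) (s.1.cutEquiv (0, y))).comp
      ((s.1.cutEquiv : ℂ × Y →L[ℝ] E).comp (ContinuousLinearMap.inr ℝ ℂ Y))
      = reducedForm (pullbackRep s.1.sec α) y := by
  refine ContinuousLinearMap.ext fun w => ?_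
  simp [cutRep_inr, cutForm_apply, reducedForm, radial]

/-- The form induced on the orbit space of the boundary, in a slice chart. -/
theorem pullbackRep_comp_j_cutOneForm (hα : IsSmoothForm 𝓘(ℝ, E) α) (s : Slice 𝒰 Y × M) {y : Y}
    (hy : ((0 : ℝ), y) ∈ s.1.D) : letI := (𝒞.cutAtlas hs).chartedSpace
    pullbackRep (fun y => (𝒞.cutChart (Sum.inr s)).symm (s.1.cutEquiv (0, y))) (𝒞.cutOneForm hs) y
      = reducedForm (pullbackRep s.1.sec α) y := by
  let _ := (𝒞.cutAtlas hs).chartedSpace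
  have := (𝒞.cutAtlas hs).isManifold
  have hD : s.1.cutEquiv ((0 : ℂ), y) ∈ (𝒞.cutChart (Sum.inr s)).target := by
    have : Nonempty M := ⟨s.2⟩
    rw [𝒞.mem_cutChart_inr_target]
    simpa [radial] using hy
  have hd : HasFDerivAt (fun y : Y => s.1.cutEquiv ((0 : ℂ), y))
      ((s.1.cutEquiv : ℂ × Y →L[ℝ] E).comp (ContinuousLinearMap.inr ℝ ℂ Y)) y :=
    s.1.cutEquiv.hasFDerivAt.comp y (hasFDerivAt_prodMk_right (𝕜 := ℝ) (0 : ℂ) y)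
  have h1 : MDifferentiableAt 𝓘(ℝ, E) 𝓘(ℝ, E) (𝒞.cutChart (Sum.inr s)).symm
      (s.1.cutEquiv ((0 : ℂ), y)) :=
    (((𝒞.cutAtlas hs).contMDiffOn_chart_symm (Sum.inr s)).contMDiffAt
      ((𝒞.cutChart (Sum.inr s)).open_target.mem_nhds hD)).mdifferentiableAt (by simp)
  rw [pullbackRep_comp _ (g := fun y : Y => s.1.cutEquiv ((0 : ℂ), y)) h1 hd.differentiableAt,
    𝒞.pullbackRep_cutOneForm hs hα _ hD, hd.fderiv, 𝒞.cutRep_comp_inr]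

theorem pullbackRep_orbitChart_symm (hα : IsSmoothForm 𝓘(ℝ, E) α) (s : Slice 𝒰 Y × 𝒞.b) {y : Y}
    (hy : ((0 : ℝ), y) ∈ s.1.D) : letI := (𝒞.cutAtlas hs).chartedSpace
    letI := (𝒞.orbitAtlas hs).chartedSpace
    pullbackRep (𝒞.orbitModelChart s).symm
        (pullback 𝓘(ℝ, Y) 𝓘(ℝ, E) 𝒞.j (𝒞.cutOneForm hs)) y
      = reducedForm (pullbackRep s.1.sec α) y := by
  let _ := (𝒞.cutAtlas hs).chartedSpace
  have := (𝒞.cutAtlas hs).isManifold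
  let _ := (𝒞.orbitAtlas hs).chartedSpace
  have := (𝒞.orbitAtlas hs).isManifold
  have : Nonempty 𝒞.b := ⟨s.2⟩
  have : Nonempty M := ⟨s.2⟩
  have hy' : y ∈ (𝒞.orbitModelChart s).target := hy
  rw [pullbackRep_pullback]
  · rw [← 𝒞.pullbackRep_comp_j_cutOneForm hs hα (s.1, (s.2 : M)) hy]
    refine pullbackRep_congr _ ?_
    filter_upwards [(𝒞.orbitModelChart s).open_target.mem_nhds hy'] with z hz
    refine (𝒞.j_orbitChart_symm s.1 hz).trans ?_
    change _ = (𝒞.sliceChart s.1).symm (s.1.cutEquiv.symm (s.1.cutEquiv (0, z)))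
    rw [s.1.cutEquiv.symm_apply_apply]
  · exact ((𝒞.isImmersionOfComplement_j hs).contMDiff _).mdifferentiableAt (by simp)
  · exact (((𝒞.orbitAtlas hs).contMDiffOn_chart_symm s).contMDiffAt
      ((𝒞.orbitModelChart s).open_target.mem_nhds hy')).mdifferentiableAt (by simp)

theorem isContactForm_pullback_j (hα : IsContactForm 𝓘(ℝ, E) α) :
    letI := (𝒞.cutAtlas hs).chartedSpace
    letI := (𝒞.orbitAtlas hs).chartedSpace
    haveI := (𝒞.orbitAtlas hs).isManifold
    IsContactForm 𝓘(ℝ, Y) (pullback 𝓘(ℝ, Y) 𝓘(ℝ, E) 𝒞.j (𝒞.cutOneForm hs)) := by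
  refine (𝒞.orbitAtlas hs).isContactForm
    (b := fun s y => reducedForm (pullbackRep s.1.sec α) y)
    (fun s y hy => 𝒞.pullbackRep_orbitChart_symm hs hα.smooth s hy) fun s y hy => ⟨?_, ?_⟩
  · have h := s.1.contDiffAt_pullbackRep_sec hα.smooth (v := (0, y)) hy
    exact (h.comp y (contDiffAt_const.prodMk contDiffAt_id)).clm_comp contDiffAt_const
  · exact s.1.contactAt_reducedForm hα hy

theorem pullback_p_pullback_j (hα : IsSmoothForm 𝓘(ℝ, E) α) :
    letI := (𝒞.cutAtlas hs).chartedSpace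
    letI := (𝒞.orbitAtlas hs).chartedSpace
    letI := (𝒞.boundaryAtlas hE₁ hb).chartedSpace
    pullback 𝓘(ℝ, E₁) 𝓘(ℝ, Y) 𝒞.p (pullback 𝓘(ℝ, Y) 𝓘(ℝ, E) 𝒞.j (𝒞.cutOneForm hs))
      = pullback 𝓘(ℝ, E₁) 𝓘(ℝ, E) 𝒞.ιb α := by
  let _ := (𝒞.cutAtlas hs).chartedSpace
  have := (𝒞.cutAtlas hs).isManifold
  let _ := (𝒞.orbitAtlas hs).chartedSpace
  have := (𝒞.orbitAtlas hs).isManifold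
  let _ := (𝒞.boundaryAtlas hE₁ hb).chartedSpace
  have := (𝒞.boundaryAtlas hE₁ hb).isManifold
  funext m
  have : Nonempty 𝒞.b := ⟨m⟩
  have : Nonempty M := ⟨m⟩
  obtain ⟨σ, hσ⟩ := hb m
  set e := 𝒞.boundaryModelChart hE₁ (σ, m) with he
  have hme : m ∈ e.source := hσ
  set y := e m with hy
  have hye : y ∈ e.target := e.map_source hme
  have hes : MDifferentiableAt 𝓘(ℝ, E₁) 𝓘(ℝ, E₁) e.symm y :=
    (((𝒞.boundaryAtlas hE₁ hb).contMDiffOn_chart_symm (σ, m)).contMDiffAt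
      (e.open_target.mem_nhds hye)).mdifferentiableAt (by simp)
  set K := (σ.boundaryEquiv hE₁).symm with hK
  have hKy : (K y).1 ∈ Ioo (-Real.pi) Real.pi ∧ ((0 : ℝ), (K y).2) ∈ σ.D := hye
  have hpd := ((𝒞.isSubmersionOfComplement_p hE₁ hb hs).contMDiff (e.symm y)).mdifferentiableAt
    (by simp)
  have hjd := ((𝒞.isImmersionOfComplement_j hs).contMDiff (𝒞.p (e.symm y))).mdifferentiableAt
    (by simp)
  have hιd := ((𝒞.isImmersionOfComplement_ιb hE₁ hb).contMDiff (e.symm y)).mdifferentiableAt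
    (by simp)
  refine (𝒞.boundaryAtlas hE₁ hb).oneForm_eq (i := (σ, m)) hme ?_
  change pullbackRep e.symm _ y = pullbackRep e.symm _ y
  have hKd : HasFDerivAt (fun z => (K z).2)
      ((ContinuousLinearMap.snd ℝ ℝ Y).comp (K : E₁ →L[ℝ] ℝ × Y)) y :=
    hasFDerivAt_snd.comp y K.hasFDerivAt
  have hLd : HasFDerivAt (fun z => ((K z).1, ((0 : ℝ), (K z).2)))
      (((ContinuousLinearMap.fst ℝ ℝ Y).comp (K : E₁ →L[ℝ] ℝ × Y)).prod
        ((0 : E₁ →L[ℝ] ℝ).prod ((ContinuousLinearMap.snd ℝ ℝ Y).comp (K : E₁ →L[ℝ] ℝ × Y)))) y :=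
    (hasFDerivAt_fst.comp y K.hasFDerivAt).prodMk ((hasFDerivAt_const (0 : ℝ) y).prodMk hKd)
  have h1 : pullbackRep e.symm (pullback 𝓘(ℝ, E₁) 𝓘(ℝ, Y) 𝒞.p
      (pullback 𝓘(ℝ, Y) 𝓘(ℝ, E) 𝒞.j (𝒞.cutOneForm hs))) y
      = (reducedForm (pullbackRep σ.sec α) (K y).2).comp
        ((ContinuousLinearMap.snd ℝ ℝ Y).comp (K : E₁ →L[ℝ] ℝ × Y)) := by
    have hev : (fun z => 𝒞.p (e.symm z)) =ᶠ[𝓝 y]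
        fun z => (𝒞.orbitModelChart (σ, m)).symm (K z).2 := by
      filter_upwards [e.open_target.mem_nhds hye] with z hz
      exact 𝒞.p_boundaryChart_symm σ hz.2
    rw [pullbackRep_pullback _ hpd hes, pullbackRep_congr _ hev,
      pullbackRep_comp _ (g := fun z => (K z).2) _ hKd.differentiableAt,
      𝒞.pullbackRep_orbitChart_symm hs hα (σ, m) hKy.2, hKd.fderiv]
    exact (((𝒞.orbitAtlas hs).contMDiffOn_chart_symm (σ, m)).contMDiffAt
      ((𝒞.orbitModelChart (σ, m)).open_target.mem_nhds hKy.2)).mdifferentiableAt (by simp)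
  have h2 : pullbackRep e.symm (pullback 𝓘(ℝ, E₁) 𝓘(ℝ, E) 𝒞.ιb α) y
      = (flowForm Prod.fst (pullbackRep σ.sec α) ((K y).1, (0, (K y).2))).comp
        (((ContinuousLinearMap.fst ℝ ℝ Y).comp (K : E₁ →L[ℝ] ℝ × Y)).prod
        ((0 : E₁ →L[ℝ] ℝ).prod ((ContinuousLinearMap.snd ℝ ℝ Y).comp (K : E₁ →L[ℝ] ℝ × Y)))) := by
    have hev : (fun z => 𝒞.ιb (e.symm z)) =ᶠ[𝓝 y]
        fun z => 𝒰.flowOut σ.sec ((K z).1, (0, (K z).2)) := by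
      filter_upwards [e.open_target.mem_nhds hye] with z hz
      exact 𝒞.ιb_boundaryChart_symm σ hz.2
    rw [pullbackRep_pullback _ hιd hes, pullbackRep_congr _ hev,
      pullbackRep_comp _ (f := 𝒰.flowOut σ.sec) (g := fun z => ((K z).1, ((0 : ℝ), (K z).2)))
        ((σ.contMDiffAt_flowOut_sec (p := ((K y).1, (0, (K y).2)))
          hKy.2).mdifferentiableAt (by simp)) hLd.differentiableAt,
      σ.pullbackRep_flowOut_sec hKy.2, hLd.fderiv]
  rw [h1]
  refine Eq.trans ?_ h2.symm
  refine ContinuousLinearMap.ext fun w => ?_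
  simp [flowForm_apply, reducedForm]

end CutData
end ContactCut

namespace ContactCut

namespace CutData

variable {E : Type*} [NormedAddCommGroup E] [NormedSpace ℝ E]
  {N : Type*} [TopologicalSpace N] [ChartedSpace E N]
  {α : OneForm 𝓘(ℝ, E) N} {𝒰 : LocalCircleAction α}
  {M X B : Type*} [TopologicalSpace M] [TopologicalSpace X] [TopologicalSpace B]
  (𝒞 : CutData 𝒰 M X B)

theorem isClosed_b : IsClosed 𝒞.b := ⟨𝒞.isOpen_compl_b⟩

theorem exists_act_eq {m : M} (hm : m ∈ 𝒞.b) (c : Circle) : ∃ m' ∈ 𝒞.b, 𝒞.ι m' = 𝒰.act c (𝒞.ι m) := by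
  have h := (𝒞.mem_b_iff m).1 hm
  have h1 := 𝒰.act_mem c _ h.1
  obtain ⟨m', hm'⟩ := (𝒞.mem_range_iff _ h1).2 (by rw [𝒰.moment_act c h.1, h.2])
  exact ⟨m', 𝒞.mem_b_of_act hm hm', hm'⟩

theorem isClosedMap_q : IsClosedMap 𝒞.q := by
  intro C hC
  rw [← 𝒞.isQuotientMap_q.isClosed_preimage]
  obtain ⟨C', hC', rfl⟩ := 𝒞.isEmbedding_ι.isInducing.isClosed_iff.1 hC
  set Z : Set (Circle × 𝒞.b) := (fun p => 𝒰.act p.1 (𝒞.ι p.2)) ⁻¹' C' with hZ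
  have hZc : IsClosed Z := by
    refine hC'.preimage (𝒰.continuousOn_act.comp_continuous
      (f := fun p : Circle × 𝒞.b => (p.1, 𝒞.ι p.2)) ?_ fun p => ⟨mem_univ _,
        ((𝒞.mem_b_iff _).1 p.2.2).1⟩)
    exact continuous_fst.prodMk (𝒞.isEmbedding_ι.continuous.comp
      (continuous_subtype_val.comp continuous_snd))
  have hpc := isClosedMap_snd_of_compactSpace Z hZc
  have heq : 𝒞.q ⁻¹' (𝒞.q '' (𝒞.ι ⁻¹' C')) = 𝒞.ι ⁻¹' C' ∪ Subtype.val '' (Prod.snd '' Z) := by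
    ext m
    constructor
    · rintro ⟨m', hm', h⟩
      rcases (𝒞.q_eq_iff _ _).1 h with rfl | ⟨-, hm, c, hc⟩
      · exact Or.inl hm'
      · refine Or.inr ⟨⟨m, hm⟩, ⟨(c, ⟨m, hm⟩), ?_, rfl⟩, rfl⟩
        change 𝒰.act c (𝒞.ι m) ∈ C'
        rw [← hc]
        exact hm'
    · rintro (h | ⟨_, ⟨⟨c, n⟩, h, rfl⟩, rfl⟩)
      · exact ⟨m, h, rfl⟩
      · obtain ⟨m', hm', he⟩ := 𝒞.exists_act_eq n.2 c
        refine ⟨m', ?_, 𝒞.q_eq_of_act n.2 he⟩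
        rw [mem_preimage, he]
        exact h
  rw [heq]
  exact hC.union (𝒞.isClosed_b.isClosedEmbedding_subtypeVal.isClosedMap _ hpc)

theorem isCompact_fiber (m : M) : IsCompact (𝒞.q ⁻¹' {𝒞.q m}) := by
  by_cases hm : m ∈ 𝒞.b
  · have hd := ((𝒞.mem_b_iff m).1 hm).1
    have hc : Continuous fun c => 𝒰.act c (𝒞.ι m) :=
      𝒰.continuousOn_act.comp_continuous (f := fun c : Circle => (c, 𝒞.ι m)) (by fun_prop)
        fun c => ⟨mem_univ _, hd⟩
    have heq : 𝒞.ι '' (𝒞.q ⁻¹' {𝒞.q m}) = range fun c => 𝒰.act c (𝒞.ι m) := by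
      ext x
      constructor
      · rintro ⟨m', h, rfl⟩
        rcases (𝒞.q_eq_iff _ _).1 h with rfl | ⟨-, -, c, hc⟩
        · exact ⟨1, 𝒰.act_one _ hd⟩
        · exact ⟨c, hc.symm⟩
      · rintro ⟨c, rfl⟩
        obtain ⟨m', -, he⟩ := 𝒞.exists_act_eq hm c
        exact ⟨m', 𝒞.q_eq_of_act hm he, he⟩
    rw [𝒞.isEmbedding_ι.isCompact_iff, heq]
    exact isCompact_range hc
  · have : 𝒞.q ⁻¹' {𝒞.q m} = {m} := by
      ext m'
      refine ⟨fun h => ?_, fun h => congrArg 𝒞.q h⟩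
      rcases (𝒞.q_eq_iff _ _).1 h with rfl | ⟨-, h, -⟩
      · rfl
      · exact absurd h hm
    rw [this]
    exact isCompact_singleton

theorem t2Space (𝒞 : CutData 𝒰 M X B) [T2Space N] : T2Space X := by
  have : T2Space M := 𝒞.isEmbedding_ι.t2Space
  refine ⟨fun x y hxy => ?_⟩
  obtain ⟨m, rfl⟩ := 𝒞.isQuotientMap_q.surjective x
  obtain ⟨m', rfl⟩ := 𝒞.isQuotientMap_q.surjective y
  have hd : Disjoint (𝒞.q ⁻¹' {𝒞.q m}) (𝒞.q ⁻¹' {𝒞.q m'}) :=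
    (disjoint_singleton.2 hxy).preimage _
  obtain ⟨u, v, hu, hv, hmu, hmv, huv⟩ :=
    SeparatedNhds.of_isCompact_isCompact (𝒞.isCompact_fiber m) (𝒞.isCompact_fiber m') hd
  have hs : ∀ w : Set M, 𝒞.q ⁻¹' (𝒞.q '' wᶜ)ᶜ ⊆ w := fun w n hn => by
    by_contra h
    exact hn ⟨n, h, rfl⟩
  refine ⟨(𝒞.q '' uᶜ)ᶜ, (𝒞.q '' vᶜ)ᶜ, (𝒞.isClosedMap_q _ hu.isClosed_compl).isOpen_compl,
    (𝒞.isClosedMap_q _ hv.isClosed_compl).isOpen_compl, ?_, ?_, ?_⟩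
  · rintro ⟨n, hn, h⟩
    exact hn (hmu h)
  · rintro ⟨n, hn, h⟩
    exact hn (hmv h)
  · refine Set.disjoint_left.2 fun z hz hz' => ?_
    obtain ⟨n, rfl⟩ := 𝒞.isQuotientMap_q.surjective z
    exact Set.disjoint_left.1 huv (hs u hz) (hs v hz')

theorem sigmaCompactSpace (𝒞 : CutData 𝒰 M X B) [SigmaCompactSpace M] : SigmaCompactSpace X := by
  rw [← isSigmaCompact_univ_iff, ← 𝒞.isQuotientMap_q.surjective.range_eq, ← image_univ]
  exact isSigmaCompact_univ.image 𝒞.isQuotientMap_q.continuous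

theorem isClosedEmbedding_j : IsClosedEmbedding 𝒞.j := by
  refine .of_continuous_injective_isClosedMap 𝒞.continuous_j ?_ ?_
  · intro x y h
    obtain ⟨m, rfl⟩ := 𝒞.isQuotientMap_p.surjective x
    obtain ⟨m', rfl⟩ := 𝒞.isQuotientMap_p.surjective y
    rw [𝒞.j_p, 𝒞.j_p] at h
    rcases (𝒞.q_eq_iff _ _).1 h with h | ⟨-, -, h⟩
    · rw [Subtype.ext h]
    · exact (𝒞.p_eq_iff _ _).2 h
  · intro C hC
    have : 𝒞.j '' C = 𝒞.q '' (Subtype.val '' (𝒞.p ⁻¹' C)) := by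
      conv_lhs => rw [← image_preimage_eq C 𝒞.isQuotientMap_p.surjective]
      rw [image_image, image_image]
      exact image_congr fun m _ => 𝒞.j_p m
    rw [this]
    exact 𝒞.isClosedMap_q _ (𝒞.isClosed_b.isClosedEmbedding_subtypeVal.isClosedMap _
      (hC.preimage 𝒞.isQuotientMap_p.continuous))

end CutData
end ContactCut

namespace ContactCut

section LocalInverse

variable {E : Type*} [NormedAddCommGroup E] [NormedSpace ℝ E]
  {H : Type*} [TopologicalSpace H] (I : ModelWithCorners ℝ E H)
  {M : Type*} [TopologicalSpace M] [ChartedSpace H M]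
  {N : Type*} [TopologicalSpace N] [ChartedSpace E N]

theorem isInteriorPoint_iff_of_mem_maximalAtlas {φ : OpenPartialHomeomorph M H}
    (hφ : φ ∈ IsManifold.maximalAtlas I ∞ M) {m : M} (hm : m ∈ φ.source) :
    I.IsInteriorPoint m ↔ φ.extend I m ∈ interior (φ.extend I).target := by
  have h : IsLocalDiffeomorphAt I I ∞ φ m :=
    ⟨⟨φ.toPartialEquiv, φ.open_source, φ.open_target,
      contMDiffOn_of_mem_maximalAtlas hφ, contMDiffOn_symm_of_mem_maximalAtlas hφ⟩, hm,
      fun _ _ => rfl⟩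
  rw [h.isInteriorPoint_iff (by simp), φ.extend_target, interior_inter,
    (φ.open_target.preimage I.continuous_symm).interior_eq]
  have hc : extChartAt I (φ m) (φ m) = I (φ m) := by
    rw [extChartAt, chartAt_self_eq]; rfl
  rw [ModelWithCorners.IsInteriorPoint, hc]
  simp [φ.map_source hm]

theorem exists_localInverse [FiniteDimensional ℝ E] {ι : M → N} {m : M}
    (hι : IsImmersionAt I 𝓘(ℝ, E) ∞ ι m) (hm : m ∉ I.boundary M) :
    ∃ (r : N → M) (O : Set N), IsOpen O ∧ ι m ∈ O ∧ ContMDiffOn 𝓘(ℝ, E) I ∞ r O ∧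
      ∀ x ∈ O, r x ∉ I.boundary M ∧ ι (r x) = x := by
  set φ := hι.domChart
  set ψ := hι.codChart
  have hφ : φ ∈ IsManifold.maximalAtlas I ∞ M := hι.domChart_mem_maximalAtlas
  have hψ : ψ ∈ IsManifold.maximalAtlas 𝓘(ℝ, E) ∞ N := hι.codChart_mem_maximalAtlas
  have : FiniteDimensional ℝ (E × hι.complement) :=
    hι.equiv.symm.toLinearEquiv.finiteDimensional
  have : FiniteDimensional ℝ hι.complement :=
    Module.Finite.of_surjective (LinearMap.snd ℝ E hι.complement) LinearMap.snd_surjective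
  have hF : Module.finrank ℝ hι.complement = 0 := by
    have h := hι.equiv.toLinearEquiv.finrank_eq
    rw [Module.finrank_prod] at h
    omega
  have : Subsingleton hι.complement := Module.finrank_zero_iff.1 hF
  have hφm : m ∈ φ.source := hι.mem_domChart_source
  have hψm : ι m ∈ ψ.source := hι.mem_codChart_source
  let l : E → E := fun y => (hι.equiv.symm y).1
  have hl : ContDiff ℝ ∞ l := contDiff_fst.comp hι.equiv.symm.contDiff
  have hle : ∀ y, hι.equiv (l y, 0) = y := fun y => by
    rw [show (l y, (0 : hι.complement)) = hι.equiv.symm y from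
      Prod.ext rfl (Subsingleton.elim _ _), hι.equiv.apply_symm_apply]
  have hel : ∀ u, l (hι.equiv (u, 0)) = u := fun u => by simp [l]
  have hw : ∀ u ∈ (φ.extend I).target, ψ (ι ((φ.extend I).symm u)) = hι.equiv (u, 0) :=
    fun u hu => hι.writtenInCharts hu
  have hmt : φ.extend I m ∈ (φ.extend I).target :=
    (φ.extend I).map_source (by rwa [φ.extend_source])
  have hmm : (φ.extend I).symm (φ.extend I m) = m := φ.extend_left_inv hφm
  have hmi : φ.extend I m ∈ interior (φ.extend I).target := by
    refine (isInteriorPoint_iff_of_mem_maximalAtlas I hφ hφm).1 ?_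
    rwa [ModelWithCorners.isInteriorPoint_iff_not_isBoundaryPoint]
  have hlψ : ContinuousOn (fun x => l (ψ x)) ψ.source :=
    hl.continuous.comp_continuousOn ψ.continuousOn
  refine ⟨fun x => (φ.extend I).symm (l (ψ x)),
    ψ.source ∩ (fun x => l (ψ x)) ⁻¹' interior (φ.extend I).target,
    hlψ.isOpen_inter_preimage ψ.open_source isOpen_interior, ⟨hψm, ?_⟩, ?_, ?_⟩
  · have h := hw _ hmt
    rw [hmm] at h
    simpa only [mem_preimage, h, hel] using hmi
  · have h1 : ContMDiffOn 𝓘(ℝ, E) 𝓘(ℝ, E) ∞ (fun x => l (ψ x)) ψ.source :=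
      hl.contMDiff.comp_contMDiffOn (contMDiffOn_of_mem_maximalAtlas hψ)
    refine (contMDiffOn_extend_symm hφ).comp (h1.mono inter_subset_left) fun x hx => ?_
    have := interior_subset hx.2
    rw [φ.extend_target_eq_image_source] at this
    obtain ⟨z, hz, hzx⟩ := this
    exact ⟨φ z, φ.map_source hz, hzx⟩
  · rintro x ⟨hx, hx'⟩
    have ht : l (ψ x) ∈ (φ.extend I).target := interior_subset hx'
    have hs : (φ.extend I).symm (l (ψ x)) ∈ φ.source := by
      have := (φ.extend I).map_target ht
      rwa [φ.extend_source] at this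
    refine ⟨?_, ?_⟩
    · have := (isInteriorPoint_iff_of_mem_maximalAtlas I hφ hs).2
        (by rwa [(φ.extend I).right_inv ht])
      rwa [ModelWithCorners.isInteriorPoint_iff_not_isBoundaryPoint] at this
    · refine ψ.injOn (hι.source_subset_preimage_source hs) hx ?_
      rw [hw _ ht, hle]

theorem isOpen_image_compl_boundary [FiniteDimensional ℝ E] {ι : M → N}
    (hι : IsImmersion I 𝓘(ℝ, E) ∞ ι) : IsOpen (ι '' (I.boundary M)ᶜ) := by
  rw [isOpen_iff_forall_mem_open]
  rintro _ ⟨m, hm, rfl⟩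
  obtain ⟨r, O, hO, hmO, -, hr⟩ := exists_localInverse I (hι.isImmersionAt m) hm
  exact ⟨O, fun x hx => ⟨r x, (hr x hx).1, (hr x hx).2⟩, hO, hmO⟩

theorem contMDiffOn_invFun [FiniteDimensional ℝ E] [Nonempty M] {ι : M → N}
    (hι : IsImmersion I 𝓘(ℝ, E) ∞ ι) (hinj : Function.Injective ι) :
    ContMDiffOn 𝓘(ℝ, E) I ∞ (Function.invFun ι) (ι '' (I.boundary M)ᶜ) := by
  rintro _ ⟨m, hm, rfl⟩
  obtain ⟨r, O, hO, hmO, hrs, hr⟩ := exists_localInverse I (hι.isImmersionAt m) hm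
  refine ((hrs.contMDiffAt (hO.mem_nhds hmO)).congr_of_eventuallyEq ?_).contMDiffWithinAt
  filter_upwards [hO.mem_nhds hmO] with x hx
  rw [← (hr x hx).2, Function.leftInverse_invFun hinj, (hr x hx).2]

end LocalInverse

end ContactCut

namespace ContactCut

section OpenSubset

variable {E : Type*} [NormedAddCommGroup E] [NormedSpace ℝ E] {H : Type*} [TopologicalSpace H]
  {I : ModelWithCorners ℝ E H} {N : Type*} [TopologicalSpace N] [ChartedSpace H N]

/-- A retraction of the ambient space onto a nonempty open subset. -/
def retractOpens (U : Opens N) [Nonempty U] : N → U := Function.invFun Subtype.val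

theorem retractOpens_coe (U : Opens N) [Nonempty U] (p : U) : retractOpens U (p : N) = p :=
  Function.leftInverse_invFun Subtype.val_injective p

theorem coe_retractOpens (U : Opens N) [Nonempty U] {x : N} (hx : x ∈ U) :
    (retractOpens U x : N) = x :=
  congrArg Subtype.val (retractOpens_coe U ⟨x, hx⟩)

theorem contMDiffOn_retractOpens (U : Opens N) [Nonempty U] :
    ContMDiffOn I I ∞ (retractOpens U) (U : Set N) := fun x hx => by
  have h : ContMDiffAt I I ∞ (fun p : U => retractOpens U (p : N)) ⟨x, hx⟩ :=
    contMDiffAt_id.congr_of_eventuallyEq (.of_forall fun p => retractOpens_coe U p)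
  exact (contMDiffAt_subtype_iff.1 h).contMDiffWithinAt

theorem mfderiv_coe_retractOpens (U : Opens N) [Nonempty U] (p : U) (v : TangentSpace I (p : N)) :
    mfderiv I I (Subtype.val : U → N) p (mfderiv I I (retractOpens U) (p : N) v) = v := by
  have h1 : MDifferentiableAt I I (retractOpens U) (p : N) :=
    ((contMDiffOn_retractOpens U).contMDiffAt (U.isOpen.mem_nhds p.2)).mdifferentiableAt (by simp)
  have h2 : MDifferentiableAt I I (Subtype.val : U → N) (retractOpens U p) :=
    (contMDiff_subtype_val _).mdifferentiableAt (n := ∞) (by simp)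
  have h3 : (Subtype.val : U → N) ∘ retractOpens U =ᶠ[𝓝 (p : N)] id := by
    filter_upwards [U.isOpen.mem_nhds p.2] with x hx using coe_retractOpens U hx
  have h4 := mfderiv_comp (I := I) (I' := I) (I'' := I) (p : N) h2 h1
  rw [h3.mfderiv_eq, mfderiv_id] at h4
  have h5 := DFunLike.congr_fun h4 v
  rw [ContinuousLinearMap.comp_apply, retractOpens_coe] at h5
  exact h5.symm

end OpenSubset

namespace LocalCircleAction

variable {E : Type*} [NormedAddCommGroup E] [NormedSpace ℝ E]
  {N : Type*} [TopologicalSpace N] [ChartedSpace E N]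
  {α : OneForm 𝓘(ℝ, E) N} (U : Opens N) [MulAction Circle U]

open Classical in
/-- The extension by the identity of an action on an open subset. -/
def actOpens (c : Circle) (x : N) : N := if h : x ∈ U then (c • ⟨x, h⟩ : U) else x

theorem actOpens_coe (c : Circle) (p : U) : actOpens U c p = (c • p : U) := by
  rw [actOpens, dif_pos p.2]

variable [ContMDiffSMul (𝓡 1) 𝓘(ℝ, E) ∞ Circle U]

/-- A free circle action on an open subset that preserves the restricted form, as a local circle
action. -/
def ofOpens (hfree : ∀ (c : Circle) (p : U), c • p = p → c = 1)
    (hinv : ∀ c : Circle,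
      pullback 𝓘(ℝ, E) 𝓘(ℝ, E) (fun p : U => c • p)
          (pullback 𝓘(ℝ, E) 𝓘(ℝ, E) (Subtype.val : U → N) α)
        = pullback 𝓘(ℝ, E) 𝓘(ℝ, E) (Subtype.val : U → N) α) : LocalCircleAction α where
  dom := U
  act := actOpens U
  isOpen_dom := U.isOpen
  act_mem c x hx := by
    rw [actOpens_coe U c ⟨x, hx⟩]
    exact (c • (⟨x, hx⟩ : U)).2
  act_one x hx := by rw [actOpens_coe U 1 ⟨x, hx⟩, one_smul]
  act_mul c d x hx := by
    rw [actOpens_coe U d ⟨x, hx⟩, actOpens_coe, actOpens_coe U (c * d) ⟨x, hx⟩, mul_smul]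
  act_free c x hx h := hfree c ⟨x, hx⟩ (Subtype.ext (by rw [← actOpens_coe]; exact h))
  smooth := by
    rcases isEmpty_or_nonempty U with h | h
    · rintro ⟨c, x⟩ ⟨-, hx⟩
      exact h.elim ⟨x, hx⟩
    · have h1 : ContMDiffOn ((𝓡 1).prod 𝓘(ℝ, E)) ((𝓡 1).prod 𝓘(ℝ, E)) ∞
          (fun p : Circle × N => (p.1, retractOpens U p.2)) (univ ×ˢ (U : Set N)) :=
        contMDiff_fst.contMDiffOn.prodMk
          ((contMDiffOn_retractOpens U).comp contMDiff_snd.contMDiffOn fun p hp => hp.2)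
      have h2 : ContMDiff ((𝓡 1).prod 𝓘(ℝ, E)) 𝓘(ℝ, E) ∞
          (fun p : Circle × U => ((p.1 • p.2 : U) : N)) :=
        contMDiff_subtype_val.comp contMDiff_smul
      refine (h2.comp_contMDiffOn h1).congr ?_
      rintro ⟨c, x⟩ ⟨-, hx⟩
      change actOpens U c x = ((c • retractOpens U x : U) : N)
      rw [← actOpens_coe, coe_retractOpens U hx]
  invariant c x hx v := by
    have hU : Nonempty U := ⟨⟨x, hx⟩⟩
    obtain ⟨p, rfl⟩ : ∃ p : U, (p : N) = x := ⟨⟨x, hx⟩, rfl⟩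
    have hs : MDifferentiableAt 𝓘(ℝ, E) 𝓘(ℝ, E) (retractOpens U) (p : N) :=
      ((contMDiffOn_retractOpens U).contMDiffAt
        (U.isOpen.mem_nhds p.2)).mdifferentiableAt (by simp)
    have hc : ContMDiff 𝓘(ℝ, E) 𝓘(ℝ, E) ∞ (fun p : U => c • p) :=
      (contMDiff_smul (I := 𝓡 1)).comp (contMDiff_const.prodMk contMDiff_id)
    have hcd : ∀ y, MDifferentiableAt 𝓘(ℝ, E) 𝓘(ℝ, E) (fun p : U => c • p) y :=
      fun y => (hc y).mdifferentiableAt (by simp)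
    have hv : ∀ y, MDifferentiableAt 𝓘(ℝ, E) 𝓘(ℝ, E) (Subtype.val : U → N) y :=
      fun y => (contMDiff_subtype_val y).mdifferentiableAt (n := ∞) (by simp)
    have he : actOpens U c =ᶠ[𝓝 (p : N)]
        (Subtype.val : U → N) ∘ (fun p : U => c • p) ∘ retractOpens U := by
      filter_upwards [U.isOpen.mem_nhds p.2] with z hz
      rw [Function.comp_apply, Function.comp_apply, ← actOpens_coe, coe_retractOpens U hz]
    let w : E := mfderiv 𝓘(ℝ, E) 𝓘(ℝ, E) (retractOpens U) (p : N) v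
    have h1 : α (c • p : U) (mfderiv 𝓘(ℝ, E) 𝓘(ℝ, E) (Subtype.val : U → N) (c • p)
        (mfderiv 𝓘(ℝ, E) 𝓘(ℝ, E) (fun p : U => c • p) p w))
          = α p (mfderiv 𝓘(ℝ, E) 𝓘(ℝ, E) (Subtype.val : U → N) p w) :=
      DFunLike.congr_fun (congrFun (hinv c) p) w
    have h2 : (mfderiv 𝓘(ℝ, E) 𝓘(ℝ, E) (Subtype.val : U → N) p w : E) = v :=
      mfderiv_coe_retractOpens U p v
    have hA : HasMFDerivAt 𝓘(ℝ, E) 𝓘(ℝ, E) (fun p : U => c • p) (retractOpens U (p : N))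
        (mfderiv 𝓘(ℝ, E) 𝓘(ℝ, E) (fun p : U => c • p) p : E →L[ℝ] E) := by
      rw [retractOpens_coe]
      exact (hcd p).hasMFDerivAt
    have hB : HasMFDerivAt 𝓘(ℝ, E) 𝓘(ℝ, E) (Subtype.val : U → N)
        (((fun p : U => c • p) ∘ retractOpens U) (p : N))
        (mfderiv 𝓘(ℝ, E) 𝓘(ℝ, E) (Subtype.val : U → N) (c • p) : E →L[ℝ] E) := by
      rw [Function.comp_apply, retractOpens_coe]
      exact (hv _).hasMFDerivAt
    have h3 := ((hB.comp (p : N) (hA.comp (p : N) hs.hasMFDerivAt)).congr_of_eventuallyEq he).mfderiv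
    have key : ∀ (x y : N) (u u' : E), x = y → u = u' → α x u = α y u' := by
      rintro x _ u _ rfl rfl
      rfl
    exact (key _ _ _ _ (actOpens_coe U c p) (DFunLike.congr_fun h3 v)).trans
      (h1.trans (key _ _ _ _ rfl h2))

theorem moment_ofOpens (hfree : ∀ (c : Circle) (p : U), c • p = p → c = 1)
    (hinv : ∀ c : Circle,
      pullback 𝓘(ℝ, E) 𝓘(ℝ, E) (fun p : U => c • p)
          (pullback 𝓘(ℝ, E) 𝓘(ℝ, E) (Subtype.val : U → N) α)
        = pullback 𝓘(ℝ, E) 𝓘(ℝ, E) (Subtype.val : U → N) α) (p : U) :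
    (ofOpens U hfree hinv).moment p
      = momentMap 𝓘(ℝ, E) (pullback 𝓘(ℝ, E) 𝓘(ℝ, E) (Subtype.val : U → N) α) p := by
  have h1 : MDifferentiableAt 𝓘(ℝ, ℝ) 𝓘(ℝ, E) (fun t : ℝ => Circle.exp t • p) 0 := by
    have h : ContMDiff 𝓘(ℝ, ℝ) 𝓘(ℝ, E) ∞ (fun t : ℝ => Circle.exp t • p) :=
      contMDiff_smul.comp ((contMDiff_circleExp.of_le le_top).prodMk contMDiff_const)
    exact (h 0).mdifferentiableAt (by simp)
  have h2 : MDifferentiableAt 𝓘(ℝ, E) 𝓘(ℝ, E) (Subtype.val : U → N) (Circle.exp 0 • p) :=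
    (contMDiff_subtype_val _).mdifferentiableAt (n := ∞) (by simp)
  have h3 : (fun t : ℝ => actOpens U (Circle.exp t) p)
      = (Subtype.val : U → N) ∘ fun t : ℝ => Circle.exp t • p :=
    funext fun t => actOpens_coe U _ p
  have key : ∀ (x y : N) (f g : ℝ → N), x = y → f = g →
      α x (mfderiv 𝓘(ℝ, ℝ) 𝓘(ℝ, E) f 0 (1 : ℝ) : E)
        = α y (mfderiv 𝓘(ℝ, ℝ) 𝓘(ℝ, E) g 0 (1 : ℝ) : E) := by
    rintro x _ f _ rfl rfl
    rfl
  refine (key _ _ _ _ (actOpens_coe U _ p) h3).trans ?_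
  exact congrArg (fun L : ℝ →L[ℝ] E => α (Circle.exp 0 • p : U) (L 1))
    (mfderiv_comp (I' := 𝓘(ℝ, E)) (0 : ℝ) h2 h1)

end LocalCircleAction

end ContactCut

namespace ContactCut

section General

variable {E : Type*} [NormedAddCommGroup E] [NormedSpace ℝ E] {H : Type*} [TopologicalSpace H]
  {I : ModelWithCorners ℝ E H}
  {E' : Type*} [NormedAddCommGroup E'] [NormedSpace ℝ E'] {H' : Type*} [TopologicalSpace H']
  {I' : ModelWithCorners ℝ E' H'}
  {E'' : Type*} [NormedAddCommGroup E''] [NormedSpace ℝ E''] {H'' : Type*} [TopologicalSpace H'']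
  {I'' : ModelWithCorners ℝ E'' H''}
  {M : Type*} [TopologicalSpace M] [ChartedSpace H M]
  {N : Type*} [TopologicalSpace N] [ChartedSpace H' N]
  {P : Type*} [TopologicalSpace P] [ChartedSpace H'' P]

theorem contMDiff_of_coe {U : Opens N} {f : M → U} (hf : ContMDiff I I' ∞ fun x => (f x : N)) :
    ContMDiff I I' ∞ f := fun x => by
  have : Nonempty U := ⟨f x⟩
  have h := (contMDiffOn_retractOpens (I := I') U).comp_contMDiff hf fun x => (f x).2
  exact (h x).congr_of_eventuallyEq (.of_forall fun y => (retractOpens_coe U (f y)).symm)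

theorem pullback_pullback_apply {f : M → N} {g : N → P} {x : M} (α : OneForm I'' P)
    (hg : MDifferentiableAt I' I'' g (f x)) (hf : MDifferentiableAt I I' f x) :
    pullback I I' f (pullback I' I'' g α) x = pullback I I'' (g ∘ f) α x := by
  rw [pullback, pullback, pullback, mfderiv_comp (I' := I') x hg hf]
  rfl

end General

namespace CutData

variable {E : Type*} [NormedAddCommGroup E] [NormedSpace ℝ E] [FiniteDimensional ℝ E]
  {H : Type*} [TopologicalSpace H] (I : ModelWithCorners ℝ E H)
  {N : Type*} [TopologicalSpace N] [ChartedSpace E N] [IsManifold 𝓘(ℝ, E) ∞ N]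
  {Y : Type*} [NormedAddCommGroup Y] [NormedSpace ℝ Y] [FiniteDimensional ℝ Y]
  {α : OneForm 𝓘(ℝ, E) N} {𝒰 : LocalCircleAction α}
  {M X B : Type*} [TopologicalSpace M] [TopologicalSpace X] [TopologicalSpace B]
  [ChartedSpace H M] (𝒞 : CutData 𝒰 M X B)
  (hs : ∀ m ∈ 𝒞.b, ∃ σ : Slice 𝒰 Y, 𝒞.ι m ∈ σ.W)
  {V : Opens M} {W : Opens X}

theorem contMDiff_q_coe (hι : IsImmersion I 𝓘(ℝ, E) ∞ 𝒞.ι) (hV : (V : Set M) = 𝒞.bᶜ) : letI := (𝒞.cutAtlas hs).chartedSpace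
    ContMDiff I 𝓘(ℝ, E) ∞ (fun m : V => 𝒞.q m) := by
  let _ := (𝒞.cutAtlas hs).chartedSpace
  intro m
  have : Nonempty M := ⟨m⟩
  have hm : 𝒞.ι m ∈ 𝒞.ι '' 𝒞.bᶜ := mem_image_of_mem _ (hV ▸ m.2)
  have h1 : ContMDiffAt 𝓘(ℝ, E) 𝓘(ℝ, E) ∞ 𝒞.proj (𝒞.ι m) :=
    (𝒞.contMDiffOn_proj hs).contMDiffAt (𝒞.isOpen_image_compl.mem_nhds hm)
  have h2 : ContMDiffAt I 𝓘(ℝ, E) ∞ (fun m : V => 𝒞.ι m) m :=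
    (hι.contMDiff.comp contMDiff_subtype_val) m
  have h3 := ContMDiffAt.comp (g := 𝒞.proj) (f := fun m : V => 𝒞.ι m) m h1 h2
  exact h3.congr_of_eventuallyEq (.of_forall fun y => (𝒞.proj_ι y).symm)

/-- The quotient map restricts to a diffeomorphism from the complement of the boundary onto the
regular part of the cut space. -/
def diffeomorph (hι : IsImmersion I 𝓘(ℝ, E) ∞ 𝒞.ι) (hb : 𝒞.b = I.boundary M)
    (hV : (V : Set M) = 𝒞.bᶜ) (hW : (W : Set X) = 𝒞.regular) : letI := (𝒞.cutAtlas hs).chartedSpace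
    V ≃ₘ^∞⟮I, 𝓘(ℝ, E)⟯ W :=
  letI := (𝒞.cutAtlas hs).chartedSpace
  have hq : ∀ x, 𝒞.q (Function.surjInv 𝒞.isQuotientMap_q.surjective x) = x :=
    Function.surjInv_eq 𝒞.isQuotientMap_q.surjective
  have hmem : ∀ x : W, Function.surjInv 𝒞.isQuotientMap_q.surjective (x : X) ∈ V := fun x => by
    have h : (x : X) ∈ 𝒞.regular := hW ▸ x.2
    rw [← hq x, 𝒞.q_mem_regular] at h
    change _ ∈ (V : Set M)
    rwa [hV]
  { toFun := fun m => ⟨𝒞.q m, by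
      change _ ∈ (W : Set X)
      rw [hW, 𝒞.q_mem_regular]
      exact (hV ▸ m.2 : (m : M) ∈ 𝒞.bᶜ)⟩
    invFun := fun x => ⟨Function.surjInv 𝒞.isQuotientMap_q.surjective x, hmem x⟩
    left_inv := fun m => by
      have hm : (m : M) ∈ 𝒞.bᶜ := hV ▸ m.2
      rcases (𝒞.q_eq_iff _ _).1 (hq (𝒞.q m)) with h | h
      · exact Subtype.ext h
      · exact absurd h.2.1 hm
    right_inv := fun x => Subtype.ext (hq x)
    contMDiff_toFun := contMDiff_of_coe (𝒞.contMDiff_q_coe I hs hι hV)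
    contMDiff_invFun := contMDiff_of_coe fun x => by
      have : Nonempty M := ⟨(⟨_, hmem x⟩ : V)⟩
      have hx : (x : X) ∈ 𝒞.regular := hW ▸ x.2
      have hO : IsOpen (𝒞.ι '' (I.boundary M)ᶜ) := hb ▸ 𝒞.isOpen_image_compl
      have h1 : ContMDiffAt 𝓘(ℝ, E) 𝓘(ℝ, E) ∞ (fun x : W => 𝒞.lift x) x :=
        (((𝒞.contMDiffOn_lift hs).contMDiffAt (𝒞.isOpen_regular.mem_nhds hx)).comp x
          (contMDiff_subtype_val x))
      have h2 : ContMDiffAt 𝓘(ℝ, E) I ∞ (Function.invFun 𝒞.ι) (𝒞.lift x) := by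
        refine (contMDiffOn_invFun I hι 𝒞.isEmbedding_ι.injective).contMDiffAt
          (hO.mem_nhds (mem_image_of_mem _ ?_))
        have := hmem x
        rw [← hb, ← hV]
        exact this
      refine (h2.comp x h1).congr_of_eventuallyEq (.of_forall fun y => ?_)
      exact (Function.leftInverse_invFun 𝒞.isEmbedding_ι.injective _).symm }

theorem pullback_diffeomorph (hι : IsImmersion I 𝓘(ℝ, E) ∞ 𝒞.ι) (hb : 𝒞.b = I.boundary M)
    (hV : (V : Set M) = 𝒞.bᶜ) (hW : (W : Set X) = 𝒞.regular)
    (hα : IsSmoothForm 𝓘(ℝ, E) α) :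
    letI := (𝒞.cutAtlas hs).chartedSpace
    pullback I 𝓘(ℝ, E) (𝒞.diffeomorph I hs hι hb hV hW)
        (pullback 𝓘(ℝ, E) 𝓘(ℝ, E) (Subtype.val : W → X) (𝒞.cutOneForm hs))
      = pullback I 𝓘(ℝ, E) (fun m : V => 𝒞.ι m) α := by
  let _ := (𝒞.cutAtlas hs).chartedSpace
  funext m
  have hm : (m : M) ∉ 𝒞.b := show (m : M) ∈ 𝒞.bᶜ from hV ▸ m.2
  have hr : 𝒞.q m ∈ 𝒞.regular := (𝒞.q_mem_regular _).2 hm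
  have hlq : 𝒞.lift ∘ (fun m : V => 𝒞.q m) = fun m : V => 𝒞.ι m :=
    funext fun m => 𝒞.lift_q (show (m : M) ∈ 𝒞.bᶜ from hV ▸ m.2)
  have hqd : MDifferentiableAt I 𝓘(ℝ, E) (fun m : V => 𝒞.q m) m :=
    (𝒞.contMDiff_q_coe I hs hι hV m).mdifferentiableAt (by simp)
  have hld : MDifferentiableAt 𝓘(ℝ, E) 𝓘(ℝ, E) 𝒞.lift (𝒞.q m) :=
    ((𝒞.contMDiffOn_lift hs).contMDiffAt (𝒞.isOpen_regular.mem_nhds hr)).mdifferentiableAt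
      (by simp)
  rw [pullback_pullback_apply _ ((contMDiff_subtype_val _).mdifferentiableAt (n := ∞) (by simp))
    (((𝒞.diffeomorph I hs hι hb hV hW).contMDiff m).mdifferentiableAt (by simp)), ← hlq,
    ← pullback_pullback_apply (f := fun m : V => 𝒞.q m) α hld hqd]
  change (𝒞.cutOneForm hs (𝒞.q m)).comp _ = (pullback 𝓘(ℝ, E) 𝓘(ℝ, E) 𝒞.lift α (𝒞.q m)).comp _
  rw [𝒞.cutOneForm_eq_pullback hs hα hr]
  rfl

end CutData

end ContactCut

namespace ContactCut

variable {E : Type*} [NormedAddCommGroup E] [NormedSpace ℝ E]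
  {N : Type*} [TopologicalSpace N] [ChartedSpace E N]
  {α : OneForm 𝓘(ℝ, E) N} {U : Opens N} [MulAction Circle U]

theorem sameOrbit_iff {x y : N} (hy : y ∈ U) :
    SameOrbit U x y ↔ ∃ c, x = LocalCircleAction.actOpens U c y := by
  constructor
  · rintro ⟨hx, hy, c, h⟩
    exact ⟨c, by rw [LocalCircleAction.actOpens_coe U c ⟨y, hy⟩, ← h]⟩
  · rintro ⟨c, rfl⟩
    rw [LocalCircleAction.actOpens_coe U c ⟨y, hy⟩]
    exact ⟨(c • (⟨y, hy⟩ : U)).2, hy, c, rfl⟩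

variable [ContMDiffSMul (𝓡 1) 𝓘(ℝ, E) ∞ Circle U] {M : Type*} [TopologicalSpace M]

/-- The cut space of a circle action on an open subset. -/
def CutData.ofOpens (hfree : ∀ (c : Circle) (p : U), c • p = p → c = 1)
    (hinv : ∀ c : Circle,
      pullback 𝓘(ℝ, E) 𝓘(ℝ, E) (fun p : U => c • p)
          (pullback 𝓘(ℝ, E) 𝓘(ℝ, E) (Subtype.val : U → N) α)
        = pullback 𝓘(ℝ, E) 𝓘(ℝ, E) (Subtype.val : U → N) α)
    {b : Set M} {ι : M → N} (hι : IsEmbedding ι) (hb : IsOpen (ι '' bᶜ)) (hU : ι '' b ⊆ U)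
    (hzero : Subtype.val '' {p : U | momentMap 𝓘(ℝ, E)
        (pullback 𝓘(ℝ, E) 𝓘(ℝ, E) (Subtype.val : U → N) α) p = 0} = ι '' b)
    (hnonneg : Subtype.val '' {p : U | 0 ≤ momentMap 𝓘(ℝ, E)
        (pullback 𝓘(ℝ, E) 𝓘(ℝ, E) (Subtype.val : U → N) α) p} = (U : Set N) ∩ range ι) :
    CutData (LocalCircleAction.ofOpens U hfree hinv) M (CutSpace U b ι)
      (BoundaryQuotient U b ι) where
  b := b
  ι := ι
  q := cutMk U b ι
  p := boundaryMk U b ι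
  j := boundaryInclusion U b ι
  isEmbedding_ι := hι
  isOpen_image_compl := hb
  mem_b_iff m := by
    rw [← hι.injective.mem_set_image, ← hzero]
    constructor
    · rintro ⟨p, hp, h⟩
      rw [← h]
      exact ⟨p.2, (LocalCircleAction.moment_ofOpens U hfree hinv p).trans hp⟩
    · rintro ⟨hm, h⟩
      exact ⟨⟨_, hm⟩, (LocalCircleAction.moment_ofOpens U hfree hinv ⟨_, hm⟩).symm.trans h, rfl⟩
  mem_range_iff x hx := by
    rw [LocalCircleAction.moment_ofOpens U hfree hinv ⟨x, hx⟩]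
    have h : x ∈ range ι ↔ x ∈ (U : Set N) ∩ range ι := ⟨fun h => ⟨hx, h⟩, fun h => h.2⟩
    rw [h, ← hnonneg]
    constructor
    · rintro ⟨p, hp, rfl⟩
      exact hp
    · exact fun h => ⟨⟨x, hx⟩, h, rfl⟩
  isQuotientMap_q := isQuotientMap_quot_mk
  isQuotientMap_p := isQuotientMap_quot_mk
  q_eq_iff m m' := by
    refine Quotient.eq.trans (or_congr Iff.rfl (and_congr_right fun _ => and_congr_right fun h => ?_))
    exact sameOrbit_iff (hU (mem_image_of_mem ι h))
  p_eq_iff m m' := by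
    have hm' : ι m' ∈ U := hU (mem_image_of_mem ι m'.2)
    refine Quotient.eq.trans ((?_ : _ ↔ SameOrbit U (ι m) (ι m')).trans (sameOrbit_iff hm'))
    constructor
    · rintro (h | h)
      · have h : (m : M) = m' := h
        rw [h]
        exact ⟨hm', hm', 1, (one_smul _ _).symm⟩
      · exact h.2.2
    · exact fun h => Or.inr ⟨m.2, m'.2, h⟩
  j_p _ := rfl

end ContactCut

end

theorem mainTheorem4 (n : ℕ)
    -- the contact manifold `(N, α)` of dimension `2n+1`
    {N : Type*} [TopologicalSpace N] [T2Space N] [SecondCountableTopology N]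
    [ChartedSpace (EuclideanSpace ℝ (Fin (2 * n + 1))) N] [IsManifold (𝓡 (2 * n + 1)) ∞ N]
    (α : OneForm (𝓡 (2 * n + 1)) N) (hα : IsContactForm (𝓡 (2 * n + 1)) α)
    -- the manifold with boundary `M` of the same dimension, embedded in `N`
    {M : Type*} [TopologicalSpace M]
    [ChartedSpace (EuclideanHalfSpace (2 * n + 1)) M] [IsManifold (𝓡∂ (2 * n + 1)) ∞ M]
    (ι : M → N) (hι : IsSmoothEmbedding (𝓡∂ (2 * n + 1)) (𝓡 (2 * n + 1)) ∞ ι)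
    -- the neighbourhood `U` of `∂M` with its free smooth circle action preserving `α`
    (U : Opens N) (hU : ι '' bdry (2 * n + 1) M ⊆ U)
    [MulAction Circle U] [ContMDiffSMul (𝓡 1) (𝓡 (2 * n + 1)) ∞ Circle U]
    (hfree : ∀ (c : Circle) (p : U), c • p = p → c = 1)
    (αU : OneForm (𝓡 (2 * n + 1)) U)
    (hαU : αU = pullback (𝓡 (2 * n + 1)) (𝓡 (2 * n + 1)) (Subtype.val : U → N) α)
    (hinv : ∀ c : Circle,
      pullback (𝓡 (2 * n + 1)) (𝓡 (2 * n + 1)) (fun p : U => c • p) αU = αU)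
    -- the two conditions on the moment map
    (hzero : Subtype.val '' {p : U | momentMap (𝓡 (2 * n + 1)) αU p = 0}
      = ι '' bdry (2 * n + 1) M)
    (hnonneg : Subtype.val '' {p : U | 0 ≤ momentMap (𝓡 (2 * n + 1)) αU p}
      = (U : Set N) ∩ range ι) :
    let b : Set M := bdry (2 * n + 1) M
    -- the smooth structures on `∂M`, `B = ∂M / S¹` and `X = M / ∼`
    ∃ (_ : ChartedSpace (EuclideanSpace ℝ (Fin (2 * n))) b)
      (_ : ChartedSpace (EuclideanSpace ℝ (Fin (2 * n - 1))) (BoundaryQuotient U b ι))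
      (_ : ChartedSpace (EuclideanSpace ℝ (Fin (2 * n + 1))) (CutSpace U b ι))
      (_ : IsManifold (𝓡 (2 * n)) ∞ b)
      (_ : IsManifold (𝓡 (2 * n - 1)) ∞ (BoundaryQuotient U b ι))
      (_ : IsManifold (𝓡 (2 * n + 1)) ∞ (CutSpace U b ι))
      (β : OneForm (𝓡 (2 * n + 1)) (CutSpace U b ι)),
      -- `∂M` has the structure induced from `N`, and `B` the quotient structure
      IsSmoothEmbedding (𝓡 (2 * n)) (𝓡 (2 * n + 1)) ∞ (fun p : b => ι p) ∧
      IsSubmersion (𝓡 (2 * n)) (𝓡 (2 * n - 1)) ∞ (boundaryMk U b ι) ∧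
      -- `(X, β)` is a contact manifold
      T2Space (CutSpace U b ι) ∧ SecondCountableTopology (CutSpace U b ι) ∧
      IsContactForm (𝓡 (2 * n + 1)) β ∧
      -- `B` is a contact submanifold of `(X, β)`, with the form induced by `α` on `∂M`
      IsSmoothEmbedding (𝓡 (2 * n - 1)) (𝓡 (2 * n + 1)) ∞ (boundaryInclusion U b ι) ∧
      IsContactForm (𝓡 (2 * n - 1))
        (pullback (𝓡 (2 * n - 1)) (𝓡 (2 * n + 1)) (boundaryInclusion U b ι) β) ∧
      pullback (𝓡 (2 * n)) (𝓡 (2 * n - 1)) (boundaryMk U b ι)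
          (pullback (𝓡 (2 * n - 1)) (𝓡 (2 * n + 1)) (boundaryInclusion U b ι) β)
        = pullback (𝓡 (2 * n)) (𝓡 (2 * n + 1)) (fun p : b => ι p) α ∧
      -- the quotient map restricts to a diffeomorphism `M ∖ ∂M → X ∖ B` taking `α` to `β`
      ∃ Φ : sourceComplement (isClosed_bdry (2 * n + 1) M)
          ≃ₘ^∞⟮𝓡∂ (2 * n + 1), 𝓡 (2 * n + 1)⟯
          cutComplement U b ι (isClosed_bdry (2 * n + 1) M),
        (∀ m, (Φ m : CutSpace U b ι) = cutMk U b ι m) ∧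
        pullback (𝓡∂ (2 * n + 1)) (𝓡 (2 * n + 1)) Φ
            (pullback (𝓡 (2 * n + 1)) (𝓡 (2 * n + 1))
              (Subtype.val : cutComplement U b ι (isClosed_bdry (2 * n + 1) M) →
                CutSpace U b ι) β)
          = pullback (𝓡∂ (2 * n + 1)) (𝓡 (2 * n + 1))
              (fun m : sourceComplement (isClosed_bdry (2 * n + 1) M) => ι m) α := by
  subst hαU
  intro b
  have hbdry : IsOpen (ι '' bᶜ) := isOpen_image_compl_boundary _ hι.isImmersion
  let 𝒞 := CutData.ofOpens hfree hinv hι.isEmbedding hbdry hU hzero hnonneg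
  have hslice : ∀ m ∈ 𝒞.b, ∃ σ : Slice (LocalCircleAction.ofOpens U hfree hinv)
      (EuclideanSpace ℝ (Fin (2 * n - 1))), 𝒞.ι m ∈ σ.W ∧ σ.angle (𝒞.ι m) = 1 := fun m hm => by
    obtain ⟨h1, h2⟩ := (𝒞.mem_b_iff m).1 hm
    have h3 := LocalCircleAction.two_le_finrank _ hα h1 h2
    refine LocalCircleAction.exists_slice _ hα ?_ h1 h2
    rw [finrank_euclideanSpace_fin] at h3 ⊢
    rw [finrank_euclideanSpace_fin]
    omega
  have hs : ∀ m ∈ 𝒞.b, ∃ σ : Slice (LocalCircleAction.ofOpens U hfree hinv)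
      (EuclideanSpace ℝ (Fin (2 * n - 1))), 𝒞.ι m ∈ σ.W := fun m hm => by
    obtain ⟨σ, h, -⟩ := hslice m hm
    exact ⟨σ, h⟩
  have hb : ∀ m : 𝒞.b, ∃ σ : Slice (LocalCircleAction.ofOpens U hfree hinv)
      (EuclideanSpace ℝ (Fin (2 * n - 1))), 𝒞.ιb m ∈ σ.cutDom := fun m => by
    obtain ⟨σ, h, h'⟩ := hslice m m.2
    refine ⟨σ, h, ?_⟩
    change (σ.angle (𝒞.ι m) : ℂ) ∈ Complex.slitPlane
    rw [h', Circle.coe_one]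
    exact Complex.one_mem_slitPlane
  have hE₁ : Module.finrank ℝ (EuclideanSpace ℝ (Fin (2 * n + 1)))
      = Module.finrank ℝ (EuclideanSpace ℝ (Fin (2 * n))) + 1 := by
    rw [finrank_euclideanSpace_fin, finrank_euclideanSpace_fin]
  have hsec : SecondCountableTopology M := hι.isEmbedding.secondCountableTopology
  have hlc : LocallyCompactSpace M :=
    have := (𝓡∂ (2 * n + 1)).locallyCompactSpace
    ChartedSpace.locallyCompactSpace (EuclideanHalfSpace (2 * n + 1)) M
  have hσ : SigmaCompactSpace (CutSpace U b ι) := 𝒞.sigmaCompactSpace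
  have hW : (cutComplement U b ι (isClosed_bdry (2 * n + 1) M) : Set (CutSpace U b ι))
      = 𝒞.regular := by
    ext x
    obtain ⟨m, rfl⟩ := 𝒞.isQuotientMap_q.surjective x
    rw [𝒞.q_mem_regular]
    exact not_congr (Set.ext_iff.1 (preimage_range_boundaryInclusion U b ι) m)
  let c₁ : ChartedSpace (EuclideanSpace ℝ (Fin (2 * n))) b :=
    (𝒞.boundaryAtlas hE₁ hb).chartedSpace
  let c₂ : ChartedSpace (EuclideanSpace ℝ (Fin (2 * n - 1))) (BoundaryQuotient U b ι) :=
    (𝒞.orbitAtlas hs).chartedSpace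
  let c₃ : ChartedSpace (EuclideanSpace ℝ (Fin (2 * n + 1))) (CutSpace U b ι) :=
    (𝒞.cutAtlas hs).chartedSpace
  have hιb : IsImmersionOfComplement ℝ (𝓡 (2 * n)) (𝓡 (2 * n + 1)) ∞ (fun p : b => ι p) :=
    𝒞.isImmersionOfComplement_ιb hE₁ hb
  have hp : IsSubmersionOfComplement ℝ (𝓡 (2 * n)) (𝓡 (2 * n - 1)) ∞ (boundaryMk U b ι) :=
    𝒞.isSubmersionOfComplement_p hE₁ hb hs
  have hj : IsImmersionOfComplement ℂ (𝓡 (2 * n - 1)) (𝓡 (2 * n + 1)) ∞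
      (boundaryInclusion U b ι) := 𝒞.isImmersionOfComplement_j hs
  refine ⟨c₁, c₂, c₃, (𝒞.boundaryAtlas hE₁ hb).isManifold,
    (𝒞.orbitAtlas hs).isManifold, (𝒞.cutAtlas hs).isManifold, 𝒞.cutOneForm hs,
    ⟨hιb.isImmersion, 𝒞.isEmbedding_ιb⟩,
    ⟨ℝ, inferInstance, inferInstance, hp⟩,
    𝒞.t2Space, ChartedSpace.secondCountable_of_sigmaCompact (EuclideanSpace ℝ (Fin (2 * n + 1))) _,
    𝒞.isContactForm_cutOneForm hs hα,
    ⟨hj.isImmersion, 𝒞.isClosedEmbedding_j.isEmbedding⟩,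
    𝒞.isContactForm_pullback_j hs hα, 𝒞.pullback_p_pullback_j hE₁ hb hs hα.smooth,
    𝒞.diffeomorph _ hs hι.isImmersion rfl rfl hW, fun _ => rfl,
    𝒞.pullback_diffeomorph _ hs hι.isImmersion rfl rfl hW hα.smooth⟩
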